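/- For $u\in\mathbb R$, $\sigma^2>0$ and an integer $n\ge 1$ let $\mathrm{GOE}(n;u,\sigma^2)$ be the law of the random real symmetric $n\times n$ matrix $A$ with probability density $$\sqrt2^{\,-n}\,\sqrt{\pi\sigma^2}^{\,-n(n+1)/2}\exp\Big(-\tfrac1{2\sigma^2}\operatorname{Trace}\big[(A+uI)^2\big]\Big)$$ with respect to $dA=\prod_{i\le j}da_{ij}$, and put $$\mathcal I_n(u)=\mathbb E_{A\sim \mathrm{GOE}(n;u,1)}|\det A|,\qquad \mathcal J_n(u)=\mathbb E_{A\sim \mathrm{GOE}(n;u,1)}\det A .$$ Let $P_k$ for $k=0,1,2,\dots$ be the $k$-th probabilists' Hermite polynomial, and let $P_{-1}(x)=-e^{x^2/2}\int_{-\infty}^x e^{-t^2/2}\,dt$. **Theorem 1.1.** Let $u\in\mathbb R$ and let $m\ge 1$ be an integer. The determinant is integrable with respect to $\mathrm{GOE}(n;u,1)$ for every $n$, and the following holds. 1. If $n=2m$, then $$\mathcal I_n(u)=\mathcal J_n(u)+\frac{\sqrt{2\pi}\,e^{-u^2/2}}{\prod_{i=1}^n\Gamma(i/2)}\sum_{1\le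 i,j\le m}\det(\Gamma_1^{i,j})\,\det\begin{bmatrix}P_{2i-1}(u)&P_{2j}(u)\\P_{2i-2}(u)&P_{2j-1}(u)\end{bmatrix},$$ where $\Gamma_1^{i,j}=\big[\Gamma(r+s-\tfrac12)\big]_{1\le r\le m,\,r\ne i;\;1\le s\le m,\,s\ne j}$. 2. If $n=2m-1$, then $$\mathcal I_n(u)=\mathcal J_n(u)+\frac{\sqrt2\,e^{-u^2/2}}{\prod_{i=1}^n\Gamma(i/2)}\sum_{0\le i,j\le m-1}\det(\Gamma_2^{i,j})\,\det\begin{bmatrix}P_{2i}(u)&P_{2j+1}(u)\\P_{2i-1}(u)&P_{2j}(u)\end{bmatrix},$$ where $\Gamma_2^{i,j}=\big[\Gamma(r+s+\tfrac12)\big]_{0\le r\le m-1,\,r\ne i;\;0\le s\le m-1,\,s\ne j}$. The determinant of the empty ($0\times0$) matrix is $1$. -/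

import Mathlib

open MeasureTheory Real

/-- The product (equivalently Borel) σ-algebra on real `n × n` matrices. -/
instance matrixMeasurableSpace (n : ℕ) : MeasurableSpace (Matrix (Fin n) (Fin n) ℝ) :=
  MeasurableSpace.pi

/-- Index set `{(i, j) : i ≤ j}` of the free entries of a symmetric `n × n` matrix. -/
abbrev UpperIdx (n : ℕ) : Type := {p : Fin n × Fin n // p.1 ≤ p.2}

/-- The symmetric matrix whose entries on and above the diagonal are the given ones. -/
def symMatrix (n : ℕ) (a : UpperIdx n → ℝ) : Matrix (Fin n) (Fin n) ℝ :=
  Matrix.of fun i j => a ⟨(min i j, max i j), min_le_max⟩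

/-- The Lebesgue measure `dA = ∏_{i ≤ j} da_{ij}` of the space of real symmetric `n × n` matrices,
as a measure on all real `n × n` matrices. -/
noncomputable def symLebesgue (n : ℕ) : Measure (Matrix (Fin n) (Fin n) ℝ) :=
  Measure.map (symMatrix n) volume

/-- The probability density of `GOE(n; u, v)` with respect to `symLebesgue n`; here `v > 0` is the
parameter `σ²`. The exponent of `√(π v)` is the dimension `n (n + 1) / 2` (an exact division). -/
noncomputable def goeDensity (n : ℕ) (u v : ℝ) (A : Matrix (Fin n) (Fin n) ℝ) : ℝ :=
  (√2 ^ n)⁻¹ * (√(π * v) ^ (n * (n + 1) / 2))⁻¹ *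
    exp (-(1 / (2 * v)) * Matrix.trace ((A + u • (1 : Matrix (Fin n) (Fin n) ℝ)) ^ 2))

/-- The law `GOE(n; u, v)`: a random symmetric matrix with mean `-u I`. -/
noncomputable def goe (n : ℕ) (u v : ℝ) : Measure (Matrix (Fin n) (Fin n) ℝ) :=
  (symLebesgue n).withDensity fun A => ENNReal.ofReal (goeDensity n u v A)

/-- `I_n(u)`, the expected absolute value of the determinant of `A ∼ GOE(n; u, 1)`. -/
noncomputable def expAbsDet (n : ℕ) (u : ℝ) : ℝ := ∫ A, |A.det| ∂(goe n u 1)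

/-- `J_n(u)`, the expected determinant of `A ∼ GOE(n; u, 1)`. -/
noncomputable def expDet (n : ℕ) (u : ℝ) : ℝ := ∫ A, A.det ∂(goe n u 1)

/-- The functions `P_k`, `k = -1, 0, 1, 2, …`: the probabilists' Hermite polynomials for `k ≥ 0`,
and `P_{-1}(x) = -e^{x²/2} ∫_{-∞}^x e^{-t²/2} dt`. (Indices below `-1` are never used.) -/
noncomputable def hermiteP : ℤ → ℝ → ℝ
  | Int.ofNat k, x => Polynomial.aeval x (Polynomial.hermite k)
  | Int.negSucc _, x => -exp (x ^ 2 / 2) * ∫ t in Set.Iic x, exp (-(t ^ 2 / 2))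

/-- The matrix `[Γ(r + s - 1/2)]` with `1 ≤ r, s ≤ m`; `r : Fin m` stands for the index `r + 1`. -/
noncomputable def gammaMatrix₁ (m : ℕ) : Matrix (Fin m) (Fin m) ℝ :=
  Matrix.of fun r s => Gamma (((r : ℝ) + 1) + ((s : ℝ) + 1) - 1 / 2)

/-- The matrix `[Γ(r + s + 1/2)]` with `0 ≤ r, s ≤ m - 1`. -/
noncomputable def gammaMatrix₂ (m : ℕ) : Matrix (Fin m) (Fin m) ℝ :=
  Matrix.of fun r s => Gamma ((r : ℝ) + (s : ℝ) + 1 / 2)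

/-- The matrix `M` with row `i` and column `j` deleted. -/
def deleteRowCol {k : ℕ} (M : Matrix (Fin (k + 1)) (Fin (k + 1)) ℝ) (i j : Fin (k + 1)) :
    Matrix (Fin k) (Fin k) ℝ :=
  M.submatrix i.succAbove j.succAbove

/-! Write `n = k + 1` for the size and `A = X - u I` with `X` centred, so that `u → -∞` pushes `A`
towards a large positive multiple of `I`. For a functional `F` that is invariant under orthogonal
conjugation and homogeneous of degree `d`, let `Φ(u) = E F(A)`. Derivatives in `u` bring down traces
of `A`. Euler's identity for homogeneous functions and rotation invariance turn the traces into
moments of the first diagonal entry. The outcome is a Hermite equation with a source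
(`shiftIntegral_ode`): `Φ''/2 - u Φ' + d Φ = n (n + 2) / 2 · E[F(A) ((A₀₀ + u)² - 1)]`.

The determinant is affine in `A₀₀`, with slope `det C` for the lower right block `C`, and `t² - 1`
against the standard Gaussian acts as a second derivative. For `F = det²` the source is therefore a
multiple of the second moment in size `n - 1`. For `F = |det| - det` the second derivative is a
point mass at the value of `A₀₀` that makes `A` singular. Writing the rest of the first row as `C
y`, and then replacing `C` by `P C Pᵀ` with `P² = 1 + y yᵀ`, absorbs all the Gaussian factors, and
the source is `exp (-u² / 2)` times the same second moment (`integral_source_abs_det_sub`).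

A solution of the homogeneous equation that is `o(|u|^d)` at `-∞` vanishes (`hermite_ode_eq_zero`).
So it suffices to exhibit closed forms with the right source and the right growth: `goeSquare` for
`det²` and `goeExcess` for `|det| - det`, the latter up to a constant.

The sums over minors are evaluated separately. The Hankel matrices `[Γ(r + s + a)]` are moment
matrices of Laguerre weights, so their minors are sums of products of Laguerre coefficients
(`sum_minors_gammaHankel`). Combining the `P_k` with these coefficients gives back the rescaled
Hermite polynomials and their Gaussian antiderivatives, and the remaining single sum telescopes to
`goeExcess` (`minors_formula_even`, `minors_formula_odd`). -/

/-! ### Rescaled Hermite polynomials and quadratic forms in them. -/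

/-- The expected characteristic polynomials `E det (X - u)` of the centred ensemble: rescaled
physicists' Hermite polynomials. -/
noncomputable def goeHermite : ℕ → ℝ → ℝ
  | 0, _ => 1
  | 1, u => -u
  | n + 2, u => -u * goeHermite (n + 1) u - (n + 1) / 2 * goeHermite n u

lemma goeHermite_add_two (n : ℕ) (u : ℝ) :
    goeHermite (n + 2) u = -u * goeHermite (n + 1) u - (n + 1) / 2 * goeHermite n u := by
  rw [goeHermite]

lemma hasDerivAt_goeHermite_succ (n : ℕ) (u : ℝ) :
    HasDerivAt (goeHermite (n + 1)) (-(n + 1) * goeHermite n u) u := by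
  induction n using Nat.strong_induction_on with
  | _ n ih =>
    match n with
    | 0 =>
      have : goeHermite (0 + 1) = fun u => -u := by ext; simp [goeHermite]
      rw [this]
      exact (hasDerivAt_id u).neg.congr_deriv (by simp [goeHermite])
    | 1 =>
      have : goeHermite (1 + 1) = fun u => -u * -u - 1 / 2 := by ext; simp [goeHermite]
      rw [this]
      refine (((hasDerivAt_id u).neg.mul (hasDerivAt_id u).neg).sub_const (1 / 2)).congr_deriv ?_
      simp [goeHermite]; ring
    | n + 2 =>
      have h1 := ih (n + 1) (by omega)
      have h0 := ih n (by omega)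
      have : goeHermite (n + 2 + 1) = fun u => -u * goeHermite (n + 1 + 1) u -
          ((n + 1 : ℕ) + 1) / 2 * goeHermite (n + 1) u := by
        ext; exact goeHermite_add_two (n + 1) _
      rw [this]
      refine (((hasDerivAt_id u).neg.mul h1).sub (h0.const_mul _)).congr_deriv ?_
      have e := goeHermite_add_two n u
      simp only [Pi.neg_apply, id]
      rw [show n + 1 + 1 = n + 2 from rfl, e]
      push_cast
      ring

/-- Raising the index instead of lowering it keeps the derivative in the span of two consecutive
polynomials over the polynomials in `u`. This is what makes the family `hermiteQuad n` closed under
differentiation. -/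
lemma hasDerivAt_goeHermite (n : ℕ) (u : ℝ) :
    HasDerivAt (goeHermite n) (2 * goeHermite (n + 1) u + 2 * u * goeHermite n u) u := by
  cases n with
  | zero =>
    have : goeHermite 0 = fun _ => 1 := by ext; simp [goeHermite]
    rw [this]
    refine (hasDerivAt_const u (1 : ℝ)).congr_deriv ?_
    simp [goeHermite]
  | succ n =>
    refine (hasDerivAt_goeHermite_succ n u).congr_deriv ?_
    rw [goeHermite_add_two]; ring

/-- A quadratic form in `goeHermite n` and `goeHermite (n + 1)` with coefficients `x, y, z`. -/
noncomputable def hermiteQuad (n : ℕ) (x y z : ℝ → ℝ) (u : ℝ) : ℝ :=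
  x u * goeHermite n u ^ 2 + y u * (goeHermite n u * goeHermite (n + 1) u) +
    z u * goeHermite (n + 1) u ^ 2

lemma hasDerivAt_hermiteQuad {x y z : ℝ → ℝ} {x' y' z' u : ℝ} (n : ℕ) (hx : HasDerivAt x x' u)
    (hy : HasDerivAt y y' u) (hz : HasDerivAt z z' u) :
    HasDerivAt (hermiteQuad n x y z)
      ((x' + 4 * u * x u - (n + 1) * y u) * goeHermite n u ^ 2 +
        (4 * x u + y' + 2 * u * y u - 2 * (n + 1) * z u) *
          (goeHermite n u * goeHermite (n + 1) u) +
        (2 * y u + z') * goeHermite (n + 1) u ^ 2) u := by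
  have hp := hasDerivAt_goeHermite n u
  have hq := hasDerivAt_goeHermite_succ n u
  refine (((hx.mul (hp.pow 2)).add (hy.mul (hp.mul hq))).add (hz.mul (hq.pow 2))).congr_deriv ?_
  simp only [Pi.mul_apply, Pi.pow_apply]
  push_cast
  ring

/-! ### The closed form of the second moment. -/

/-- The second moment polynomials `E det (X - u) ^ 2` of the centred ensemble. -/
noncomputable def goeSquare (k : ℕ) (u : ℝ) : ℝ :=
  -(4 / (3 * (k + 1))) * hermiteQuad (k + 1) (fun u => (k + 2) / 2 * (u ^ 2 - 2 * (k + 1)))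
    (fun u => u ^ 3 - (2 * (k + 1) + 1 / 2) * u) (fun u => u ^ 2 - 2 * (k + 1) - 1) u

/-- The derivative of `goeSquare`. -/
noncomputable def goeSquareDeriv (k : ℕ) (u : ℝ) : ℝ :=
  -(4 / (3 * (k + 1))) * hermiteQuad (k + 1)
    (fun u => (k + 2) * (u ^ 3 + (3 / 2 - 2 * (k + 1)) * u))
    (fun u => 2 * u ^ 4 + (2 - 4 * (k + 1)) * u ^ 2 + 3 / 2)
    (fun u => 2 * u ^ 3 - (4 * (k + 1) - 1) * u) u

/-- The second derivative of `goeSquare`. -/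
noncomputable def goeSquareDeriv₂ (k : ℕ) (u : ℝ) : ℝ :=
  -(4 / (3 * (k + 1))) * hermiteQuad (k + 1)
    (fun u => (k + 2) * (2 * u ^ 4 + (7 - 4 * (k + 1)) * u ^ 2 - 2 * (k + 1)))
    (fun u => 4 * u ^ 5 + (12 - 8 * (k + 1)) * u ^ 3 + (11 - 4 * (k + 1)) * u)
    (fun u => 4 * u ^ 4 + (10 - 8 * (k + 1)) * u ^ 2 + 4 - 4 * (k + 1)) u

lemma hasDerivAt_goeSquare (k : ℕ) (u : ℝ) :
    HasDerivAt (goeSquare k) (goeSquareDeriv k u) u := by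
  have i := hasDerivAt_id u
  refine ((hasDerivAt_hermiteQuad (k + 1)
    ((((i.pow 2).sub_const (2 * ((k : ℝ) + 1))).const_mul (((k : ℝ) + 2) / 2)))
    ((i.pow 3).sub (i.const_mul (2 * ((k : ℝ) + 1) + 1 / 2)))
    (((i.pow 2).sub_const (2 * ((k : ℝ) + 1))).sub_const 1)).const_mul
      (-(4 / (3 * ((k : ℝ) + 1))))).congr_deriv ?_
  simp only [goeSquareDeriv, hermiteQuad, Pi.sub_apply, Pi.pow_apply, id]
  push_cast
  ring

lemma hasDerivAt_goeSquareDeriv (k : ℕ) (u : ℝ) :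
    HasDerivAt (goeSquareDeriv k) (goeSquareDeriv₂ k u) u := by
  have i := hasDerivAt_id u
  refine ((hasDerivAt_hermiteQuad (k + 1)
    ((((i.pow 3).add (i.const_mul (3 / 2 - 2 * ((k : ℝ) + 1)))).const_mul ((k : ℝ) + 2)))
    ((((i.pow 4).const_mul 2).add ((i.pow 2).const_mul (2 - 4 * ((k : ℝ) + 1)))).add_const (3 / 2))
    (((i.pow 3).const_mul 2).sub (i.const_mul (4 * ((k : ℝ) + 1) - 1)))).const_mul
      (-(4 / (3 * ((k : ℝ) + 1))))).congr_deriv ?_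
  simp only [goeSquareDeriv₂, hermiteQuad, Pi.sub_apply, Pi.add_apply, Pi.pow_apply, id]
  push_cast
  ring

lemma goeSquare_zero (u : ℝ) : goeSquare 0 u = 1 := by
  simp [goeSquare, hermiteQuad, goeHermite]; ring

/-- This is the equation that `shiftIntegral_ode` and `integral_source_det_sq` give for `det ^ 2`
after normalization. Once the highest Hermite polynomial is eliminated by the recurrence, both sides
are quadratic forms in the same two polynomials. -/
lemma goeSquare_ode (k : ℕ) (u : ℝ) :
    1 / 2 * goeSquareDeriv₂ (k + 1) u - u * goeSquareDeriv (k + 1) u +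
      2 * ((k + 1 : ℕ) : ℝ) * goeSquare (k + 1) u =
        ((k + 1 : ℕ) : ℝ) * ((k + 1 : ℕ) + 2) * goeSquare k u := by
  have h1 : (k : ℝ) + 1 ≠ 0 := by positivity
  have h2 : (k : ℝ) + 1 + 1 ≠ 0 := by positivity
  simp only [goeSquareDeriv₂, goeSquareDeriv, goeSquare, hermiteQuad]
  rw [goeHermite_add_two (k + 1)]
  push_cast
  field_simp
  ring

/-- The definition of `goeSquare k` hides its degree: single terms have degree up to `2 k + 6`, but
the sum has degree `2 k`. Here the leading part `u ^ 2 * goeSquare k u` of the next polynomial is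
visible, which allows an induction on the degree. -/
lemma goeSquare_succ (k : ℕ) (u : ℝ) :
    goeSquare (k + 1) u = (1 + k / 2 + u ^ 2) * goeSquare k u - 3 / 4 * u * goeSquareDeriv k u +
      1 / 8 * goeSquareDeriv₂ k u := by
  have h1 : (k : ℝ) + 1 ≠ 0 := by positivity
  have h2 : (k : ℝ) + 1 + 1 ≠ 0 := by positivity
  simp only [goeSquareDeriv₂, goeSquareDeriv, goeSquare, hermiteQuad]
  rw [goeHermite_add_two (k + 1)]
  push_cast
  field_simp
  ring

open Polynomial in
/-- `goeSquare` as a polynomial. -/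
lemma exists_polynomial_goeSquare (k : ℕ) :
    ∃ p : ℝ[X], p.Monic ∧ p.natDegree = 2 * k ∧ ∀ u, p.eval u = goeSquare k u := by
  induction k with
  | zero => exact ⟨1, monic_one, by simp, fun u => by simp [goeSquare_zero]⟩
  | succ k ih =>
    obtain ⟨p, hm, hd, he⟩ := ih
    have hfun : (fun u => p.eval u) = goeSquare k := funext he
    have h1 : ∀ u, p.derivative.eval u = goeSquareDeriv k u := fun u => by
      have := p.hasDerivAt u
      rw [hfun] at this
      exact this.unique (hasDerivAt_goeSquare k u)
    have h2 : ∀ u, p.derivative.derivative.eval u = goeSquareDeriv₂ k u := fun u => by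
      have := p.derivative.hasDerivAt u
      rw [funext h1] at this
      exact this.unique (hasDerivAt_goeSquareDeriv k u)
    -- All of the recursion except `X ^ 2 * p`. None of its three terms has degree above that of
    -- `p`, so it does not affect the leading term.
    let r : ℝ[X] := C (1 + (k : ℝ) / 2) * p - C (3 / 4) * (X * p.derivative) +
      C (1 / 8) * p.derivative.derivative
    have hr : r.natDegree ≤ 2 * k := by
      have d1 : p.derivative.natDegree ≤ p.natDegree - 1 := natDegree_derivative_le p
      have d2 : p.derivative.derivative.natDegree ≤ p.derivative.natDegree - 1 :=
        natDegree_derivative_le _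
      have d3 : (X * p.derivative).natDegree ≤ 2 * k := by
        by_cases hz : p.natDegree = 0
        · have : p.derivative = 0 := by
            rw [eq_C_of_natDegree_eq_zero hz]; simp
          simp [this]
        · exact natDegree_mul_le.trans (by rw [natDegree_X]; omega)
      refine natDegree_add_le_of_degree_le 
        ((natDegree_sub_le _ _).trans (max_le ?_ ?_)) ?_
      · exact (natDegree_C_mul_le _ _).trans hd.le
      · exact (natDegree_C_mul_le _ _).trans d3
      · exact (natDegree_C_mul_le _ _).trans (by omega)
    have hXm : (X ^ 2 * p).Monic := (monic_X_pow 2).mul hm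
    have hXd : (X ^ 2 * p).natDegree = 2 * (k + 1) := by
      rw [(monic_X_pow 2).natDegree_mul hm, natDegree_X_pow, hd]; ring
    have hlt : r.degree < (X ^ 2 * p).degree := by
      rw [degree_eq_natDegree hXm.ne_zero, hXd]
      exact (degree_le_of_natDegree_le hr).trans_lt (by norm_cast; omega)
    refine ⟨X ^ 2 * p + r, hXm.add_of_left hlt, ?_, fun u => ?_⟩
    · rw [natDegree_add_eq_left_of_degree_lt hlt, hXd]
    · simp only [r, eval_add, eval_sub, eval_mul, eval_pow, eval_X, eval_C, h1, h2, he,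
        goeSquare_succ]
      ring

/-! ### Gaussian antiderivatives and the closed form of the excess. -/

/-- The antiderivatives of `exp (-u² / 2) * goeHermite k u` that vanish at `-∞`. -/
noncomputable def goeTail : ℕ → ℝ → ℝ
  | 0, u => ∫ t in Set.Iic u, exp (-(t ^ 2 / 2))
  | 1, u => exp (-(u ^ 2 / 2))
  | k + 2, u => exp (-(u ^ 2 / 2)) * goeHermite (k + 1) u + (k + 1) / 2 * goeTail k u

lemma goeTail_add_two (k : ℕ) (u : ℝ) :
    goeTail (k + 2) u = exp (-(u ^ 2 / 2)) * goeHermite (k + 1) u + (k + 1) / 2 * goeTail k u := by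
  rw [goeTail]

lemma integrable_exp_neg_sq_half : Integrable fun t : ℝ => exp (-(t ^ 2 / 2)) := by
  have := integrable_exp_neg_mul_sq (b := 1 / 2) (by norm_num)
  refine this.congr (Filter.Eventually.of_forall fun t => ?_)
  simp only
  congr 1; ring

lemma hasDerivAt_exp_neg_sq_half (u : ℝ) :
    HasDerivAt (fun u : ℝ => exp (-(u ^ 2 / 2))) (exp (-(u ^ 2 / 2)) * (-u)) u := by
  refine (((hasDerivAt_id u).pow 2).div_const 2).neg.exp.congr_deriv ?_
  simp only [Pi.pow_apply, id, Pi.neg_apply]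
  push_cast
  ring

lemma hasDerivAt_goeTail (k : ℕ) (u : ℝ) :
    HasDerivAt (goeTail k) (exp (-(u ^ 2 / 2)) * goeHermite k u) u := by
  induction k using Nat.strong_induction_on with
  | _ k ih =>
    match k with
    | 0 =>
      have hI := integrable_exp_neg_sq_half
      have : goeTail 0 = fun u => (∫ t in Set.Iic (0 : ℝ), exp (-(t ^ 2 / 2))) +
          ∫ t in (0 : ℝ)..u, exp (-(t ^ 2 / 2)) := by
        ext v
        rw [goeTail, intervalIntegral.integral_Iic_sub_Iic hI.integrableOn hI.integrableOn |>.symm]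
        ring
      rw [this]
      have hc : Continuous fun t : ℝ => exp (-(t ^ 2 / 2)) := by fun_prop
      simpa [goeHermite] using (hc.integral_hasStrictDerivAt 0 u).hasDerivAt.const_add
        (∫ t in Set.Iic (0 : ℝ), exp (-(t ^ 2 / 2)))
    | 1 =>
      have : goeTail 1 = fun u => exp (-(u ^ 2 / 2)) := by ext; simp [goeTail]
      rw [this]
      refine (hasDerivAt_exp_neg_sq_half u).congr_deriv ?_
      simp [goeHermite]
    | k + 2 =>
      have : goeTail (k + 2) = fun u => exp (-(u ^ 2 / 2)) * goeHermite (k + 1) u +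
          (k + 1) / 2 * goeTail k u := by ext; exact goeTail_add_two k _
      rw [this]
      refine (((hasDerivAt_exp_neg_sq_half u).mul (hasDerivAt_goeHermite_succ k u)).add
        ((ih k (by omega)).const_mul _)).congr_deriv ?_
      rw [goeHermite_add_two]; ring

/-- The excess `E (|det (X - u)| - det (X - u))` in closed form, up to a constant factor. -/
noncomputable def goeExcess (n : ℕ) (u : ℝ) : ℝ :=
  -(goeHermite n u * goeTail (n + 1) u) + exp (-(u ^ 2 / 2)) *
    hermiteQuad n (fun _ => n + 1) (fun u => 2 * u) (fun _ => 2) u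

/-- The derivative of `goeExcess`. -/
noncomputable def goeExcessDeriv (n : ℕ) (u : ℝ) : ℝ :=
  -((2 * goeHermite (n + 1) u + 2 * u * goeHermite n u) * goeTail (n + 1) u) +
    exp (-(u ^ 2 / 2)) *
      hermiteQuad n (fun u => (n + 1) * u) (fun u => 1 + 2 * u ^ 2) (fun u => 2 * u) u

/-- The second derivative of `goeExcess`. -/
noncomputable def goeExcessDeriv₂ (n : ℕ) (u : ℝ) : ℝ :=
  -(((4 * u ^ 2 - 2 * n) * goeHermite n u + 4 * u * goeHermite (n + 1) u) * goeTail (n + 1) u) +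
    exp (-(u ^ 2 / 2)) *
      hermiteQuad n (fun u => (n + 1) * u ^ 2) (fun u => 2 * u ^ 3 + 3 * u)
        (fun u => 2 * u ^ 2 + 2) u

lemma hasDerivAt_goeExcess (n : ℕ) (u : ℝ) :
    HasDerivAt (goeExcess n) (goeExcessDeriv n u) u := by
  have i := hasDerivAt_id u
  refine (((hasDerivAt_goeHermite n u).mul (hasDerivAt_goeTail (n + 1) u)).neg.add
    ((hasDerivAt_exp_neg_sq_half u).mul (hasDerivAt_hermiteQuad n
      (hasDerivAt_const u ((n : ℝ) + 1)) (i.const_mul 2) (hasDerivAt_const u 2)))).congr_deriv ?_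
  simp only [goeExcessDeriv, hermiteQuad, id]
  ring

lemma hasDerivAt_goeExcessDeriv (n : ℕ) (u : ℝ) :
    HasDerivAt (goeExcessDeriv n) (goeExcessDeriv₂ n u) u := by
  have i := hasDerivAt_id u
  refine (((((hasDerivAt_goeHermite_succ n u).const_mul 2).add ((i.const_mul 2).mul
    (hasDerivAt_goeHermite n u))).mul (hasDerivAt_goeTail (n + 1) u)).neg.add
    ((hasDerivAt_exp_neg_sq_half u).mul (hasDerivAt_hermiteQuad n
      (i.const_mul ((n : ℝ) + 1)) (((i.pow 2).const_mul 2).const_add 1)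
      (i.const_mul 2)))).congr_deriv ?_
  simp only [goeExcessDeriv₂, hermiteQuad, id, Pi.add_apply, Pi.mul_apply, Pi.pow_apply]
  push_cast
  ring

/-- The coefficient of `goeTail` cancels because `goeHermite (k + 1)` solves the homogeneous
equation. What remains is the quadratic form that defines `goeSquare k`. -/
lemma goeExcess_ode (k : ℕ) (u : ℝ) :
    1 / 2 * goeExcessDeriv₂ (k + 1) u - u * goeExcessDeriv (k + 1) u +
      ((k + 1 : ℕ) : ℝ) * goeExcess (k + 1) u =
        3 * (k + 1) / 4 * exp (-(u ^ 2 / 2)) * goeSquare k u := by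
  have h1 : (k : ℝ) + 1 ≠ 0 := by positivity
  simp only [goeExcessDeriv₂, goeExcessDeriv, goeExcess, goeSquare, hermiteQuad]
  push_cast
  field_simp
  ring

/-! ### Minors of Hankel matrices of Gamma values. -/

/-- The coefficients of the Laguerre polynomials with parameter `a - 1`, up to signs. -/
noncomputable def laguerreCoeff (a : ℝ) (k i : ℕ) : ℝ :=
  k.choose i * Gamma (k + a) / Gamma (i + a)

/-- The Hankel matrix `[Γ(r + s + a)]`. -/
noncomputable def gammaHankel (a : ℝ) (m : ℕ) : Matrix (Fin m) (Fin m) ℝ :=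
  Matrix.of fun r s => Gamma ((r : ℝ) + s + a)

/-- The unitriangular matrix of coefficients of monic Laguerre polynomials. -/
noncomputable def laguerreMatrix (a : ℝ) (m : ℕ) : Matrix (Fin m) (Fin m) ℝ :=
  Matrix.of fun k i => (-1) ^ ((k : ℕ) + i) * laguerreCoeff a k i

lemma Gamma_add_natCast {x : ℝ} (hx : 0 < x) (s : ℕ) :
    Gamma (x + s) = (ascPochhammer ℝ s).eval x * Gamma x := by
  induction s with
  | zero => simp
  | succ s ih =>
    rw [Nat.cast_succ, ← add_assoc, Gamma_add_one (by positivity), ih, ascPochhammer_succ_eval]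
    ring

open Polynomial in
lemma sum_choose_mul_eval (k : ℕ) (p : ℝ[X]) (x : ℝ) :
    ∑ i ∈ Finset.range (k + 1), (-1) ^ (k + i) * k.choose i * p.eval (x + i) =
      (fwdDiff 1)^[k] (fun y => p.eval y) x := by
  rw [fwdDiff_iter_eq_sum_shift]
  refine Finset.sum_congr rfl fun i hi => ?_
  have hi : i ≤ k := Nat.lt_succ_iff.1 (Finset.mem_range.1 hi)
  have : (-1 : ℝ) ^ (k + i) = (-1) ^ (k - i) := by
    rw [show k + i = (k - i) + 2 * i by omega, pow_add, pow_mul]; simp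
  rw [this]
  simp

/-- Since `Γ(i + s + a) / Γ(i + a)` is the rising factorial of `a + i` of length `s`, the entry is
`Γ(k + a)` times the `k`-th forward difference at `a` of a monic polynomial of degree `s`. It
vanishes for `s < k` and yields `k!` for `s = k`. -/
lemma laguerreMatrix_mul_gammaHankel {a : ℝ} (ha : 0 < a) {m : ℕ} (k s : Fin m) (h : s ≤ k) :
    (laguerreMatrix a m * gammaHankel a m) k s =
      if s = k then (k : ℕ).factorial * Gamma (k + a) else 0 := by
  have h0 : ∀ i : ℕ, (Gamma (i + a)) ≠ 0 := fun i => (Gamma_pos_of_pos (by positivity)).ne'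
  have e1 : (laguerreMatrix a m * gammaHankel a m) k s = ∑ i ∈ Finset.range m,
      Gamma (k + a) *
        ((-1) ^ ((k : ℕ) + i) * (k : ℕ).choose i * (ascPochhammer ℝ s).eval (a + i)) := by
    rw [Matrix.mul_apply, ← Fin.sum_univ_eq_sum_range (fun i => Gamma (k + a) *
        ((-1) ^ ((k : ℕ) + i) * (k : ℕ).choose i * (ascPochhammer ℝ s).eval (a + i)))]
    refine Finset.sum_congr rfl fun i _ => ?_
    simp only [laguerreMatrix, gammaHankel, Matrix.of_apply, laguerreCoeff]
    rw [show (i : ℝ) + s + a = (a + i) + (s : ℕ) by ring, Gamma_add_natCast (by positivity),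
      show a + (i : ℝ) = i + a by ring]
    have := h0 i
    field_simp
  have e2 : (laguerreMatrix a m * gammaHankel a m) k s =
      Gamma (k + a) * (fwdDiff 1)^[k] (fun y => (ascPochhammer ℝ s).eval y) a := by
    rw [e1, ← sum_choose_mul_eval, Finset.mul_sum]
    symm
    refine Finset.sum_subset (Finset.range_subset_range.2 k.2) fun i _ hi => ?_
    rw [Nat.choose_eq_zero_of_lt (by simpa using hi)]
    simp
  have hd : (ascPochhammer ℝ s).natDegree = s := ascPochhammer_natDegree _ _
  rw [e2]
  split_ifs with hs
  · subst hs
    have := Polynomial.fwdDiff_iter_degree_eq_factorial (ascPochhammer ℝ s)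
    rw [hd, (monic_ascPochhammer ℝ s).leadingCoeff] at this
    have h2 := congrFun this a
    simp only [Pi.smul_apply, one_smul] at h2
    rw [h2, mul_comm]
    simp
  · have : (ascPochhammer ℝ s).natDegree < k := by
      rw [hd]; exact lt_of_le_of_ne h fun h' => hs (Fin.ext h')
    have h2 := congrFun (Polynomial.fwdDiff_iter_eq_zero_of_degree_lt this) a
    rw [h2]; simp

lemma laguerreMatrix_eq_zero {a : ℝ} {m : ℕ} {k i : Fin m} (h : k < i) :
    laguerreMatrix a m k i = 0 := by
  simp [laguerreMatrix, laguerreCoeff, Nat.choose_eq_zero_of_lt (Fin.lt_def.1 h)]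

lemma laguerreMatrix_diag {a : ℝ} (ha : 0 < a) {m : ℕ} (k : Fin m) :
    laguerreMatrix a m k k = 1 := by
  have : Gamma ((k : ℝ) + a) ≠ 0 := (Gamma_pos_of_pos (by positivity)).ne'
  simp [laguerreMatrix, laguerreCoeff, ← two_mul, div_self this]

lemma det_laguerreMatrix {a : ℝ} (ha : 0 < a) (m : ℕ) : (laguerreMatrix a m).det = 1 := by
  rw [Matrix.det_of_isLowerTriangular _ fun i j h => laguerreMatrix_eq_zero (by simpa using h)]
  exact Finset.prod_eq_one fun i _ => laguerreMatrix_diag ha i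

open scoped Matrix in
-- Orthogonality of the monic Laguerre polynomials: `Γ(r + s + a)` is the moment of order `r + s` of
-- `t ^ (a - 1) * exp (-t)` on the half-line. For `l ≤ k` only the summand `s = l` survives: for `s
-- < l` the product of the first two factors vanishes, for `s > l` the triangular factor does.
-- Symmetry gives the other half.
lemma laguerreMatrix_gammaHankel_transpose {a : ℝ} (ha : 0 < a) (m : ℕ) :
    laguerreMatrix a m * gammaHankel a m * (laguerreMatrix a m)ᵀ =
      Matrix.diagonal fun k : Fin m => ((k : ℕ).factorial * Gamma (k + a) : ℝ) := by
  have key : ∀ k l : Fin m, l ≤ k →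
      (laguerreMatrix a m * gammaHankel a m * (laguerreMatrix a m)ᵀ) k l =
        if k = l then ((k : ℕ).factorial * Gamma (k + a) : ℝ) else 0 := by
    intro k l hl
    rw [Matrix.mul_apply, Finset.sum_eq_single l]
    · rw [laguerreMatrix_mul_gammaHankel ha k l hl, Matrix.transpose_apply, laguerreMatrix_diag ha,
        mul_one]
      simp [eq_comm]
    · intro s _ hs
      rcases lt_or_gt_of_ne hs with h | h
      · rw [laguerreMatrix_mul_gammaHankel ha k s (h.le.trans hl), if_neg (h.trans_le hl).ne,
          zero_mul]
      · rw [Matrix.transpose_apply, laguerreMatrix_eq_zero h, mul_zero]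
    · simp
  have hsymm : (laguerreMatrix a m * gammaHankel a m * (laguerreMatrix a m)ᵀ)ᵀ =
      laguerreMatrix a m * gammaHankel a m * (laguerreMatrix a m)ᵀ := by
    have : (gammaHankel a m)ᵀ = gammaHankel a m := by
      ext i j; simp [gammaHankel, add_comm]
    rw [Matrix.transpose_mul, Matrix.transpose_mul, Matrix.transpose_transpose, this,
      Matrix.mul_assoc]
  ext k l
  rw [Matrix.diagonal_apply]
  rcases le_total l k with h | h
  · exact key k l h
  · rw [← hsymm, Matrix.transpose_apply, key l k h]
    by_cases e : k = l
    · simp [e]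
    · simp [e, Ne.symm e]

lemma det_gammaHankel {a : ℝ} (ha : 0 < a) (m : ℕ) :
    (gammaHankel a m).det = ∏ k ∈ Finset.range m, (k.factorial * Gamma (k + a)) := by
  have := congrArg Matrix.det (laguerreMatrix_gammaHankel_transpose ha m)
  rw [Matrix.det_mul, Matrix.det_mul, Matrix.det_transpose, det_laguerreMatrix ha,
    Matrix.det_diagonal] at this
  rw [one_mul, mul_one] at this
  rw [this, Fin.prod_univ_eq_prod_range (fun k => (k.factorial * Gamma (k + a) : ℝ))]

open scoped Matrix in
lemma adjugate_gammaHankel {a : ℝ} (ha : 0 < a) {m : ℕ} (i j : Fin m) :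
    (gammaHankel a m).adjugate i j = (gammaHankel a m).det *
      ∑ k : Fin m, laguerreMatrix a m k i * laguerreMatrix a m k j /
        ((k : ℕ).factorial * Gamma (k + a)) := by
  set L := laguerreMatrix a m
  set T := gammaHankel a m
  set N : Fin m → ℝ := fun k => (k : ℕ).factorial * Gamma (k + a)
  have hN : ∀ k, N k ≠ 0 := fun k =>
    mul_ne_zero (by positivity) (Gamma_pos_of_pos (by positivity)).ne'
  have hL : IsUnit L.det := by rw [det_laguerreMatrix ha]; exact isUnit_one
  have hLT : IsUnit Lᵀ.det := by rwa [Matrix.det_transpose]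
  have h : L * T * Lᵀ = Matrix.diagonal N := laguerreMatrix_gammaHankel_transpose ha m
  have hinv : T * (Lᵀ * Matrix.diagonal (fun k => (N k)⁻¹) * L) = 1 := by
    have h1 : L * T * Lᵀ * Matrix.diagonal (fun k => (N k)⁻¹) = 1 := by
      rw [h, Matrix.diagonal_mul_diagonal, ← Matrix.diagonal_one]
      congr 1; ext k; exact mul_inv_cancel₀ (hN k)
    have h2 : T * Lᵀ * Matrix.diagonal (fun k => (N k)⁻¹) = L⁻¹ := by
      rw [← Matrix.mul_one L⁻¹, ← h1]
      simp only [← Matrix.mul_assoc, Matrix.nonsing_inv_mul L hL, Matrix.one_mul]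
    simp only [← Matrix.mul_assoc, h2, Matrix.nonsing_inv_mul L hL]
  have hadj : T.adjugate = T.det • (Lᵀ * Matrix.diagonal (fun k => (N k)⁻¹) * L) := by
    calc T.adjugate = T.adjugate * (T * (Lᵀ * Matrix.diagonal (fun k => (N k)⁻¹) * L)) := by
          rw [hinv, Matrix.mul_one]
      _ = _ := by rw [← Matrix.mul_assoc, Matrix.adjugate_mul, Matrix.smul_mul, Matrix.one_mul]
  rw [hadj, Matrix.smul_apply, smul_eq_mul, Matrix.mul_apply]
  congr 1
  refine Finset.sum_congr rfl fun k _ => ?_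
  rw [Matrix.mul_diagonal, Matrix.transpose_apply, div_eq_mul_inv]
  ring

/-- The minors of the Hankel matrix, paired with two vectors. -/
lemma sum_minors_gammaHankel {a : ℝ} (ha : 0 < a) (m : ℕ) (x y : ℕ → ℝ) :
    ∑ i : Fin (m + 1), ∑ j : Fin (m + 1),
      (deleteRowCol (gammaHankel a (m + 1)) i j).det * (x i * y j) =
        (gammaHankel a (m + 1)).det * ∑ k ∈ Finset.range (m + 1),
          (∑ i ∈ Finset.range (k + 1), laguerreCoeff a k i * x i) *
            (∑ i ∈ Finset.range (k + 1), laguerreCoeff a k i * y i) /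
              (k.factorial * Gamma (k + a)) := by
  have hsum : ∀ (k : Fin (m + 1)) (x : ℕ → ℝ),
      ∑ i ∈ Finset.range ((k : ℕ) + 1), laguerreCoeff a k i * x i =
        ∑ i : Fin (m + 1), laguerreCoeff a k i * x i := by
    intro k x
    rw [Fin.sum_univ_eq_sum_range (fun i => laguerreCoeff a k i * x i)]
    refine Finset.sum_subset (Finset.range_subset_range.2 k.2) fun i _ hi => ?_
    simp [laguerreCoeff, Nat.choose_eq_zero_of_lt (show (k : ℕ) < i by simpa using hi)]
  have hdel : ∀ i j : Fin (m + 1), (deleteRowCol (gammaHankel a (m + 1)) i j).det =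
      (gammaHankel a (m + 1)).det * ∑ k : Fin (m + 1), laguerreCoeff a k i * laguerreCoeff a k j /
        ((k : ℕ).factorial * Gamma (k + a)) := by
    intro i j
    have h1 := Matrix.adjugate_fin_succ_eq_det_submatrix (gammaHankel a (m + 1)) j i
    rw [adjugate_gammaHankel ha] at h1
    -- The cofactor sign cancels the signs of the two entries of `laguerreMatrix`, so only the
    -- unsigned `laguerreCoeff` remain.
    have hs : ((-1 : ℝ) ^ ((i : ℕ) + j)) * (-1) ^ ((i : ℕ) + j) = 1 := by
      rw [← pow_add, ← two_mul, pow_mul]; simp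
    calc (deleteRowCol (gammaHankel a (m + 1)) i j).det
        = (-1) ^ ((i : ℕ) + j) * ((-1) ^ ((i : ℕ) + j) *
            (deleteRowCol (gammaHankel a (m + 1)) i j).det) := by rw [← mul_assoc, hs, one_mul]
      _ = _ := by
        rw [deleteRowCol, ← h1, mul_left_comm, Finset.mul_sum]
        congr 1
        refine Finset.sum_congr rfl fun k _ => ?_
        simp only [laguerreMatrix, Matrix.of_apply]
        have hk : ((-1 : ℝ) ^ (k : ℕ)) * (-1) ^ (k : ℕ) = 1 := by
          rw [← pow_add, ← two_mul, pow_mul]; simp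
        rw [pow_add] at hs
        simp only [pow_add]
        linear_combination (laguerreCoeff a k i * laguerreCoeff a k j /
          ((k : ℕ).factorial * Gamma (k + a))) * (((-1) ^ (i : ℕ) * (-1) ^ (j : ℕ)) ^ 2 * hk + hs)
  rw [← Fin.sum_univ_eq_sum_range (fun k =>
    (∑ i ∈ Finset.range (k + 1), laguerreCoeff a k i * x i) *
            (∑ i ∈ Finset.range (k + 1), laguerreCoeff a k i * y i) /
              (k.factorial * Gamma (k + a)))]
  simp only [hsum, hdel, Finset.sum_div, Finset.mul_sum, Finset.sum_mul]
  rw [Finset.sum_comm_cycle]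
  refine Finset.sum_congr rfl fun k _ => ?_
  rw [Finset.sum_comm]
  refine Finset.sum_congr rfl fun i _ => ?_
  refine Finset.sum_congr rfl fun j _ => ?_
  ring

/-! ### Laguerre combinations of Hermite polynomials. -/

lemma laguerreCoeff_half_succ (k i : ℕ) :
    laguerreCoeff (1 / 2) (k + 1) (i + 1) =
      laguerreCoeff (3 / 2) k i + (k + 1 / 2) * laguerreCoeff (1 / 2) k (i + 1) := by
  have h1 : Gamma (((k + 1 : ℕ) : ℝ) + 1 / 2) = (k + 1 / 2) * Gamma (k + 1 / 2) := by
    rw [← Gamma_add_one (by positivity)]; push_cast; ring_nf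
  have h2 : Gamma (((i + 1 : ℕ) : ℝ) + 1 / 2) = Gamma (i + 3 / 2) := by
    push_cast; ring_nf
  have h3 : Gamma ((k : ℝ) + 3 / 2) = (k + 1 / 2) * Gamma (k + 1 / 2) := by
    rw [← Gamma_add_one (by positivity)]; ring_nf
  simp only [laguerreCoeff]
  rw [h1, h2, h3, Nat.choose_succ_succ]
  push_cast
  ring

lemma laguerreCoeff_zero_right_half (k : ℕ) :
    laguerreCoeff (1 / 2) (k + 1) 0 = (k + 1 / 2) * laguerreCoeff (1 / 2) k 0 := by
  have h1 : Gamma (((k + 1 : ℕ) : ℝ) + 1 / 2) = (k + 1 / 2) * Gamma (k + 1 / 2) := by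
    rw [← Gamma_add_one (by positivity)]; push_cast; ring_nf
  simp only [laguerreCoeff]
  rw [h1]
  simp only [Nat.choose_zero_right]
  ring

lemma laguerreCoeff_three_half_succ (k i : ℕ) :
    laguerreCoeff (3 / 2) (k + 1) i =
      laguerreCoeff (1 / 2) (k + 1) i + (k + 1) * laguerreCoeff (3 / 2) k i := by
  have h1 : Gamma (((k + 1 : ℕ) : ℝ) + 1 / 2) = Gamma (k + 3 / 2) := by
    push_cast; ring_nf
  have h2 : Gamma (((k + 1 : ℕ) : ℝ) + 3 / 2) = (k + 3 / 2) * Gamma (k + 3 / 2) := by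
    rw [← Gamma_add_one (by positivity)]; push_cast; ring_nf
  have h3 : Gamma ((i : ℝ) + 3 / 2) = (i + 1 / 2) * Gamma (i + 1 / 2) := by
    rw [← Gamma_add_one (by positivity)]; ring_nf
  have h4 : Gamma ((i : ℝ) + 1 / 2) ≠ 0 := (Gamma_pos_of_pos (by positivity)).ne'
  have h5 : (i : ℝ) + 1 / 2 ≠ 0 := by positivity
  have hc : ((k : ℝ) + 1 - i) * ((k + 1).choose i : ℝ) = (k + 1) * (k.choose i : ℝ) := by
    rcases le_or_gt i (k + 1) with hi | hi
    · have := Nat.choose_mul_succ_eq k i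
      have h := congrArg (Nat.cast (R := ℝ)) this
      push_cast [Nat.cast_sub hi] at h
      linarith
    · rw [Nat.choose_eq_zero_of_lt hi, Nat.choose_eq_zero_of_lt (by omega : k < i)]; simp
  simp only [laguerreCoeff]
  rw [h1, h2, h3]
  field_simp
  linear_combination (2 : ℝ) * hc

/-- The combination of a sequence with the coefficients `laguerreCoeff a k`. -/
noncomputable def laguerreSum (a : ℝ) (k : ℕ) (f : ℕ → ℝ) : ℝ :=
  ∑ i ∈ Finset.range (k + 1), laguerreCoeff a k i * f i

lemma laguerreCoeff_eq_zero {a : ℝ} {k i : ℕ} (h : k < i) : laguerreCoeff a k i = 0 := by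
  simp [laguerreCoeff, Nat.choose_eq_zero_of_lt h]

/-- Together with `laguerreSum_three_half_succ` this alternates between the parameters `1/2` and
`3/2`. The factors `k + 1/2` and `k + 1` are `(n + 1) / 2` for `n = 2 k` and `n = 2 k + 1`, as in
the recurrences of `goeHermite` and `goeTail`. -/
lemma laguerreSum_half_succ (k : ℕ) (f : ℕ → ℝ) :
    laguerreSum (1 / 2) (k + 1) f = laguerreSum (3 / 2) k (fun i => f (i + 1)) +
      (k + 1 / 2) * laguerreSum (1 / 2) k f := by
  have h : laguerreSum (1 / 2) k f =
      ∑ i ∈ Finset.range (k + 1 + 1), laguerreCoeff (1 / 2) k i * f i := by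
    rw [Finset.sum_range_succ, laguerreCoeff_eq_zero (Nat.lt_succ_self k), zero_mul, add_zero]
    rfl
  rw [h, laguerreSum, laguerreSum, Finset.sum_range_succ' _ (k + 1),
    Finset.sum_range_succ' _ (k + 1), laguerreCoeff_zero_right_half, mul_add, Finset.mul_sum,
    ← add_assoc, ← Finset.sum_add_distrib]
  congr 1
  · refine Finset.sum_congr rfl fun i _ => ?_
    rw [laguerreCoeff_half_succ]; ring
  · ring

lemma laguerreSum_three_half_succ (k : ℕ) (f : ℕ → ℝ) :
    laguerreSum (3 / 2) (k + 1) f = laguerreSum (1 / 2) (k + 1) f +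
      (k + 1) * laguerreSum (3 / 2) k f := by
  have h : laguerreSum (3 / 2) k f =
      ∑ i ∈ Finset.range (k + 1 + 1), laguerreCoeff (3 / 2) k i * f i := by
    rw [Finset.sum_range_succ, laguerreCoeff_eq_zero (Nat.lt_succ_self k), zero_mul, add_zero]
    rfl
  rw [h, laguerreSum, laguerreSum, Finset.mul_sum, ← Finset.sum_add_distrib]
  refine Finset.sum_congr rfl fun i _ => ?_
  rw [laguerreCoeff_three_half_succ]; ring

lemma laguerreSum_zero {a : ℝ} (ha : 0 < a) (f : ℕ → ℝ) : laguerreSum a 0 f = f 0 := by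
  have : Gamma a ≠ 0 := (Gamma_pos_of_pos ha).ne'
  simp [laguerreSum, laguerreCoeff, this]

lemma laguerreSum_sub (a : ℝ) (k : ℕ) (f g : ℕ → ℝ) :
    laguerreSum a k (fun i => f i - g i) = laguerreSum a k f - laguerreSum a k g := by
  simp [laguerreSum, mul_sub]

lemma laguerreSum_mul_left (a c : ℝ) (k : ℕ) (f : ℕ → ℝ) :
    laguerreSum a k (fun i => c * f i) = c * laguerreSum a k f := by
  simp only [laguerreSum, Finset.mul_sum]
  exact Finset.sum_congr rfl fun i _ => by ring

lemma hermiteP_natCast (n : ℕ) (u : ℝ) :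
    hermiteP (n : ℤ) u = Polynomial.aeval u (Polynomial.hermite n) := rfl

lemma hermiteP_neg_one (u : ℝ) : hermiteP (-1) u = -exp (u ^ 2 / 2) * goeTail 0 u := rfl

lemma hasDerivAt_hermiteP (n : ℕ) (u : ℝ) :
    HasDerivAt (hermiteP n) (u * hermiteP n u - hermiteP (n + 1 : ℕ) u) u := by
  have h : hermiteP n = fun u => Polynomial.aeval u (Polynomial.hermite n) := rfl
  rw [h]
  refine (Polynomial.hasDerivAt_aeval _ u).congr_deriv ?_
  simp only [hermiteP_natCast, Polynomial.hermite_succ, map_sub, map_mul, Polynomial.aeval_X]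
  ring

lemma hasDerivAt_laguerreSum (a : ℝ) (k : ℕ) (d : ℕ) (u : ℝ) :
    HasDerivAt (fun u => laguerreSum a k (fun i => hermiteP ((2 * i + d : ℕ) : ℤ) u))
      (u * laguerreSum a k (fun i => hermiteP ((2 * i + d : ℕ) : ℤ) u) -
        laguerreSum a k (fun i => hermiteP ((2 * i + d + 1 : ℕ) : ℤ) u)) u := by
  rw [← laguerreSum_mul_left, ← laguerreSum_sub]
  exact HasDerivAt.fun_sum fun i _ => (hasDerivAt_hermiteP _ u).const_mul _

/-- The operator `f ↦ f' - u f` sends `P_j` to `-P_{j+1}`. Written with this operator, the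
recurrence of `goeHermite` (`hrec`) becomes the alternating recursion of the Laguerre sums. -/
lemma goeHermite_eq_laguerreSum (k : ℕ) :
    (∀ u, goeHermite (2 * k) u =
      laguerreSum (1 / 2) k (fun i => hermiteP ((2 * i + 0 : ℕ) : ℤ) u)) ∧
    ∀ u, goeHermite (2 * k + 1) u =
      -laguerreSum (3 / 2) k (fun i => hermiteP ((2 * i + 1 : ℕ) : ℤ) u) := by
  have hrec : ∀ n u d, HasDerivAt (goeHermite (n + 1)) d u →
      goeHermite (n + 2) u = d - u * goeHermite (n + 1) u + (n + 1) / 2 * goeHermite n u := by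
    intro n u d h
    rw [h.unique (hasDerivAt_goeHermite_succ n u), goeHermite_add_two]; ring
  induction k with
  | zero =>
    refine ⟨fun u => ?_, fun u => ?_⟩
    · rw [laguerreSum_zero (by norm_num), hermiteP_natCast]; simp [goeHermite]
    · rw [laguerreSum_zero (by norm_num), hermiteP_natCast]; simp [goeHermite]
  | succ k ih =>
    obtain ⟨h0, h1⟩ := ih
    have h2 : ∀ u, goeHermite (2 * (k + 1)) u =
        laguerreSum (1 / 2) (k + 1) (fun i => hermiteP ((2 * i + 0 : ℕ) : ℤ) u) := by
      intro u
      have hd := (hasDerivAt_laguerreSum (3 / 2) k 1 u).neg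
      have hf : goeHermite (2 * k + 1) =
          -fun u => laguerreSum (3 / 2) k (fun i => hermiteP ((2 * i + 1 : ℕ) : ℤ) u) := funext h1
      rw [← hf] at hd
      rw [mul_add, mul_one, hrec _ _ _ hd, h1, h0, laguerreSum_half_succ]
      have : (fun i : ℕ => hermiteP ((2 * (i + 1) + 0 : ℕ) : ℤ) u) =
          fun i : ℕ => hermiteP ((2 * i + 1 + 1 : ℕ) : ℤ) u := by
        ext i; congr 2
      rw [this]
      push_cast
      ring
    refine ⟨h2, fun u => ?_⟩
    have hd := hasDerivAt_laguerreSum (1 / 2) (k + 1) 0 u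
    have hf : goeHermite (2 * k + 1 + 1) = fun u =>
        laguerreSum (1 / 2) (k + 1) (fun i => hermiteP ((2 * i + 0 : ℕ) : ℤ) u) := funext h2
    rw [← hf] at hd
    rw [show 2 * (k + 1) + 1 = 2 * k + 1 + 2 by ring, hrec _ _ _ hd, h1,
      show 2 * k + 1 + 1 = 2 * (k + 1) by ring, h2, laguerreSum_three_half_succ]
    push_cast
    ring_nf

/-- Termwise integration of the previous expansion: `-exp (-u² / 2) P_{j-1}` is the antiderivative
of `exp (-u² / 2) P_j` that vanishes at `-∞`, and `P_{-1}` is normalized so that this holds for `j =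
0` too. The proof compares recursions instead of integrating. -/
lemma goeTail_eq_laguerreSum (k : ℕ) (u : ℝ) :
    goeTail (2 * k) u =
      -exp (-(u ^ 2 / 2)) * laguerreSum (1 / 2) k (fun i => hermiteP (2 * (i : ℤ) - 1) u) ∧
    goeTail (2 * k + 1) u =
      exp (-(u ^ 2 / 2)) * laguerreSum (3 / 2) k (fun i => hermiteP (2 * (i : ℤ)) u) := by
  induction k with
  | zero =>
    refine ⟨?_, ?_⟩
    · rw [laguerreSum_zero (by norm_num)]
      simp only [Nat.cast_zero, mul_zero, zero_sub, hermiteP_neg_one]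
      rw [← mul_assoc, neg_mul_neg, ← exp_add]
      simp
    · rw [laguerreSum_zero (by norm_num)]
      have : hermiteP (2 * ((0 : ℕ) : ℤ)) u = 1 := by
        have := hermiteP_natCast 0 u
        simpa using this
      rw [this]; simp [goeTail]
  | succ k ih =>
    obtain ⟨h0, h1⟩ := ih
    have h2 : goeTail (2 * (k + 1)) u = -exp (-(u ^ 2 / 2)) *
        laguerreSum (1 / 2) (k + 1) (fun i => hermiteP (2 * (i : ℤ) - 1) u) := by
      rw [mul_add, mul_one, goeTail_add_two, h0, (goeHermite_eq_laguerreSum k).2,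
        laguerreSum_half_succ]
      have : (fun i : ℕ => hermiteP (2 * ((i + 1 : ℕ) : ℤ) - 1) u) =
          fun i : ℕ => hermiteP ((2 * i + 1 : ℕ) : ℤ) u := by
        ext i; congr 1; push_cast; ring
      rw [this]
      push_cast
      ring
    refine ⟨h2, ?_⟩
    rw [show 2 * (k + 1) + 1 = 2 * k + 1 + 2 by ring, goeTail_add_two, h1,
      show 2 * k + 1 + 1 = 2 * (k + 1) by ring, (goeHermite_eq_laguerreSum (k + 1)).1,
      laguerreSum_three_half_succ]
    have : (fun i : ℕ => hermiteP ((2 * i + 0 : ℕ) : ℤ) u) =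
        fun i : ℕ => hermiteP (2 * (i : ℤ)) u := by
      ext i; congr 1
    rw [this]
    push_cast
    ring

/-! ### Telescoping of the excesses. -/

/-- The increments of the (rescaled) excesses `goeExcess n` along a parity class. -/
noncomputable def goeIncrement (n : ℕ) (u : ℝ) : ℝ :=
  exp (-(u ^ 2 / 2)) * goeHermite n u ^ 2 -
    (2 * goeHermite (n + 1) u + u * goeHermite n u) * goeTail n u

/-- After division by `k!` and the matching Gamma value the two terms on the right become
consecutive values of one sequence, so sums of increments over a parity class telescope. -/
lemma goeIncrement_succ (n : ℕ) (u : ℝ) :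
    goeIncrement (n + 1) u = 2 / (n + 2) * goeExcess (n + 2) u - (n + 1) / 2 * goeExcess n u := by
  have h : (n : ℝ) + 2 ≠ 0 := by positivity
  simp only [goeIncrement, goeExcess, hermiteQuad]
  rw [show n + 2 + 1 = n + 1 + 2 from rfl, goeTail_add_two (n + 1), goeHermite_add_two (n + 1),
    show n + 1 + 1 = n + 2 from rfl, goeHermite_add_two n]
  push_cast
  field_simp
  ring

lemma goeExcess_zero (u : ℝ) : goeExcess 0 u = 0 := by
  simp [goeExcess, hermiteQuad, goeHermite, goeTail]; ring

lemma goeIncrement_zero (u : ℝ) : goeIncrement 0 u = 2 * goeExcess 1 u := by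
  simp only [goeIncrement, goeExcess, hermiteQuad, goeTail_add_two, goeHermite_add_two]
  simp [goeHermite]; ring

lemma sum_goeIncrement_odd (m : ℕ) (u : ℝ) :
    ∑ k ∈ Finset.range m, goeIncrement (2 * k + 1) u / (k.factorial * Gamma (k + 3 / 2)) =
      goeExcess (2 * m) u / (m.factorial * Gamma (m + 1 / 2)) := by
  induction m with
  | zero => simp [goeExcess_zero]
  | succ m ih =>
    have h3 : Gamma ((m : ℝ) + 3 / 2) = (m + 1 / 2) * Gamma (m + 1 / 2) := by
      rw [← Gamma_add_one (by positivity)]; ring_nf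
    have h1 : Gamma (((m + 1 : ℕ) : ℝ) + 1 / 2) = (m + 1 / 2) * Gamma (m + 1 / 2) := by
      rw [← Gamma_add_one (by positivity)]; push_cast; ring_nf
    have h4 : Gamma ((m : ℝ) + 1 / 2) ≠ 0 := (Gamma_pos_of_pos (by positivity)).ne'
    have h5 : (m : ℝ) + 1 / 2 ≠ 0 := by positivity
    have h6 : (m : ℝ) + 1 ≠ 0 := by positivity
    have h7 : (m.factorial : ℝ) ≠ 0 := by positivity
    rw [Finset.sum_range_succ, ih, goeIncrement_succ, h1, h3, Nat.factorial_succ, mul_add, mul_one]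
    push_cast
    field_simp
    ring

lemma sum_goeIncrement_even (m : ℕ) (u : ℝ) :
    ∑ k ∈ Finset.range (m + 1), goeIncrement (2 * k) u / (k.factorial * Gamma (k + 1 / 2)) =
      goeExcess (2 * m + 1) u / (m.factorial * Gamma (m + 3 / 2)) := by
  induction m with
  | zero =>
    have h3 : Gamma ((3 / 2 : ℝ)) = 1 / 2 * Gamma (1 / 2) := by
      rw [← Gamma_add_one (by norm_num)]; norm_num
    have h4 : Gamma ((1 : ℝ) / 2) ≠ 0 := (Gamma_pos_of_pos (by positivity)).ne'
    simp only [zero_add, Finset.range_one, mul_zero, Finset.sum_singleton, goeIncrement_zero,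
      Nat.factorial_zero, Nat.cast_zero, Nat.cast_one, one_mul, h3]
    field_simp
  | succ m ih =>
    have h3 : Gamma (((m + 1 : ℕ) : ℝ) + 3 / 2) = (m + 3 / 2) * Gamma (m + 3 / 2) := by
      rw [← Gamma_add_one (by positivity)]; push_cast; ring_nf
    have h1 : Gamma (((m + 1 : ℕ) : ℝ) + 1 / 2) = Gamma (m + 3 / 2) := by
      push_cast; ring_nf
    have h4 : Gamma ((m : ℝ) + 3 / 2) ≠ 0 := (Gamma_pos_of_pos (by positivity)).ne'
    have h5 : (m : ℝ) + 3 / 2 ≠ 0 := by positivity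
    have h6 : (m : ℝ) + 1 ≠ 0 := by positivity
    have h7 : (m.factorial : ℝ) ≠ 0 := by positivity
    have h8 : (2 : ℝ) * m + 1 + 2 ≠ 0 := by positivity
    rw [Finset.sum_range_succ, ih, show 2 * (m + 1) = 2 * m + 1 + 1 by ring, goeIncrement_succ, h1,
      h3, Nat.factorial_succ, show 2 * m + 1 + 1 + 1 = 2 * m + 1 + 2 by ring]
    push_cast
    field_simp
    ring

/-! ### Evaluation of the sums over minors. -/

lemma gammaMatrix₁_eq (m : ℕ) : gammaMatrix₁ m = gammaHankel (3 / 2) m := by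
  ext r s
  simp only [gammaMatrix₁, gammaHankel, Matrix.of_apply]
  congr 1; ring

lemma gammaMatrix₂_eq (m : ℕ) : gammaMatrix₂ m = gammaHankel (1 / 2) m := rfl

/-- The `2 × 2` determinant is a difference of two products of a function of `i` and a function of
`j`, so `sum_minors_gammaHankel` applies to each. The resulting Laguerre sums are, up to sign and a
Gaussian factor, `goeHermite`, `goeTail` and a combination of two Hermite polynomials; together they
form `goeIncrement`. -/
lemma sum_minors_gammaMatrix₁ (k : ℕ) (u : ℝ) :
    exp (-(u ^ 2 / 2)) * ∑ i : Fin (k + 1), ∑ j : Fin (k + 1),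
      (deleteRowCol (gammaMatrix₁ (k + 1)) i j).det *
        Matrix.det
          !![hermiteP (2 * ((i : ℤ) + 1) - 1) u, hermiteP (2 * ((j : ℤ) + 1)) u;
             hermiteP (2 * ((i : ℤ) + 1) - 2) u, hermiteP (2 * ((j : ℤ) + 1) - 1) u] =
      (gammaHankel (3 / 2) (k + 1)).det *
        (goeExcess (2 * (k + 1)) u / ((k + 1).factorial * Gamma ((k + 1 : ℕ) + 1 / 2))) := by
  rw [← sum_goeIncrement_odd, gammaMatrix₁_eq]
  have e1 : ∀ i : ℕ, hermiteP (2 * ((i : ℤ) + 1) - 1) u = hermiteP ((2 * i + 1 : ℕ) : ℤ) u :=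
    fun i => by congr 1; push_cast; ring
  have e2 : ∀ i : ℕ, hermiteP (2 * ((i : ℤ) + 1)) u = hermiteP ((2 * i + 1 + 1 : ℕ) : ℤ) u :=
    fun i => by congr 1
  have e0 : ∀ i : ℕ, hermiteP (2 * ((i : ℤ) + 1) - 2) u = hermiteP (2 * (i : ℤ)) u :=
    fun i => by congr 1; ring
  simp only [Matrix.det_fin_two_of, mul_sub, Finset.sum_sub_distrib, e0, e1, e2]
  have s1 := sum_minors_gammaHankel (a := 3 / 2) (by norm_num) k
    (fun i => hermiteP ((2 * i + 1 : ℕ) : ℤ) u) (fun i => hermiteP ((2 * i + 1 : ℕ) : ℤ) u)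
  have s2 := sum_minors_gammaHankel (a := 3 / 2) (by norm_num) k
    (fun i => hermiteP (2 * (i : ℤ)) u) (fun i => hermiteP ((2 * i + 1 + 1 : ℕ) : ℤ) u)
  simp only [mul_comm (hermiteP ((2 * _ + 1 + 1 : ℕ) : ℤ) u)] 
  rw [s1, s2, ← mul_sub, ← mul_sub, mul_left_comm, ← Finset.sum_sub_distrib, Finset.mul_sum]
  congr 1
  refine Finset.sum_congr rfl fun l _ => ?_
  -- Differentiating the Laguerre expansion raises all Hermite indices by one; comparison with the
  -- known derivative evaluates the sum of the `P_{2i+2}`.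
  have hd := (hasDerivAt_laguerreSum (3 / 2) l 1 u).neg
  have hf : goeHermite (2 * l + 1) =
      -fun u => laguerreSum (3 / 2) l (fun i => hermiteP ((2 * i + 1 : ℕ) : ℤ) u) :=
    funext (goeHermite_eq_laguerreSum l).2
  rw [← hf] at hd
  have hu := hd.unique (hasDerivAt_goeHermite (2 * l + 1) u)
  have hH := (goeHermite_eq_laguerreSum l).2 u
  rw [goeIncrement, (goeTail_eq_laguerreSum l u).2]
  have hu2 : 2 * goeHermite (2 * l + 1 + 1) u + u * goeHermite (2 * l + 1) u =
      laguerreSum (3 / 2) l (fun i => hermiteP ((2 * i + 1 + 1 : ℕ) : ℤ) u) := by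
    linear_combination -hu - u * hH
  rw [hu2, hH]
  simp only [laguerreSum]
  ring

lemma sum_minors_gammaMatrix₂ (k : ℕ) (u : ℝ) :
    exp (-(u ^ 2 / 2)) * ∑ i : Fin (k + 1), ∑ j : Fin (k + 1),
      (deleteRowCol (gammaMatrix₂ (k + 1)) i j).det *
        Matrix.det
          !![hermiteP (2 * (i : ℤ)) u, hermiteP (2 * (j : ℤ) + 1) u;
             hermiteP (2 * (i : ℤ) - 1) u, hermiteP (2 * (j : ℤ)) u] =
      (gammaHankel (1 / 2) (k + 1)).det *
        (goeExcess (2 * k + 1) u / (k.factorial * Gamma (k + 3 / 2))) := by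
  rw [← sum_goeIncrement_even, gammaMatrix₂_eq]
  have e1 : ∀ i : ℕ, hermiteP (2 * (i : ℤ)) u = hermiteP ((2 * i + 0 : ℕ) : ℤ) u :=
    fun i => by congr 1
  have e2 : ∀ i : ℕ, hermiteP (2 * (i : ℤ) + 1) u = hermiteP ((2 * i + 0 + 1 : ℕ) : ℤ) u :=
    fun i => by congr 1
  simp only [Matrix.det_fin_two_of, mul_sub, Finset.sum_sub_distrib, e1, e2]
  have s1 := sum_minors_gammaHankel (a := 1 / 2) (by norm_num) k
    (fun i => hermiteP ((2 * i + 0 : ℕ) : ℤ) u) (fun i => hermiteP ((2 * i + 0 : ℕ) : ℤ) u)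
  have s2 := sum_minors_gammaHankel (a := 1 / 2) (by norm_num) k
    (fun i => hermiteP (2 * (i : ℤ) - 1) u) (fun i => hermiteP ((2 * i + 0 + 1 : ℕ) : ℤ) u)
  simp only [mul_comm (hermiteP ((2 * _ + 0 + 1 : ℕ) : ℤ) u)] 
  rw [s1, s2, ← mul_sub, ← mul_sub, mul_left_comm, ← Finset.sum_sub_distrib, Finset.mul_sum]
  congr 1
  refine Finset.sum_congr rfl fun l _ => ?_
  have hd := hasDerivAt_laguerreSum (1 / 2) l 0 u
  have hf : goeHermite (2 * l) =
      fun u => laguerreSum (1 / 2) l (fun i => hermiteP ((2 * i + 0 : ℕ) : ℤ) u) :=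
    funext (goeHermite_eq_laguerreSum l).1
  rw [← hf] at hd
  have hu := hd.unique (hasDerivAt_goeHermite (2 * l) u)
  have hH := (goeHermite_eq_laguerreSum l).1 u
  rw [goeIncrement, (goeTail_eq_laguerreSum l u).1]
  have hu2 : 2 * goeHermite (2 * l + 1) u + u * goeHermite (2 * l) u =
      -laguerreSum (1 / 2) l (fun i => hermiteP ((2 * i + 0 + 1 : ℕ) : ℤ) u) := by
    linear_combination -hu - u * hH
  rw [hu2, hH]
  simp only [laguerreSum]
  ring

lemma prod_Gamma_half_even (m : ℕ) :
    ∏ i ∈ Finset.Icc 1 (2 * m), Gamma ((i : ℝ) / 2) =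
      ∏ k ∈ Finset.range m, (k.factorial * Gamma (k + 1 / 2)) := by
  induction m with
  | zero => simp
  | succ m ih =>
    rw [Finset.prod_range_succ, ← ih, show 2 * (m + 1) = 2 * m + 1 + 1 by ring,
      Finset.prod_Icc_succ_top (by omega), Finset.prod_Icc_succ_top (by omega), mul_assoc]
    congr 1
    rw [← Gamma_nat_eq_factorial, mul_comm]
    push_cast
    congr 2 <;> ring_nf

/-- Shifting the Gamma factors by one index leaves only the ends `Γ(1/2) = √π` and `Γ(m + 1/2)`.
This is why the even case carries `√(2π)` and the odd case only `√2`. -/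
lemma prod_Gamma_add_three_half (m : ℕ) :
    (∏ k ∈ Finset.range m, (k.factorial * Gamma (k + 3 / 2))) * √π =
      (∏ k ∈ Finset.range m, (k.factorial * Gamma (k + 1 / 2))) * Gamma (m + 1 / 2) := by
  induction m with
  | zero => rw [Nat.cast_zero, zero_add, Gamma_one_half_eq]; simp
  | succ m ih =>
    have h1 : Gamma (((m + 1 : ℕ) : ℝ) + 1 / 2) = Gamma (m + 3 / 2) := by
      push_cast; ring_nf
    rw [Finset.prod_range_succ, Finset.prod_range_succ, h1]
    linear_combination (m.factorial * Gamma (m + 3 / 2)) * ih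

/-- The right-hand side of the even case. -/
lemma minors_formula_even (k : ℕ) (u : ℝ) :
    √(2 * π) * exp (-(u ^ 2 / 2)) /
        (∏ i ∈ Finset.Icc 1 (2 * (k + 1)), Gamma ((i : ℝ) / 2)) *
      ∑ i : Fin (k + 1), ∑ j : Fin (k + 1),
        (deleteRowCol (gammaMatrix₁ (k + 1)) i j).det *
          Matrix.det
            !![hermiteP (2 * ((i : ℤ) + 1) - 1) u, hermiteP (2 * ((j : ℤ) + 1)) u;
               hermiteP (2 * ((i : ℤ) + 1) - 2) u, hermiteP (2 * ((j : ℤ) + 1) - 1) u] =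
      2 * √2 / ((2 * (k + 1) : ℕ) * Gamma ((2 * (k + 1) : ℕ) / 2)) *
        goeExcess (2 * (k + 1)) u := by
  rw [mul_comm (√(2 * π)), mul_div_assoc, mul_assoc, mul_left_comm, sum_minors_gammaMatrix₁,
    det_gammaHankel (by norm_num), prod_Gamma_half_even]
  have h := prod_Gamma_add_three_half (k + 1)
  have hP : ∏ k ∈ Finset.range (k + 1), (k.factorial * Gamma (k + 1 / 2) : ℝ) ≠ 0 :=
    Finset.prod_ne_zero_iff.2 fun i _ =>
      mul_ne_zero (by positivity) (Gamma_pos_of_pos (by positivity)).ne'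
  have hG : Gamma (((k + 1 : ℕ) : ℝ) + 1 / 2) ≠ 0 := (Gamma_pos_of_pos (by positivity)).ne'
  have hg : Gamma (((2 * (k + 1) : ℕ) : ℝ) / 2) = k.factorial := by
    rw [← Gamma_nat_eq_factorial]; congr 1; push_cast; ring
  have hpi : √π ≠ 0 := by positivity
  have h7 : (k.factorial : ℝ) ≠ 0 := by positivity
  have h8 : (k : ℝ) + 1 ≠ 0 := by positivity
  rw [hg, Nat.factorial_succ, sqrt_mul (by norm_num)]
  set A := ∏ k ∈ Finset.range (k + 1), (k.factorial * Gamma (k + 3 / 2) : ℝ)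
  set B := ∏ k ∈ Finset.range (k + 1), (k.factorial * Gamma (k + 1 / 2) : ℝ)
  set c := Gamma (((k + 1 : ℕ) : ℝ) + 1 / 2)
  push_cast
  field_simp
  linear_combination goeExcess (2 * (k + 1)) u * h

/-- The right-hand side of the odd case. -/
lemma minors_formula_odd (k : ℕ) (u : ℝ) :
    √2 * exp (-(u ^ 2 / 2)) /
        (∏ i ∈ Finset.Icc 1 (2 * k + 1), Gamma ((i : ℝ) / 2)) *
      ∑ i : Fin (k + 1), ∑ j : Fin (k + 1),
        (deleteRowCol (gammaMatrix₂ (k + 1)) i j).det *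
          Matrix.det
            !![hermiteP (2 * (i : ℤ)) u, hermiteP (2 * (j : ℤ) + 1) u;
               hermiteP (2 * (i : ℤ) - 1) u, hermiteP (2 * (j : ℤ)) u] =
      2 * √2 / ((2 * k + 1 : ℕ) * Gamma ((2 * k + 1 : ℕ) / 2)) * goeExcess (2 * k + 1) u := by
  rw [mul_comm √2, mul_div_assoc, mul_assoc, mul_left_comm, sum_minors_gammaMatrix₂,
    det_gammaHankel (by norm_num), Finset.prod_Icc_succ_top (by omega), prod_Gamma_half_even,
    Finset.prod_range_succ]
  have hP : ∏ k ∈ Finset.range k, (k.factorial * Gamma (k + 1 / 2) : ℝ) ≠ 0 :=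
    Finset.prod_ne_zero_iff.2 fun i _ =>
      mul_ne_zero (by positivity) (Gamma_pos_of_pos (by positivity)).ne'
  have hG : Gamma ((k : ℝ) + 1 / 2) ≠ 0 := (Gamma_pos_of_pos (by positivity)).ne'
  have hg : Gamma (((2 * k + 1 : ℕ) : ℝ) / 2) = Gamma (k + 1 / 2) := by
    congr 1; push_cast; ring
  have h3 : Gamma ((k : ℝ) + 3 / 2) = (k + 1 / 2) * Gamma (k + 1 / 2) := by
    rw [← Gamma_add_one (by positivity)]; ring_nf
  have h7 : (k.factorial : ℝ) ≠ 0 := by positivity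
  have h8 : (k : ℝ) + 1 / 2 ≠ 0 := by positivity
  have h9 : (2 : ℝ) * k + 1 ≠ 0 := by positivity
  rw [hg, h3]
  set A := ∏ k ∈ Finset.range k, (k.factorial * Gamma (k + 1 / 2) : ℝ)
  set c := Gamma ((k : ℝ) + 1 / 2)
  push_cast
  field_simp

/-! ### Uniqueness for the Hermite equation and behaviour at `-∞`. -/

open Filter Topology in
lemma tendsto_goeHermite_div (d : ℕ) :
    Tendsto (fun u => goeHermite d u / (-u) ^ d) atBot (𝓝 1) := by
  induction d using Nat.strong_induction_on with
  | _ d ih =>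
    match d with
    | 0 => simp [goeHermite]
    | 1 =>
      refine tendsto_const_nhds.congr' ?_
      filter_upwards [eventually_lt_atBot (0 : ℝ)] with u hu
      rw [goeHermite, pow_one, div_self (by linarith)]
    | d + 2 =>
      have h1 := ih (d + 1) (by omega)
      have h0 := ih d (by omega)
      have hz : Tendsto (fun u : ℝ => ((d : ℝ) + 1) / 2 * (u⁻¹ * u⁻¹)) atBot (𝓝 0) := by
        simpa using (tendsto_inv_atBot_zero.mul tendsto_inv_atBot_zero).const_mul (((d : ℝ) + 1) / 2)
      have := h1.sub (hz.mul h0)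
      rw [zero_mul, sub_zero] at this
      refine this.congr' ?_
      filter_upwards [eventually_lt_atBot (0 : ℝ)] with u hu
      have hu' : u ≠ 0 := hu.ne
      rw [goeHermite_add_two]
      have h3 : (-u) ^ d ≠ 0 := pow_ne_zero _ (by linarith)
      rw [pow_succ (-u) (d + 1), pow_succ]
      field_simp

open Filter Topology in
/-- A solution of the Hermite equation that is small at `-∞` vanishes. -/
lemma hermite_ode_eq_zero {d : ℕ} {y y' y'' : ℝ → ℝ} (h1 : ∀ u, HasDerivAt y (y' u) u)
    (h2 : ∀ u, HasDerivAt y' (y'' u) u)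
    (hode : ∀ u, 1 / 2 * y'' u - u * y' u + d * y u = 0)
    (hlim : Tendsto (fun u => y u / (-u) ^ d) atBot (𝓝 0)) (u : ℝ) : y u = 0 := by
  set H := goeHermite d
  set H1 : ℝ → ℝ := fun u => 2 * goeHermite (d + 1) u + 2 * u * goeHermite d u
  have hH : ∀ u, HasDerivAt H (H1 u) u := hasDerivAt_goeHermite d
  have hH1 : ∀ u, HasDerivAt H1 (2 * u * H1 u - 2 * d * H u) u := fun u => by
    refine (((hasDerivAt_goeHermite_succ d u).const_mul 2).add
      (((hasDerivAt_id u).const_mul 2).mul (hasDerivAt_goeHermite d u))).congr_deriv ?_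
    simp only [H, H1, id]
    ring
  have hy'' : ∀ u, y'' u = 2 * u * y' u - 2 * d * y u := fun u => by linarith [hode u]
  have hE : ∀ u : ℝ, HasDerivAt (fun u : ℝ => exp (-u ^ 2)) (exp (-u ^ 2) * (-2 * u)) u :=
    fun u => by
      refine ((hasDerivAt_id u).pow 2).neg.exp.congr_deriv ?_
      simp only [Pi.neg_apply, Pi.pow_apply, id]
      push_cast
      ring
  -- The Wronskian with the polynomial solution is a constant multiple of `exp (u ^ 2)`.
  obtain ⟨K, hK⟩ : ∃ K, ∀ u, y' u * H u - y u * H1 u = K * exp (u ^ 2) := by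
    have hW : ∀ u, HasDerivAt (fun u => exp (-u ^ 2) * (y' u * H u - y u * H1 u)) 0 u := fun u => by
      refine ((hE u).mul (((h2 u).mul (hH u)).sub ((h1 u).mul (hH1 u)))).congr_deriv ?_
      rw [hy'']
      simp only [Pi.sub_apply, Pi.mul_apply]
      ring
    refine ⟨exp (-0 ^ 2) * (y' 0 * H 0 - y 0 * H1 0), fun u => ?_⟩
    have := is_const_of_deriv_eq_zero (fun u => (hW u).differentiableAt) (fun u => (hW u).deriv) u 0
    rw [← this, mul_right_comm, ← exp_add]
    simp
  have hquot := tendsto_goeHermite_div d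
  obtain ⟨R, hR0, hR⟩ : ∃ R : ℝ, R < 0 ∧ ∀ u ≤ R, 0 < H u ∧ H u ≤ 2 * (-u) ^ d := by
    have e1 := hquot.eventually (lt_mem_nhds (show (0 : ℝ) < 1 by norm_num))
    have e2 := hquot.eventually (gt_mem_nhds (show (1 : ℝ) < 2 by norm_num))
    obtain ⟨R, hR⟩ := eventually_atBot.1 (e1.and e2)
    refine ⟨min R (-1), by simp, fun u hu => ?_⟩
    have hu0 : u < 0 := lt_of_le_of_lt (hu.trans (min_le_right _ _)) (by norm_num)
    have hp : 0 < (-u) ^ d := pow_pos (by linarith) _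
    obtain ⟨a, b⟩ := hR u (hu.trans (min_le_left _ _))
    exact ⟨(div_pos_iff_of_pos_right hp).1 a, ((div_lt_iff₀ hp).1 b).le⟩
  have hf : ∀ u ≤ R, HasDerivAt (fun u => y u / H u) (K * (exp (u ^ 2) / H u ^ 2)) u :=
    fun u hu => by
      refine ((h1 u).div (hH u) (hR u hu).1.ne').congr_deriv ?_
      rw [hK]; ring
  have hflim : Tendsto (fun u => y u / H u) atBot (𝓝 0) := by
    have := hlim.div hquot one_ne_zero
    rw [zero_div] at this
    refine this.congr' ?_
    filter_upwards [eventually_lt_atBot (0 : ℝ)] with u hu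
    have hp : (-u) ^ d ≠ 0 := pow_ne_zero _ (by linarith)
    simp only [Pi.div_apply]
    rw [div_div_div_cancel_right₀ hp]
  -- From `H ≤ 2 (-u)^d` and `u^(2d) ≤ d! exp (u²)`: the factor of `K` in the derivative of `y / H`
  -- stays away from zero.
  have hbound : ∀ u ≤ R, 1 / (4 * d.factorial : ℝ) ≤ exp (u ^ 2) / H u ^ 2 := fun u hu => by
    obtain ⟨a, b⟩ := hR u hu
    have c : H u ^ 2 ≤ 4 * (u ^ 2) ^ d := by
      calc H u ^ 2 ≤ (2 * (-u) ^ d) ^ 2 := by gcongr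
        _ = 4 * (u ^ 2) ^ d := by rw [mul_pow, ← pow_mul, mul_comm d, pow_mul]; norm_num
    have e := pow_div_factorial_le_exp (u ^ 2) (by positivity) d
    rw [div_le_iff₀ (by positivity)] at e
    rw [div_le_div_iff₀ (by positivity) (by positivity)]
    nlinarith
  have hmvt : ∀ u < R, |K| * (1 / (4 * d.factorial : ℝ)) * (R - u) ≤ |y R / H R - y u / H u| := by
    intro u hu
    obtain ⟨c, hc, he⟩ := exists_hasDerivAt_eq_slope (fun u => y u / H u)
      (fun u => K * (exp (u ^ 2) / H u ^ 2)) hu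
      (HasDerivAt.continuousOn fun x hx => hf x hx.2) (fun x hx => hf x hx.2.le)
    rw [eq_div_iff (by linarith)] at he
    rw [← he, abs_mul, abs_mul, abs_of_pos (show 0 < R - u by linarith)]
    refine mul_le_mul_of_nonneg_right ?_ (by linarith)
    exact mul_le_mul_of_nonneg_left ((hbound c hc.2.le).trans (le_abs_self _)) (abs_nonneg _)
  -- For `K ≠ 0` the quotient `y / H` would change at least linearly towards `-∞`, contradicting its
  -- limit `0`.
  have hK0 : K = 0 := by
    by_contra hne
    have hc : 0 < |K| * (1 / (4 * d.factorial : ℝ)) := by positivity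
    have t1 : Tendsto (fun u => |K| * (1 / (4 * d.factorial : ℝ)) * (R - u)) atBot atTop := by
      refine Tendsto.const_mul_atTop hc ?_
      exact (tendsto_atTop_add_const_left atBot R tendsto_neg_atBot_atTop).congr fun u => by ring
    have t2 : Tendsto (fun u => |y R / H R - y u / H u|) atBot (𝓝 |y R / H R - 0|) :=
      (tendsto_const_nhds.sub hflim).abs
    refine not_tendsto_nhds_of_tendsto_atTop (tendsto_atTop_mono' _ ?_ t1) _ t2
    filter_upwards [eventually_lt_atBot R] with u hu using hmvt u hu
  have hfR : y R / H R = 0 := by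
    have hconst : ∀ u < R, y u / H u = y R / H R := fun u hu => by
      obtain ⟨c, hc, he⟩ := exists_hasDerivAt_eq_slope (fun u => y u / H u)
        (fun u => K * (exp (u ^ 2) / H u ^ 2)) hu
        (HasDerivAt.continuousOn fun x hx => hf x hx.2) (fun x hx => hf x hx.2.le)
      rw [hK0, zero_mul, eq_comm, div_eq_zero_iff] at he
      rcases he with he | he <;> linarith
    refine tendsto_nhds_unique (tendsto_const_nhds.congr' ?_) hflim
    filter_upwards [eventually_lt_atBot R] with u hu using (hconst u hu).symm
  have hyR : y R = 0 := by
    rcases div_eq_zero_iff.1 hfR with h | h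
    · exact h
    · exact absurd h (hR R le_rfl).1.ne'
  have hy'R : y' R = 0 := by
    have := hK R
    rw [hyR, hK0, zero_mul, zero_mul, sub_zero] at this
    exact (mul_eq_zero.1 this).resolve_right (hR R le_rfl).1.ne'
  -- A bounded interval around both `R` and `u`, on which the first-order system is uniformly
  -- Lipschitz; the zero Cauchy data at `R` then propagate to `u`.
  set T := |u| + |R| + 1
  have hT : 0 ≤ T := by positivity
  have huT : u ∈ Set.Ioo (-T) T := by
    rw [Set.mem_Ioo, ← abs_lt]; simp only [T]; linarith [abs_nonneg R]
  have hRT : R ∈ Set.Ioo (-T) T := by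
    rw [Set.mem_Ioo, ← abs_lt]; simp only [T]; linarith [abs_nonneg u]
  have key := ODE_solution_unique_of_mem_Ioo (E := ℝ × ℝ) (a := -T) (b := T) (t₀ := R)
    (K := Real.toNNReal (2 * T + 2 * d + 1))
    (v := fun t x => (x.2, 2 * t * x.2 - 2 * d * x.1)) (s := fun _ => Set.univ)
    (f := fun t => (y t, y' t)) (g := fun _ => 0) ?_ hRT ?_ ?_ ?_ huT
  · exact congrArg Prod.fst key
  · intro t ht
    refine (LipschitzWith.of_dist_le_mul fun x z => ?_).lipschitzOnWith
    have htT : |t| ≤ T := (abs_lt.2 ht).le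
    simp only [dist_eq_norm, Prod.norm_def, Prod.fst_sub, Prod.snd_sub,
      Real.norm_eq_abs]
    rw [Real.coe_toNNReal _ (by positivity)]
    have n1 : |x.1 - z.1| ≤ max |x.1 - z.1| |x.2 - z.2| := le_max_left _ _
    have n2 : |x.2 - z.2| ≤ max |x.1 - z.1| |x.2 - z.2| := le_max_right _ _
    set M := max |x.1 - z.1| |x.2 - z.2|
    have hM : 0 ≤ M := (abs_nonneg _).trans n1
    refine max_le ?_ ?_
    · have : 0 ≤ (2 * T + 2 * d) * M := by positivity
      nlinarith
    · calc |2 * t * x.2 - 2 * d * x.1 - (2 * t * z.2 - 2 * d * z.1)|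
          = |2 * t * (x.2 - z.2) - 2 * d * (x.1 - z.1)| := by ring_nf
        _ ≤ |2 * t * (x.2 - z.2)| + |2 * d * (x.1 - z.1)| := abs_sub _ _
        _ = 2 * |t| * |x.2 - z.2| + 2 * d * |x.1 - z.1| := by
            rw [abs_mul, abs_mul, abs_mul, abs_mul]; simp
        _ ≤ 2 * T * M + 2 * d * M := by gcongr
        _ ≤ (2 * T + 2 * d + 1) * M := by nlinarith
  · intro t _
    refine ⟨((h1 t).prodMk (h2 t)).congr_deriv ?_, Set.mem_univ _⟩
    rw [hy'']
  · intro t _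
    refine ⟨(hasDerivAt_const t (0 : ℝ × ℝ)).congr_deriv ?_, Set.mem_univ _⟩
    ext <;> simp
  · simp [hyR, hy'R]

open Filter Topology in
lemma tendsto_goeSquare_div (k : ℕ) :
    Tendsto (fun u => goeSquare k u / (-u) ^ (2 * k)) atBot (𝓝 1) := by
  obtain ⟨p, hm, hd, he⟩ := exists_polynomial_goeSquare k
  have h := p.isEquivalent_atBot_lead
  rw [hm.leadingCoeff, hd] at h
  simp only [one_mul, funext he] at h
  have hne : ∀ᶠ u : ℝ in atBot, u ^ (2 * k) ≠ 0 := by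
    filter_upwards [eventually_lt_atBot (0 : ℝ)] with u hu using pow_ne_zero _ hu.ne
  have := (Asymptotics.isEquivalent_iff_tendsto_one hne).1 h
  refine this.congr fun u => ?_
  rw [Pi.div_apply, Even.neg_pow (even_two_mul k)]

open Filter Topology in
lemma tendsto_exp_neg_sq_half_mul_pow (m : ℕ) :
    Tendsto (fun u : ℝ => exp (-(u ^ 2 / 2)) * (-u) ^ m) atBot (𝓝 0) := by
  have h := (tendsto_pow_mul_exp_neg_atTop_nhds_zero m).comp tendsto_neg_atBot_atTop
  refine squeeze_zero' ?_ ?_ h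
  · filter_upwards [eventually_lt_atBot (0 : ℝ)] with u hu
    have : 0 < -u := by linarith
    positivity
  · filter_upwards [eventually_lt_atBot (-2 : ℝ)] with u hu
    have : 0 < -u := by linarith
    simp only [Function.comp]
    rw [mul_comm]
    refine mul_le_mul_of_nonneg_left (exp_le_exp.2 ?_) (by positivity)
    nlinarith

open Filter Topology in
lemma tendsto_exp_mul_goeHermite (k : ℕ) :
    Tendsto (fun u : ℝ => exp (-(u ^ 2 / 2)) * goeHermite k u) atBot (𝓝 0) := by
  have := (tendsto_exp_neg_sq_half_mul_pow k).mul (tendsto_goeHermite_div k)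
  rw [zero_mul] at this
  refine this.congr' ?_
  filter_upwards [eventually_lt_atBot (0 : ℝ)] with u hu
  have : (-u) ^ k ≠ 0 := pow_ne_zero _ (by linarith)
  field_simp

open Filter Topology in
lemma tendsto_goeTail (k : ℕ) : Tendsto (goeTail k) atBot (𝓝 0) := by
  induction k using Nat.strong_induction_on with
  | _ k ih =>
    match k with
    | 0 =>
      have hI := integrable_exp_neg_sq_half
      have h := intervalIntegral_tendsto_integral_Iic (0 : ℝ) hI.integrableOn tendsto_id
        (μ := volume) (l := atBot)
      have h2 := (tendsto_const_nhds (x := ∫ t in Set.Iic (0 : ℝ), exp (-(t ^ 2 / 2)))).sub h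
      rw [sub_self] at h2
      refine h2.congr fun u => ?_
      rw [id, ← intervalIntegral.integral_Iic_sub_Iic hI.integrableOn hI.integrableOn, goeTail]
      ring
    | 1 =>
      refine (tendsto_exp_mul_goeHermite 0).congr fun u => ?_
      simp [goeHermite, goeTail]
    | k + 2 =>
      have := (tendsto_exp_mul_goeHermite (k + 1)).add ((ih k (by omega)).const_mul (((k : ℝ) + 1) / 2))
      rw [mul_zero, add_zero] at this
      exact this.congr fun u => (goeTail_add_two k u).symm

open Filter Topology in
-- Each term contains a Gaussian factor or `goeTail`, which beats the polynomial growth. This is the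
-- growth condition of `hermite_ode_eq_zero`.
lemma tendsto_goeExcess_div (n : ℕ) :
    Tendsto (fun u => goeExcess n u / (-u) ^ n) atBot (𝓝 0) := by
  have hp := tendsto_goeHermite_div n
  have hq := tendsto_goeHermite_div (n + 1)
  have h1 := hp.mul (tendsto_goeTail (n + 1))
  have h2 := ((tendsto_exp_neg_sq_half_mul_pow n).mul (hp.mul hp)).const_mul ((n : ℝ) + 1)
  have h3 := ((tendsto_exp_neg_sq_half_mul_pow (n + 2)).mul (hp.mul hq)).const_mul (-2)
  have h4 := ((tendsto_exp_neg_sq_half_mul_pow (n + 2)).mul (hq.mul hq)).const_mul 2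
  have := h1.neg.add ((h2.add h3).add h4)
  simp only [mul_zero, zero_mul, neg_zero, add_zero] at this
  refine this.congr' ?_
  filter_upwards [eventually_lt_atBot (0 : ℝ)] with u hu
  have hu' : u ≠ 0 := hu.ne
  have h3 : (-u) ^ n ≠ 0 := pow_ne_zero _ (by linarith)
  simp only [goeExcess, hermiteQuad, pow_succ (-u)]
  field_simp

/-! ### Symmetric matrices in coordinates and the Jacobian of a congruence. -/

instance matrixBorelSpace (n : ℕ) : BorelSpace (Matrix (Fin n) (Fin n) ℝ) :=
  inferInstanceAs (BorelSpace (Fin n → Fin n → ℝ))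

lemma symMatrix_apply {n : ℕ} (a : UpperIdx n → ℝ) (i j : Fin n) :
    symMatrix n a i j = a ⟨(min i j, max i j), min_le_max⟩ := rfl

lemma isSymm_symMatrix {n : ℕ} (a : UpperIdx n → ℝ) : (symMatrix n a).IsSymm := by
  ext i j
  simp only [Matrix.transpose_apply, symMatrix_apply, min_comm j i, max_comm j i]

lemma symMatrix_apply_of_le {n : ℕ} (a : UpperIdx n → ℝ) (p : UpperIdx n) :
    symMatrix n a p.1.1 p.1.2 = a p := by
  obtain ⟨⟨i, j⟩, h⟩ := p
  have h : i ≤ j := h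
  simp only [symMatrix_apply, min_eq_left h, max_eq_right h]

/-- The entries on and above the diagonal. -/
def upperEntries {n : ℕ} (A : Matrix (Fin n) (Fin n) ℝ) : UpperIdx n → ℝ := fun p => A p.1.1 p.1.2

@[simp]
lemma upperEntries_symMatrix {n : ℕ} (a : UpperIdx n → ℝ) : upperEntries (symMatrix n a) = a :=
  funext fun p => symMatrix_apply_of_le a p

lemma symMatrix_upperEntries {n : ℕ} {A : Matrix (Fin n) (Fin n) ℝ} (hA : A.IsSymm) :
    symMatrix n (upperEntries A) = A := by
  ext i j
  rw [symMatrix_apply]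
  rcases le_total i j with h | h
  · simp [upperEntries, h]
  · simp only [upperEntries, min_eq_right h, max_eq_left h]
    exact hA.apply i j

lemma continuous_symMatrix (n : ℕ) : Continuous (symMatrix n) :=
  continuous_matrix fun _ _ => continuous_apply _

lemma symMatrix_add {n : ℕ} (a b : UpperIdx n → ℝ) :
    symMatrix n (a + b) = symMatrix n a + symMatrix n b := rfl

lemma symMatrix_smul {n : ℕ} (c : ℝ) (a : UpperIdx n → ℝ) :
    symMatrix n (c • a) = c • symMatrix n a := rfl

open scoped Matrix

/-- The congruence `A ↦ P A Pᵀ` on symmetric matrices, in coordinates. -/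
def congruence {n : ℕ} (P : Matrix (Fin n) (Fin n) ℝ) : (UpperIdx n → ℝ) →ₗ[ℝ] (UpperIdx n → ℝ) where
  toFun a := upperEntries (P * symMatrix n a * Pᵀ)
  map_add' a b := by
    rw [symMatrix_add, Matrix.mul_add, Matrix.add_mul]; rfl
  map_smul' c a := by
    rw [symMatrix_smul, Matrix.mul_smul, Matrix.smul_mul]; rfl

lemma symMatrix_congruence {n : ℕ} (P : Matrix (Fin n) (Fin n) ℝ) (a : UpperIdx n → ℝ) :
    symMatrix n (congruence P a) = P * symMatrix n a * Pᵀ := by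
  have h : (P * symMatrix n a * Pᵀ).IsSymm := by
    rw [Matrix.IsSymm, Matrix.transpose_mul, Matrix.transpose_mul, Matrix.transpose_transpose,
      (isSymm_symMatrix a).eq, Matrix.mul_assoc]
  exact symMatrix_upperEntries h

lemma congruence_mul {n : ℕ} (P Q : Matrix (Fin n) (Fin n) ℝ) :
    congruence (P * Q) = congruence P ∘ₗ congruence Q := by
  ext1 a
  refine LinearMap.ext fun b => ?_
  have : symMatrix n (congruence (P * Q) (Pi.single a b)) =
      symMatrix n (congruence P (congruence Q (Pi.single a b))) := by
    simp only [symMatrix_congruence, Matrix.transpose_mul, Matrix.mul_assoc]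
  have := congrArg upperEntries this
  simpa using this

lemma congruence_one (n : ℕ) : congruence (1 : Matrix (Fin n) (Fin n) ℝ) = LinearMap.id := by
  refine LinearMap.ext fun a => ?_
  simp [congruence]

lemma det_congruence_mul {n : ℕ} (P Q : Matrix (Fin n) (Fin n) ℝ) :
    LinearMap.det (congruence (P * Q)) =
      LinearMap.det (congruence P) * LinearMap.det (congruence Q) := by
  rw [congruence_mul, LinearMap.det_comp]

/-- The products over `i ≤ j` and over `j ≤ i` agree by symmetry and overlap on the diagonal, so the
square of either is `(∏ d) ^ (2 n + 2)`. Absolute values allow taking the root. -/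
lemma prod_upperIdx {n : ℕ} (d : Fin n → ℝ) :
    |∏ p : UpperIdx n, d p.1.1 * d p.1.2| = |∏ i, d i| ^ (n + 1) := by
  have h1 : ∏ p : UpperIdx n, d p.1.1 * d p.1.2 =
      ∏ p : Fin n × Fin n with p.1 ≤ p.2, d p.1 * d p.2 :=
    (Finset.prod_subtype (p := fun p : Fin n × Fin n => p.1 ≤ p.2)
      (Finset.univ.filter fun p : Fin n × Fin n => p.1 ≤ p.2) (by simp)
      (fun p => d p.1 * d p.2)).symm
  have h2 : ∏ p : Fin n × Fin n with p.1 ≤ p.2, d p.1 * d p.2 =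
      ∏ p : Fin n × Fin n with p.2 ≤ p.1, d p.1 * d p.2 := by
    refine Finset.prod_bij' (fun p _ => p.swap) (fun p _ => p.swap) ?_ ?_ ?_ ?_ ?_ <;>
      simp [mul_comm]
  have h3 : (∏ p : Fin n × Fin n with p.1 ≤ p.2, d p.1 * d p.2) *
      ∏ p : Fin n × Fin n with p.2 ≤ p.1, d p.1 * d p.2 = (∏ i, d i) ^ (2 * (n + 1)) := by
    have hu : (Finset.univ.filter fun p : Fin n × Fin n => p.1 ≤ p.2) ∪
        (Finset.univ.filter fun p : Fin n × Fin n => p.2 ≤ p.1) = Finset.univ := by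
      ext p; simpa using le_total p.1 p.2
    have hi : (Finset.univ.filter fun p : Fin n × Fin n => p.1 ≤ p.2) ∩
        (Finset.univ.filter fun p : Fin n × Fin n => p.2 ≤ p.1) = Finset.univ.diag := by
      ext p; simp [le_antisymm_iff]
    rw [← Finset.prod_union_inter, hu, hi, Finset.prod_diag, ← Finset.univ_product_univ,
      Finset.prod_product]
    simp only [Finset.prod_mul_distrib, Finset.prod_const, Finset.card_univ, Fintype.card_fin,
      Finset.prod_pow]
    ring
  rw [h1]
  rw [← h2, ← sq] at h3
  have := congrArg abs h3
  rw [abs_pow, abs_pow, mul_comm 2, pow_mul] at this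
  exact (pow_left_inj₀ (abs_nonneg _) (by positivity) two_ne_zero).1 this

/-- Congruence by `P` scales Lebesgue measure on symmetric matrices by `|det P| ^ (n + 1)`. -/
lemma abs_det_congruence {n : ℕ} (P : Matrix (Fin n) (Fin n) ℝ) (hP : P.det ≠ 0) :
    |LinearMap.det (congruence P)| = |P.det| ^ (n + 1) := by
  have hdiag : ∀ D : Fin n → ℝ, LinearMap.det (congruence (Matrix.diagonal D)) =
      ∏ p : UpperIdx n, D p.1.1 * D p.1.2 := by
    intro D
    have : congruence (Matrix.diagonal D) =
        Matrix.toLin' (Matrix.diagonal fun p : UpperIdx n => D p.1.1 * D p.1.2) := by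
      refine LinearMap.ext fun a => funext fun p => ?_
      rw [Matrix.toLin'_apply, Matrix.mulVec_diagonal]
      simp only [congruence, LinearMap.coe_mk, AddHom.coe_mk, upperEntries]
      rw [Matrix.diagonal_transpose, Matrix.mul_diagonal, Matrix.diagonal_mul,
        symMatrix_apply_of_le]
      ring
    rw [this, LinearMap.det_toLin', Matrix.det_diagonal]
  refine Matrix.diagonal_transvection_induction_of_det_ne_zero
    (fun P => |LinearMap.det (congruence P)| = |P.det| ^ (n + 1)) P hP ?_ ?_ ?_
  · intro D _
    rw [hdiag, prod_upperIdx, Matrix.det_diagonal]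
  · intro t
    obtain ⟨i, j, hij, c⟩ := t
    simp only [Matrix.TransvectionStruct.toMatrix_mk, Matrix.det_transvection_of_ne i j hij,
      abs_one, one_pow]
    -- Conjugation by `D` doubles the parameter `c`, that is, squares the transvection. By
    -- multiplicativity the nonzero determinant of its congruence equals its own square, hence is
    -- `1`.
    set D : Fin n → ℝ := Function.update 1 i 2
    have hDi : D i = 2 := by simp [D]
    have hDj : D j = 1 := by simp [D, hij.symm]
    have hcomm : Matrix.diagonal D * Matrix.transvection i j c =
        Matrix.transvection i j c * Matrix.transvection i j c * Matrix.diagonal D := by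
      rw [Matrix.transvection_mul_transvection_same i j hij]
      simp only [Matrix.transvection, Matrix.mul_add, Matrix.add_mul, Matrix.mul_one, Matrix.one_mul]
      congr 1
      ext a b
      rw [Matrix.diagonal_mul, Matrix.mul_diagonal]
      simp only [Matrix.single_apply]
      split_ifs with h
      · rw [← h.1, ← h.2, hDi, hDj]; ring
      · simp
    have hD : LinearMap.det (congruence (Matrix.diagonal D)) ≠ 0 := by
      rw [hdiag]
      have h0 : ∀ a, D a ≠ 0 := fun a => by
        by_cases h : a = i
        · rw [h, hDi]; norm_num
        · simp [D, h]
      exact Finset.prod_ne_zero_iff.2 fun p _ => mul_ne_zero (h0 _) (h0 _)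
    have ht : LinearMap.det (congruence (Matrix.transvection i j c)) ≠ 0 := by
      intro h
      have h1 : congruence (Matrix.transvection i j (-c) * Matrix.transvection i j c) =
          LinearMap.id := by
        rw [Matrix.transvection_mul_transvection_same i j hij, neg_add_cancel,
          Matrix.transvection_zero, congruence_one]
      have h2 := congrArg LinearMap.det h1
      rw [det_congruence_mul, h, mul_zero, LinearMap.det_id] at h2
      exact zero_ne_one h2
    have h3 := congrArg (fun M => LinearMap.det (congruence M)) hcomm
    simp only [det_congruence_mul] at h3
    have h4 : LinearMap.det (congruence (Matrix.transvection i j c)) = 1 := by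
      rw [mul_comm] at h3
      have h5 := mul_right_cancel₀ hD h3
      have h6 : LinearMap.det (congruence (Matrix.transvection i j c)) * 1 = _ :=
        (mul_one _).trans h5
      exact (mul_left_cancel₀ ht h6).symm
    rw [h4, abs_one]
  · intro A B _ _ hA hB
    rw [det_congruence_mul, abs_mul, hA, hB, Matrix.det_mul, abs_mul, mul_pow]

lemma det_congruence_ne_zero {n : ℕ} {P : Matrix (Fin n) (Fin n) ℝ} (hP : P.det ≠ 0) :
    LinearMap.det (congruence P) ≠ 0 := by
  rw [← abs_ne_zero, abs_det_congruence P hP]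
  exact pow_ne_zero _ (abs_ne_zero.2 hP)

lemma measurable_congruence {n : ℕ} (P : Matrix (Fin n) (Fin n) ℝ) : Measurable (congruence P) :=
  (LinearMap.continuous_of_finiteDimensional _).measurable

lemma lintegral_congruence {n : ℕ} {P : Matrix (Fin n) (Fin n) ℝ} (hP : P.det ≠ 0)
    {f : (UpperIdx n → ℝ) → ENNReal} (hf : Measurable f) :
    ∫⁻ a, f (congruence P a) = ENNReal.ofReal ((|P.det| ^ (n + 1))⁻¹) * ∫⁻ a, f a := by
  rw [← lintegral_map hf (measurable_congruence P),
    Measure.map_linearMap_addHaar_eq_smul_addHaar _ (det_congruence_ne_zero hP),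
    lintegral_smul_measure, abs_inv, abs_det_congruence P hP, smul_eq_mul]

lemma measurePreserving_congruence {n : ℕ} {P : Matrix (Fin n) (Fin n) ℝ} (hP : |P.det| = 1) :
    MeasurePreserving (congruence P) := by
  have h0 : P.det ≠ 0 := by
    rw [← abs_ne_zero, hP]; exact one_ne_zero
  refine ⟨measurable_congruence P, ?_⟩
  rw [Measure.map_linearMap_addHaar_eq_smul_addHaar _ (det_congruence_ne_zero h0), abs_inv,
    abs_det_congruence P h0, hP]
  simp

/-! ### Splitting off the first row and column. -/

/-- The matrix with first row `(x, b)`, first column `(x, b)ᵀ` and lower right block `C`. -/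
def borderMatrix {k : ℕ} (x : ℝ) (b : Fin k → ℝ) (C : Matrix (Fin k) (Fin k) ℝ) :
    Matrix (Fin (k + 1)) (Fin (k + 1)) ℝ :=
  Matrix.of (Fin.cons (Fin.cons x b) fun i => Fin.cons (b i) (C i))

section border

variable {k : ℕ} (x : ℝ) (b : Fin k → ℝ) (C : Matrix (Fin k) (Fin k) ℝ)

@[simp] lemma borderMatrix_zero_zero : borderMatrix x b C 0 0 = x := rfl
@[simp] lemma borderMatrix_zero_succ (j : Fin k) : borderMatrix x b C 0 j.succ = b j := rfl
@[simp] lemma borderMatrix_succ_zero (i : Fin k) : borderMatrix x b C i.succ 0 = b i := rfl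
@[simp] lemma borderMatrix_succ_succ (i j : Fin k) :
    borderMatrix x b C i.succ j.succ = C i j := rfl

end border

/-- The index set of the upper triangle split into the first row and the rest. -/
noncomputable def upperIdxSplit (k : ℕ) : Fin (k + 1) ⊕ UpperIdx k ≃ UpperIdx (k + 1) :=
  Equiv.ofBijective
    (Sum.elim (fun j => ⟨(0, j), Fin.zero_le j⟩)
      fun p => ⟨(p.1.1.succ, p.1.2.succ), Fin.succ_le_succ_iff.2 p.2⟩) <| by
    constructor
    · rintro (i | ⟨⟨i, j⟩, h⟩) (i' | ⟨⟨i', j'⟩, h'⟩) hh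
      · simpa using hh
      · simp [Subtype.ext_iff] at hh
        exact absurd hh.1.symm (Fin.succ_ne_zero _)
      · simp [Subtype.ext_iff] at hh
      · simpa using hh
    · rintro ⟨⟨i, j⟩, h⟩
      have h : i ≤ j := h
      induction i using Fin.cases with
      | zero => exact ⟨Sum.inl j, rfl⟩
      | succ i =>
        induction j using Fin.cases with
        | zero => exact absurd h (by simp)
        | succ j => exact ⟨Sum.inr ⟨(i, j), Fin.succ_le_succ_iff.1 h⟩, rfl⟩

/-- Splitting off the first row and column of a symmetric matrix. -/
noncomputable def symSplit (k : ℕ) :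
    (ℝ × (Fin k → ℝ) × (UpperIdx k → ℝ)) ≃ᵐ (UpperIdx (k + 1) → ℝ) :=
  MeasurableEquiv.prodAssoc.symm.trans <|
    ((MeasurableEquiv.piFinSuccAbove (fun _ => ℝ) 0).symm.prodCongr (MeasurableEquiv.refl _)).trans <|
      (MeasurableEquiv.sumPiEquivProdPi fun _ : Fin (k + 1) ⊕ UpperIdx k => ℝ).symm.trans <|
        MeasurableEquiv.piCongrLeft (fun _ => ℝ) (upperIdxSplit k)

lemma measurePreserving_symSplit (k : ℕ) : MeasurePreserving (symSplit k) := by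
  refine MeasurePreserving.trans (volume_preserving_prodAssoc.symm _) ?_
  refine MeasurePreserving.trans
    ((((volume_preserving_piFinSuccAbove (fun _ : Fin (k + 1) => ℝ) 0).symm _)).prod
      (MeasurePreserving.id _)) ?_
  exact MeasurePreserving.trans
    (volume_measurePreserving_sumPiEquivProdPi_symm fun _ : Fin (k + 1) ⊕ UpperIdx k => ℝ)
    (volume_measurePreserving_piCongrLeft (fun _ => ℝ) (upperIdxSplit k))

lemma symSplit_inl (k : ℕ) (x : ℝ) (b : Fin k → ℝ) (c : UpperIdx k → ℝ) (j : Fin (k + 1)) :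
    symSplit k (x, b, c) (upperIdxSplit k (Sum.inl j)) = Fin.cons (α := fun _ => ℝ) x b j := by
  have := Equiv.piCongrLeft_apply_apply (fun _ => ℝ) (upperIdxSplit k)
    ((MeasurableEquiv.sumPiEquivProdPi fun _ : Fin (k + 1) ⊕ UpperIdx k => ℝ).symm
      ((MeasurableEquiv.piFinSuccAbove (fun _ => ℝ) 0).symm (x, b), c)) (Sum.inl j)
  refine this.trans ?_
  change (MeasurableEquiv.piFinSuccAbove (fun _ => ℝ) 0).symm (x, b) j = _
  simp [MeasurableEquiv.piFinSuccAbove]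

lemma symSplit_inr (k : ℕ) (x : ℝ) (b : Fin k → ℝ) (c : UpperIdx k → ℝ) (p : UpperIdx k) :
    symSplit k (x, b, c) (upperIdxSplit k (Sum.inr p)) = c p :=
  Equiv.piCongrLeft_apply_apply (fun _ => ℝ) (upperIdxSplit k)
    ((MeasurableEquiv.sumPiEquivProdPi fun _ : Fin (k + 1) ⊕ UpperIdx k => ℝ).symm
      ((MeasurableEquiv.piFinSuccAbove (fun _ => ℝ) 0).symm (x, b), c)) (Sum.inr p)

lemma symMatrix_symSplit (k : ℕ) (x : ℝ) (b : Fin k → ℝ) (c : UpperIdx k → ℝ) :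
    symMatrix (k + 1) (symSplit k (x, b, c)) = borderMatrix x b (symMatrix k c) := by
  have h0 : ∀ j, symMatrix (k + 1) (symSplit k (x, b, c)) 0 j =
      Fin.cons (α := fun _ => ℝ) x b j := fun j => by
    rw [← symSplit_inl k x b c j]
    exact symMatrix_apply_of_le _ (upperIdxSplit k (Sum.inl j))
  ext i j
  induction i using Fin.cases with
  | zero =>
    rw [h0]; rfl
  | succ i =>
    induction j using Fin.cases with
    | zero =>
      rw [(isSymm_symMatrix _).apply, h0]; rfl
    | succ j =>
      have h1 : ∀ i j : Fin k, i ≤ j → symMatrix (k + 1) (symSplit k (x, b, c)) i.succ j.succ =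
          symMatrix k c i j := fun i j h => by
        have e := symSplit_inr k x b c ⟨(i, j), h⟩
        rw [symMatrix_apply_of_le c ⟨(i, j), h⟩, ← e]
        exact symMatrix_apply_of_le _ (upperIdxSplit k (Sum.inr ⟨(i, j), h⟩))
      rw [borderMatrix_succ_succ]
      rcases le_total i j with h | h
      · exact h1 i j h
      · rw [(isSymm_symMatrix _).apply, h1 j i h, (isSymm_symMatrix _).apply]

/-! ### Polynomial growth and Gaussian integrability. -/

/-- Continuous functions of the free entries with at most polynomial growth. -/
structure PolyGrowth {n : ℕ} (G : (UpperIdx n → ℝ) → ℝ) : Prop where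
  continuous : Continuous G
  bound : ∃ C : ℝ, ∃ d : ℕ, 0 ≤ C ∧ ∀ a, |G a| ≤ C * (1 + ‖a‖) ^ d

namespace PolyGrowth

variable {n : ℕ} {G H : (UpperIdx n → ℝ) → ℝ}

lemma mul (hG : PolyGrowth G) (hH : PolyGrowth H) : PolyGrowth fun a => G a * H a := by
  refine ⟨hG.continuous.mul hH.continuous, ?_⟩
  obtain ⟨C, d, hC, h⟩ := hG.bound
  obtain ⟨C', d', hC', h'⟩ := hH.bound
  refine ⟨C * C', d + d', mul_nonneg hC hC', fun a => ?_⟩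
  rw [abs_mul, pow_add, mul_mul_mul_comm]
  exact mul_le_mul (h a) (h' a) (abs_nonneg _) (by positivity)

lemma add (hG : PolyGrowth G) (hH : PolyGrowth H) : PolyGrowth fun a => G a + H a := by
  refine ⟨hG.continuous.add hH.continuous, ?_⟩
  obtain ⟨C, d, hC, h⟩ := hG.bound
  obtain ⟨C', d', hC', h'⟩ := hH.bound
  refine ⟨C + C', d + d', add_nonneg hC hC', fun a => ?_⟩
  have h1 : (1 : ℝ) ≤ 1 + ‖a‖ := by simp
  calc |G a + H a| ≤ |G a| + |H a| := abs_add_le _ _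
    _ ≤ C * (1 + ‖a‖) ^ d + C' * (1 + ‖a‖) ^ d' := add_le_add (h a) (h' a)
    _ ≤ C * (1 + ‖a‖) ^ (d + d') + C' * (1 + ‖a‖) ^ (d + d') := by
        gcongr <;> first | exact h1 | omega
    _ = _ := by ring

lemma const (c : ℝ) : PolyGrowth fun _ : UpperIdx n → ℝ => c :=
  ⟨continuous_const, |c|, 0, abs_nonneg c, fun a => by simp⟩

lemma pow (hG : PolyGrowth G) (j : ℕ) : PolyGrowth fun a => G a ^ j := by
  induction j with
  | zero => simpa using const (n := n) 1
  | succ j ih => simpa only [pow_succ] using ih.mul hG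

lemma entry (i j : Fin n) : PolyGrowth fun a => symMatrix n a i j := by
  refine ⟨(continuous_symMatrix n).matrix_elem i j, 1, 1, zero_le_one, fun a => ?_⟩
  have := norm_le_pi_norm a ⟨(min i j, max i j), min_le_max⟩
  rw [Real.norm_eq_abs] at this
  rw [symMatrix_apply]; linarith

lemma sum {ι : Type*} (s : Finset ι) {f : ι → (UpperIdx n → ℝ) → ℝ}
    (h : ∀ i ∈ s, PolyGrowth (f i)) : PolyGrowth fun a => ∑ i ∈ s, f i a := by
  classical
  induction s using Finset.induction_on with
  | empty => simpa using const (n := n) 0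
  | insert i s hi ih =>
    simp only [Finset.sum_insert hi]
    exact (h i (Finset.mem_insert_self i s)).add
      (ih fun j hj => h j (Finset.mem_insert_of_mem hj))

lemma trace : PolyGrowth fun a => (symMatrix n a).trace := sum _ fun i _ => entry i i

end PolyGrowth

lemma trace_mul_self_symMatrix {n : ℕ} (a : UpperIdx n → ℝ) :
    (symMatrix n a * symMatrix n a).trace = ∑ i, ∑ j, symMatrix n a i j ^ 2 := by
  simp only [Matrix.trace, Matrix.diag, Matrix.mul_apply]
  refine Finset.sum_congr rfl fun i _ => Finset.sum_congr rfl fun j _ => ?_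
  rw [(isSymm_symMatrix a).apply i j]; ring

lemma sum_sq_le_trace_mul_self {n : ℕ} (a : UpperIdx n → ℝ) :
    ∑ p, a p ^ 2 ≤ (symMatrix n a * symMatrix n a).trace := by
  rw [trace_mul_self_symMatrix, ← Finset.sum_product', Finset.univ_product_univ]
  calc ∑ p, a p ^ 2 = ∑ p : UpperIdx n, symMatrix n a p.1.1 p.1.2 ^ 2 := by
        simp only [symMatrix_apply_of_le]
    _ = ∑ p : Fin n × Fin n with p.1 ≤ p.2, symMatrix n a p.1 p.2 ^ 2 :=
        (Finset.sum_subtype (p := fun p : Fin n × Fin n => p.1 ≤ p.2)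
          (Finset.univ.filter fun p : Fin n × Fin n => p.1 ≤ p.2) (by simp)
          (fun p => symMatrix n a p.1 p.2 ^ 2)).symm
    _ ≤ _ := Finset.sum_le_sum_of_subset_of_nonneg (Finset.filter_subset _ _)
        fun _ _ _ => sq_nonneg _

/-- The unnormalized Gaussian weight `exp (-c Tr A² - v Tr A)`. -/
noncomputable def gaussWeight (n : ℕ) (c v : ℝ) (a : UpperIdx n → ℝ) : ℝ :=
  exp (-(c * (symMatrix n a * symMatrix n a).trace) - v * (symMatrix n a).trace)

lemma continuous_gaussWeight (n : ℕ) (c v : ℝ) : Continuous (gaussWeight n c v) := by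
  have h := continuous_symMatrix n
  unfold gaussWeight
  exact ((((h.matrix_mul h).matrix_trace.const_mul c).neg).sub
    (h.matrix_trace.const_mul v)).rexp

lemma gaussWeight_pos (n : ℕ) (c v : ℝ) (a : UpperIdx n → ℝ) : 0 < gaussWeight n c v a :=
  exp_pos _

/-- `Tr A²` dominates the sum of the squared free entries. Half of this Gaussian decay absorbs the
polynomial and the linear trace term, the other half is a product of one-dimensional Gaussians. -/
lemma PolyGrowth.integrable {n : ℕ} {G : (UpperIdx n → ℝ) → ℝ} (hG : PolyGrowth G) {c : ℝ}
    (hc : 0 < c) (v : ℝ) : Integrable fun a => G a * gaussWeight n c v a := by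
  obtain ⟨C, d, hC, hb⟩ := hG.bound
  obtain ⟨C', hC', hb'⟩ : ∃ C' : ℝ, 0 ≤ C' ∧
      ∀ a : UpperIdx n → ℝ, |(symMatrix n a).trace| ≤ C' * ‖a‖ := by
    refine ⟨n, by positivity, fun a => ?_⟩
    refine (Finset.abs_sum_le_sum_abs _ _).trans ?_
    calc ∑ i, |(symMatrix n a).diag i| ≤ ∑ _i : Fin n, ‖a‖ := by
          refine Finset.sum_le_sum fun i _ => ?_
          have := norm_le_pi_norm a ⟨(min i i, max i i), min_le_max⟩
          rwa [Real.norm_eq_abs] at this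
      _ = n * ‖a‖ := by simp
  have hint : Integrable fun a : UpperIdx n → ℝ => ∏ p, exp (-(c / 2) * a p ^ 2) :=
    Integrable.fintype_prod (f := fun (_ : UpperIdx n) (x : ℝ) => exp (-(c / 2) * x ^ 2))
      fun _ => integrable_exp_neg_mul_sq (by positivity)
  -- The `1` comes from bounding the polynomial by `exp (1 + t)`, the rest from the trace;
  -- completing the square in `m * t` against `c / 2 * t ^ 2` produces `K`.
  set m := 1 + |v| * C'
  set K := C * (d.factorial * exp (1 + m ^ 2 / (2 * c)))
  refine (hint.const_mul K).mono' (hG.continuous.mul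
    (continuous_gaussWeight n c v)).aestronglyMeasurable (Filter.Eventually.of_forall fun a => ?_)
  rw [Real.norm_eq_abs, abs_mul, abs_of_pos (gaussWeight_pos n c v a), ← exp_sum,
    ← Finset.mul_sum]
  set t := ‖a‖
  have ht : 0 ≤ t := norm_nonneg a
  have h1 : (1 + t) ^ d ≤ d.factorial * exp (1 + t) := by
    have := pow_div_factorial_le_exp (1 + t) (by positivity) d
    rw [div_le_iff₀ (by positivity)] at this
    linarith
  have h2 : t ^ 2 ≤ ∑ p, a p ^ 2 := by
    have hS : 0 ≤ ∑ p, a p ^ 2 := Finset.sum_nonneg fun _ _ => sq_nonneg _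
    have h : t ≤ √(∑ p, a p ^ 2) := (pi_norm_le_iff_of_nonneg (sqrt_nonneg _)).2 fun p =>
      abs_le_sqrt (Finset.single_le_sum (f := fun p => a p ^ 2) (fun _ _ => sq_nonneg _)
        (Finset.mem_univ p))
    calc t ^ 2 ≤ √(∑ p, a p ^ 2) ^ 2 := by gcongr
      _ = _ := sq_sqrt hS
  have h3 := sum_sq_le_trace_mul_self a
  have h4 : -(v * (symMatrix n a).trace) ≤ |v| * C' * t := by
    refine (neg_le_abs _).trans ?_
    rw [abs_mul, mul_assoc]
    exact mul_le_mul_of_nonneg_left (hb' a) (abs_nonneg v)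
  have h5 : m * t ≤ c / 2 * t ^ 2 + m ^ 2 / (2 * c) := by
    have : 0 ≤ (c * t - m) ^ 2 / (2 * c) := by positivity
    have e : (c * t - m) ^ 2 / (2 * c) = c / 2 * t ^ 2 + m ^ 2 / (2 * c) - m * t := by
      field_simp; ring
    linarith
  have h6 : gaussWeight n c v a ≤ exp (-(c * ∑ p, a p ^ 2) + |v| * C' * t) := by
    refine exp_le_exp.2 ?_
    have := mul_le_mul_of_nonneg_left h3 hc.le
    linarith
  calc |G a| * gaussWeight n c v a
      ≤ (C * (d.factorial * exp (1 + t))) * exp (-(c * ∑ p, a p ^ 2) + |v| * C' * t) := by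
        refine mul_le_mul ((hb a).trans ?_) h6 (gaussWeight_pos _ _ _ _).le (by positivity)
        exact mul_le_mul_of_nonneg_left h1 hC
    _ = C * d.factorial * exp (1 + t + (-(c * ∑ p, a p ^ 2) + |v| * C' * t)) := by
        rw [exp_add (1 + t)]; ring
    _ ≤ C * d.factorial * exp (1 + m ^ 2 / (2 * c) + -(c / 2) * ∑ p, a p ^ 2) := by
        refine mul_le_mul_of_nonneg_left (exp_le_exp.2 ?_) (by positivity)
        have e : m * t = t + |v| * C' * t := by simp only [m]; ring
        have := mul_le_mul_of_nonneg_left h2 (show 0 ≤ c / 2 by positivity)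
        linarith
    _ = _ := by rw [exp_add]; simp only [K]; ring

open ProbabilityTheory in
/-- Differentiation of exponential families on symmetric matrices under the integral sign. -/
lemma hasDerivAt_integral_exp {n : ℕ} {G X : (UpperIdx n → ℝ) → ℝ} (hG : Continuous G)
    (hG0 : ∀ a, 0 ≤ G a) {t : ℝ}
    (hint : ∀ᶠ s in nhds t, Integrable fun a => G a * exp (s * X a)) (j : ℕ) :
    HasDerivAt (fun s => ∫ a, G a * (X a ^ j * exp (s * X a)))
      (∫ a, G a * (X a ^ (j + 1) * exp (t * X a))) t := by
  -- With `G` as density the integrals are exponential moments of `X` under `μ`, which are smooth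
  -- inside the set of integrable exponents.
  set μ : Measure (UpperIdx n → ℝ) := volume.withDensity fun a => ENNReal.ofReal (G a)
  have hμ : ∀ g : (UpperIdx n → ℝ) → ℝ, ∫ a, g a ∂μ = ∫ a, G a * g a := fun g => by
    rw [integral_withDensity_eq_integral_toReal_smul hG.measurable.ennreal_ofReal
      (Filter.Eventually.of_forall fun _ => ENNReal.ofReal_lt_top)]
    simp [ENNReal.toReal_ofReal (hG0 _)]
  have hmem : t ∈ interior (integrableExpSet X μ) := by
    rw [mem_interior_iff_mem_nhds]
    filter_upwards [hint] with s hs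
    rw [integrableExpSet, Set.mem_ofPred_eq,
      integrable_withDensity_iff_integrable_smul' hG.measurable.ennreal_ofReal
        (Filter.Eventually.of_forall fun _ => ENNReal.ofReal_lt_top)]
    simpa [ENNReal.toReal_ofReal (hG0 _)] using hs
  have h := hasDerivAt_integral_pow_mul_exp_real hmem j
  simpa only [hμ] using h

/-- Obtained by comparing exponents of `2` in `prod_upperIdx` for the constant family `2`. -/
lemma card_upperIdx (n : ℕ) : 2 * Fintype.card (UpperIdx n) = n * (n + 1) := by
  have h := prod_upperIdx (n := n) fun _ => (2 : ℝ)
  simp only [Finset.prod_const, Finset.card_univ, Fintype.card_fin] at h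
  rw [abs_of_pos (by positivity), abs_of_pos (by positivity), ← pow_mul,
    show (2 : ℝ) * 2 = 2 ^ 2 by norm_num, ← pow_mul] at h
  exact Nat.pow_right_injective le_rfl (by exact_mod_cast h)

/-! ### Invariant homogeneous functionals and their trace moments. -/

/-- Nonnegative continuous functions of a matrix that are homogeneous of degree `d` and invariant
under orthogonal conjugation. -/
structure IsInvariantOfDegree {n : ℕ} (F : Matrix (Fin n) (Fin n) ℝ → ℝ) (d : ℕ) : Prop where
  continuous : Continuous F
  nonneg : ∀ A, 0 ≤ F A
  homogeneous : ∀ (t : ℝ) (A), 0 < t → F (t • A) = t ^ d * F A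
  invariant : ∀ O A : Matrix (Fin n) (Fin n) ℝ, O * Oᵀ = 1 → F (O * A * Oᵀ) = F A

lemma IsInvariantOfDegree.polyGrowth {n d : ℕ} {F : Matrix (Fin n) (Fin n) ℝ → ℝ}
    (hF : IsInvariantOfDegree F d) : PolyGrowth fun a => F (symMatrix n a) := by
  have hc : Continuous fun a => F (symMatrix n a) := hF.continuous.comp (continuous_symMatrix n)
  refine ⟨hc, ?_⟩
  obtain ⟨C, hC⟩ := (isCompact_closedBall (0 : UpperIdx n → ℝ) 1).exists_bound_of_continuousOn
    hc.continuousOn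
  have hC0 : 0 ≤ C := (norm_nonneg _).trans (hC 0 (by simp))
  refine ⟨C, d, hC0, fun a => ?_⟩
  rcases le_or_gt ‖a‖ 1 with h | h
  · refine (hC a (by simpa using h)).trans ?_
    exact le_mul_of_one_le_right hC0 (one_le_pow₀ (by simp))
  · have h0 : 0 < ‖a‖ := one_pos.trans h
    have e : F (symMatrix n a) = ‖a‖ ^ d * F (symMatrix n (‖a‖⁻¹ • a)) := by
      rw [← hF.homogeneous _ _ h0, symMatrix_smul, smul_smul, mul_inv_cancel₀ h0.ne', one_smul]
    have hb := hC (‖a‖⁻¹ • a) (by simp [norm_smul, h0.ne'])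
    rw [Real.norm_eq_abs] at hb
    rw [e, abs_mul, abs_pow, abs_norm, mul_comm]
    refine mul_le_mul hb (by gcongr; simp) (by positivity) hC0

/-- The moments `∫ F(A) (Tr A)^j exp (-Tr A² / 2 - v Tr A) dA`. -/
noncomputable def traceMoment {n : ℕ} (F : Matrix (Fin n) (Fin n) ℝ → ℝ) (j : ℕ) (v : ℝ) : ℝ :=
  ∫ a, F (symMatrix n a) * (symMatrix n a).trace ^ j * gaussWeight n (1 / 2) v a

section

variable {n d : ℕ} {F : Matrix (Fin n) (Fin n) ℝ → ℝ}

lemma hasDerivAt_traceMoment (hF : IsInvariantOfDegree F d) (j : ℕ) (v : ℝ) :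
    HasDerivAt (traceMoment F j) (-traceMoment F (j + 1) v) v := by
  have hsgn : (-1 : ℝ) ^ j * (-1) ^ j = 1 := by rw [← mul_pow]; simp
  have hc : Continuous fun a => F (symMatrix n a) * gaussWeight n (1 / 2) 0 a :=
    hF.polyGrowth.continuous.mul (continuous_gaussWeight n _ _)
  have hw : ∀ s a, gaussWeight n (1 / 2) s a =
      gaussWeight n (1 / 2) 0 a * exp (s * -(symMatrix n a).trace) := fun s a => by
    rw [gaussWeight, gaussWeight, ← exp_add]; congr 1; ring
  have h := hasDerivAt_integral_exp (X := fun a => -(symMatrix n a).trace) (t := v) hc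
    (fun a => mul_nonneg (hF.nonneg _) (gaussWeight_pos _ _ _ _).le)
    (Filter.Eventually.of_forall fun s => by
      refine (hF.polyGrowth.integrable (c := 1 / 2) (by norm_num) s).congr
        (Filter.Eventually.of_forall fun a => ?_)
      simp only [hw s]; ring) j
  have hfun : traceMoment F j = fun s => (-1) ^ j * ∫ a, F (symMatrix n a) *
      gaussWeight n (1 / 2) 0 a * ((-(symMatrix n a).trace) ^ j *
        exp (s * -(symMatrix n a).trace)) := by
    ext s
    rw [traceMoment, ← integral_const_mul]
    refine integral_congr_ae (Filter.Eventually.of_forall fun a => ?_)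
    simp only [hw s, neg_pow (symMatrix n a).trace]
    linear_combination (-F (symMatrix n a) * (symMatrix n a).trace ^ j *
      gaussWeight n (1 / 2) 0 a * exp (s * -(symMatrix n a).trace)) * hsgn
  rw [hfun]
  refine (h.const_mul _).congr_deriv ?_
  rw [traceMoment, ← integral_const_mul, ← integral_neg]
  refine integral_congr_ae (Filter.Eventually.of_forall fun a => ?_)
  simp only [hw v, neg_pow (symMatrix n a).trace (j + 1)]
  linear_combination (-F (symMatrix n a) * (symMatrix n a).trace ^ (j + 1) *
      gaussWeight n (1 / 2) 0 a * exp (v * -(symMatrix n a).trace)) * hsgn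

/-- Euler's identity for homogeneous functions, in integrated form. -/
lemma integral_trace_mul_self (hF : IsInvariantOfDegree F d) (v : ℝ) :
    ∫ a, F (symMatrix n a) * (symMatrix n a * symMatrix n a).trace * gaussWeight n (1 / 2) v a =
      (d + Fintype.card (UpperIdx n)) * traceMoment F 0 v - v * traceMoment F 1 v := by
  set N := Fintype.card (UpperIdx n)
  set X : (UpperIdx n → ℝ) → ℝ := fun a => -(symMatrix n a * symMatrix n a).trace / 2
  set G : (UpperIdx n → ℝ) → ℝ := fun a => F (symMatrix n a) * exp (-(v * (symMatrix n a).trace))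
  have hs := continuous_symMatrix n
  have hG : Continuous G :=
    hF.polyGrowth.continuous.mul ((hs.matrix_trace.const_mul v).neg.rexp)
  have hw : ∀ s a, gaussWeight n (s / 2) v a =
      exp (-(v * (symMatrix n a).trace)) * exp (s * X a) := fun s a => by
    rw [gaussWeight, ← exp_add]; congr 1; simp only [X]; ring
  have h := hasDerivAt_integral_exp (G := G) (X := X) (t := 1) hG
    (fun a => mul_nonneg (hF.nonneg _) (exp_pos _).le)
    (by
      filter_upwards [lt_mem_nhds (show (0 : ℝ) < 1 by norm_num)] with s hs
      refine (hF.polyGrowth.integrable (c := s / 2) (by positivity) v).congr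
        (Filter.Eventually.of_forall fun a => ?_)
      simp only [hw s, G]; ring) 0
  have hE : ∀ s : ℝ, (∫ a, G a * (X a ^ 0 * exp (s * X a))) =
      ∫ a, F (symMatrix n a) * gaussWeight n (s / 2) v a := fun s => by
    refine integral_congr_ae (Filter.Eventually.of_forall fun a => ?_)
    simp only [hw s, G]; ring
  simp only [hE] at h
  -- Rescaling `a` by `τ` evaluates the integral with weight `τ ^ 2 / 2`. Its derivative at `τ = 1`
  -- is then compared with the one obtained under the integral sign.
  have hsc : ∀ τ : ℝ, 0 < τ → ∫ a, F (symMatrix n a) * gaussWeight n (τ ^ 2 / 2) v a =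
      (τ ^ (d + N))⁻¹ * traceMoment F 0 (v / τ) := fun τ hτ => by
    have h1 := Measure.integral_comp_smul (volume : Measure (UpperIdx n → ℝ))
      (fun a => F (symMatrix n a) * gaussWeight n (1 / 2) (v / τ) a) τ
    have h2 : ∀ a, F (symMatrix n (τ • a)) * gaussWeight n (1 / 2) (v / τ) (τ • a) =
        τ ^ d * (F (symMatrix n a) * gaussWeight n (τ ^ 2 / 2) v a) := fun a => by
      rw [symMatrix_smul, hF.homogeneous _ _ hτ, mul_assoc]
      congr 2
      rw [gaussWeight, gaussWeight, symMatrix_smul, Matrix.smul_mul, Matrix.mul_smul]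
      simp only [Matrix.trace_smul, smul_eq_mul]
      congr 1; field_simp
    simp only [h2, integral_const_mul, Module.finrank_fintype_fun_eq_card, smul_eq_mul] at h1
    rw [abs_of_pos (by positivity)] at h1
    have h3 : τ ^ d ≠ 0 := by positivity
    have h4 : τ ^ N ≠ 0 := by positivity
    simp only [traceMoment, pow_zero, mul_one]
    rw [pow_add]
    field_simp at h1 ⊢
    linear_combination h1
  have hL : HasDerivAt (fun τ : ℝ => ∫ a, F (symMatrix n a) * gaussWeight n (τ ^ 2 / 2) v a)
      ((∫ a, G a * (X a ^ (0 + 1) * exp (1 * X a))) * 2) 1 := by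
    have hsq : HasDerivAt (fun τ : ℝ => τ ^ 2) 2 1 := by simpa using hasDerivAt_pow 2 (1 : ℝ)
    have h' : HasDerivAt (fun s => ∫ a, F (symMatrix n a) * gaussWeight n (s / 2) v a)
      (∫ a, G a * (X a ^ (0 + 1) * exp (1 * X a))) ((fun τ : ℝ => τ ^ 2) 1) := by simpa using h
    exact HasDerivAt.comp (h := fun τ : ℝ => τ ^ 2) 1 h' hsq
  have hR : HasDerivAt (fun τ : ℝ => (τ ^ (d + N))⁻¹ * traceMoment F 0 (v / τ))
      (-((d + N : ℕ) : ℝ) * traceMoment F 0 v + v * traceMoment F 1 v) 1 := by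
    have hp : HasDerivAt (fun τ : ℝ => (τ ^ (d + N))⁻¹) (-((d + N : ℕ) : ℝ)) 1 := by
      exact ((hasDerivAt_pow (d + N) (1 : ℝ)).inv (by simp)).congr_deriv (by simp)
    have hv : HasDerivAt (fun τ : ℝ => v / τ) (-v) 1 := by
      have := (hasDerivAt_inv (one_ne_zero (α := ℝ))).const_mul v
      simpa [div_eq_mul_inv] using this
    have ht : HasDerivAt (traceMoment F 0) (-traceMoment F (0 + 1) v) ((fun τ : ℝ => v / τ) 1) := by
      simpa using hasDerivAt_traceMoment hF 0 v
    refine (hp.mul (ht.comp 1 hv)).congr_deriv ?_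
    simp
    ring
  have hev : (fun τ : ℝ => ∫ a, F (symMatrix n a) * gaussWeight n (τ ^ 2 / 2) v a) =ᶠ[nhds 1]
      fun τ => (τ ^ (d + N))⁻¹ * traceMoment F 0 (v / τ) := by
    filter_upwards [lt_mem_nhds (show (0 : ℝ) < 1 by norm_num)] with τ hτ using hsc τ hτ
  have key := (hL.congr_of_eventuallyEq hev.symm).unique hR
  have hfin : (∫ a, G a * (X a ^ (0 + 1) * exp (1 * X a))) * 2 = -∫ a, F (symMatrix n a) *
      (symMatrix n a * symMatrix n a).trace * gaussWeight n (1 / 2) v a := by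
    rw [← integral_mul_const, ← integral_neg]
    refine integral_congr_ae (Filter.Eventually.of_forall fun a => ?_)
    simp only [hw 1, G, X]; ring
  rw [hfin] at key
  push_cast at key
  linarith

end

/-! ### Moments of entries under orthogonal invariance. -/

/-- Householder reflections act transitively on spheres. -/
lemma exists_orthogonal_mulVec_eq {n : ℕ} {x y : Fin n → ℝ} (h : x ⬝ᵥ x = y ⬝ᵥ y) :
    ∃ O : Matrix (Fin n) (Fin n) ℝ, O * Oᵀ = 1 ∧ Oᵀ * O = 1 ∧ O *ᵥ x = y := by
  by_cases hw : x - y = 0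
  · exact ⟨1, by simp, by simp, by simpa using sub_eq_zero.1 hw⟩
  set w := x - y
  have hww : w ⬝ᵥ w ≠ 0 := fun h0 => hw (dotProduct_self_eq_zero.1 h0)
  set O : Matrix (Fin n) (Fin n) ℝ := 1 - (2 / (w ⬝ᵥ w)) • Matrix.vecMulVec w w
  have hT : Oᵀ = O := by
    simp [O, Matrix.transpose_sub, Matrix.transpose_smul, Matrix.transpose_vecMulVec]
  have hO : O * O = 1 := by
    have hV : Matrix.vecMulVec w w * Matrix.vecMulVec w w = (w ⬝ᵥ w) • Matrix.vecMulVec w w := by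
      rw [Matrix.vecMulVec_mul_vecMulVec]
      ext i j
      simp only [Matrix.vecMulVec_apply, Matrix.smul_apply, Pi.smul_apply, smul_eq_mul]
      ring
    simp only [O, Matrix.sub_mul, Matrix.mul_sub, Matrix.one_mul, Matrix.mul_one, Matrix.smul_mul,
      Matrix.mul_smul, hV]
    ext i j
    simp only [Matrix.sub_apply, Matrix.smul_apply, smul_eq_mul]
    field_simp
    ring
  refine ⟨O, by rw [hT, hO], by rw [hT, hO], ?_⟩
  have hwx : 2 * (w ⬝ᵥ x) = w ⬝ᵥ w := by
    simp only [w, sub_dotProduct, dotProduct_sub]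
    rw [dotProduct_comm y x]
    linarith
  simp only [O, Matrix.sub_mulVec, Matrix.one_mulVec, Matrix.smul_mulVec, Matrix.vecMulVec_mulVec]
  rw [op_smul_eq_smul, smul_smul, show 2 / (w ⬝ᵥ w) * (w ⬝ᵥ x) = 1 by
    rw [div_mul_eq_mul_div, hwx, div_self hww], one_smul]
  simp [w]

section

variable {k d : ℕ} {F : Matrix (Fin (k + 1)) (Fin (k + 1)) ℝ → ℝ}

lemma gaussWeight_congruence {n : ℕ} {O : Matrix (Fin n) (Fin n) ℝ} (hO : Oᵀ * O = 1)
    (c v : ℝ) (a : UpperIdx n → ℝ) : gaussWeight n c v (congruence O a) = gaussWeight n c v a := by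
  have h1 : ∀ M : Matrix (Fin n) (Fin n) ℝ, (O * M * Oᵀ).trace = M.trace := fun M => by
    rw [Matrix.trace_mul_comm, ← Matrix.mul_assoc, hO, Matrix.one_mul]
  have h2 : O * symMatrix n a * Oᵀ * (O * symMatrix n a * Oᵀ) =
      O * (symMatrix n a * symMatrix n a) * Oᵀ := by
    calc _ = O * symMatrix n a * (Oᵀ * O) * symMatrix n a * Oᵀ := by
          simp only [Matrix.mul_assoc]
      _ = _ := by rw [hO, Matrix.mul_one]; simp only [Matrix.mul_assoc]
  rw [gaussWeight, gaussWeight, symMatrix_congruence, h2, h1, h1]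

/-- Under an orthogonally invariant weight the law of `vᵀ A v` depends on the length of `v` only. -/
lemma integral_quadForm (hF : IsInvariantOfDegree F d) (φ : ℝ → ℝ) (hφ : Measurable φ) (s : ℝ)
    (v : Fin (k + 1) → ℝ) :
    ∫ a, F (symMatrix _ a) * φ (v ⬝ᵥ symMatrix _ a *ᵥ v) * gaussWeight (k + 1) (1 / 2) s a =
      ∫ a, F (symMatrix _ a) * φ ((v ⬝ᵥ v) * symMatrix _ a 0 0) *
        gaussWeight (k + 1) (1 / 2) s a := by
  set e : Fin (k + 1) → ℝ := Pi.single 0 (√(v ⬝ᵥ v))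
  have hv : 0 ≤ v ⬝ᵥ v := Finset.sum_nonneg fun i _ => mul_self_nonneg (v i)
  have he : e ⬝ᵥ e = v ⬝ᵥ v := by simp [e, mul_self_sqrt hv]
  obtain ⟨O, h1, h2, h3⟩ := exists_orthogonal_mulVec_eq he.symm
  have hdet : |O.det| = 1 := by
    have := congrArg Matrix.det h1
    rw [Matrix.det_mul, Matrix.det_transpose, Matrix.det_one] at this
    exact abs_eq_abs.2 (by simpa using mul_self_eq_one_iff.1 this) |>.trans abs_one
  have hm : Measurable fun a => F (symMatrix (k + 1) a) *
      φ (e ⬝ᵥ symMatrix (k + 1) a *ᵥ e) * gaussWeight (k + 1) (1 / 2) s a := by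
    refine (hF.polyGrowth.continuous.measurable.mul (hφ.comp ?_)).mul
      (continuous_gaussWeight _ _ _).measurable
    have := continuous_symMatrix (k + 1)
    have : Continuous fun a => e ⬝ᵥ symMatrix (k + 1) a *ᵥ e := by fun_prop
    exact this.measurable
  have hp := measurePreserving_congruence hdet
  have h4 : ∀ a, v ⬝ᵥ symMatrix _ a *ᵥ v = e ⬝ᵥ symMatrix _ (congruence O a) *ᵥ e := fun a => by
    have h5 : Oᵀ *ᵥ e = v := by rw [← h3, Matrix.mulVec_mulVec, h2, Matrix.one_mulVec]
    rw [symMatrix_congruence, ← Matrix.mulVec_mulVec, h5, ← Matrix.mulVec_mulVec,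
      Matrix.dotProduct_mulVec e, ← Matrix.mulVec_transpose, h5]
  have h6 : ∀ a, (v ⬝ᵥ v) * symMatrix (k + 1) a 0 0 = e ⬝ᵥ symMatrix _ a *ᵥ e := fun a => by
    simp only [e, single_dotProduct, Matrix.mulVec_single, op_smul_eq_smul, Pi.smul_apply,
      Matrix.col_apply, smul_eq_mul]
    rw [← mul_assoc, mul_self_sqrt hv]
  simp only [h4, h6]
  conv_rhs => rw [← hp.map_eq, integral_map hp.measurable.aemeasurable hm.aestronglyMeasurable]
  simp only [gaussWeight_congruence h2, symMatrix_congruence, hF.invariant _ _ h1]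

lemma integral_diag (hF : IsInvariantOfDegree F d) (s : ℝ) (i : Fin (k + 1)) :
    ∫ a, F (symMatrix _ a) * symMatrix _ a i i * gaussWeight (k + 1) (1 / 2) s a =
      ∫ a, F (symMatrix _ a) * symMatrix _ a 0 0 * gaussWeight (k + 1) (1 / 2) s a := by
  simpa using integral_quadForm hF id measurable_id s (Pi.single i 1)

lemma traceMoment_one (hF : IsInvariantOfDegree F d) (s : ℝ) :
    traceMoment F 1 s = (k + 1) *
      ∫ a, F (symMatrix _ a) * symMatrix _ a 0 0 * gaussWeight (k + 1) (1 / 2) s a := by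
  have hi : ∀ i : Fin (k + 1), Integrable fun a =>
      F (symMatrix _ a) * symMatrix _ a i i * gaussWeight (k + 1) (1 / 2) s a := fun i =>
    (hF.polyGrowth.mul (PolyGrowth.entry i i)).integrable (by norm_num) s
  calc traceMoment F 1 s = ∫ a, ∑ i, F (symMatrix _ a) * symMatrix _ a i i *
        gaussWeight (k + 1) (1 / 2) s a := by
        refine integral_congr_ae (Filter.Eventually.of_forall fun a => ?_)
        simp only [pow_one, Matrix.trace, Matrix.diag, Finset.mul_sum, Finset.sum_mul]
    _ = _ := by
        rw [integral_finsetSum _ fun i _ => hi i]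
        simp only [integral_diag hF]
        simp

/-- Polarization: by invariance `∫ F (vᵀ A v)²` is `|v|⁴` times the value for the first basis
vector, and adding the cases `v = e_i ± e_j` isolates the mixed terms. For `i = j` these vectors are
`2 e_i` and `0`, whence the factor `3`. -/
lemma integral_entry_pair (hF : IsInvariantOfDegree F d) (s : ℝ) (i j : Fin (k + 1)) :
    ∫ a, F (symMatrix _ a) * (symMatrix _ a i i * symMatrix _ a j j + 2 * symMatrix _ a i j ^ 2) *
        gaussWeight (k + 1) (1 / 2) s a =
      (if i = j then 3 else 1) *
        ∫ a, F (symMatrix _ a) * symMatrix _ a 0 0 ^ 2 * gaussWeight (k + 1) (1 / 2) s a := by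
  set w := gaussWeight (k + 1) (1 / 2) s
  set Q := ∫ a, F (symMatrix _ a) * symMatrix _ a 0 0 ^ 2 * w a
  have hint : ∀ G : (UpperIdx (k + 1) → ℝ) → ℝ, PolyGrowth G → Integrable fun a =>
      F (symMatrix _ a) * G a * w a := fun G hG =>
    (hF.polyGrowth.mul hG).integrable (by norm_num) s
  have hq : ∀ v : Fin (k + 1) → ℝ, ∫ a, F (symMatrix _ a) * (v ⬝ᵥ symMatrix _ a *ᵥ v) ^ 2 * w a =
      (v ⬝ᵥ v) ^ 2 * Q := fun v => by
    have := integral_quadForm hF (fun x => x ^ 2) (by fun_prop) s v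
    rw [this, ← integral_const_mul]
    refine integral_congr_ae (Filter.Eventually.of_forall fun a => ?_)
    simp only; ring
  have hpoly : ∀ v : Fin (k + 1) → ℝ,
      PolyGrowth fun a => (v ⬝ᵥ symMatrix (k + 1) a *ᵥ v) ^ 2 := fun v => by
    have h : ∀ i, PolyGrowth fun a => (symMatrix (k + 1) a *ᵥ v) i := fun i =>
      PolyGrowth.sum Finset.univ fun j _ => (PolyGrowth.entry i j).mul (PolyGrowth.const (v j))
    exact PolyGrowth.pow (PolyGrowth.sum Finset.univ fun i _ => (PolyGrowth.const (v i)).mul (h i)) 2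
  set e : Fin (k + 1) → Fin (k + 1) → ℝ := fun i => Pi.single i 1
  have hquad : ∀ (c : ℝ) (a), (e i + c • e j) ⬝ᵥ symMatrix (k + 1) a *ᵥ (e i + c • e j) =
      symMatrix _ a i i + c ^ 2 * symMatrix _ a j j + 2 * c * symMatrix _ a i j := fun c a => by
    have hs : symMatrix _ a j i = symMatrix _ a i j := (isSymm_symMatrix a).apply i j
    simp only [e, Matrix.mulVec_add, Matrix.mulVec_smul, add_dotProduct, dotProduct_add,
      smul_dotProduct, dotProduct_smul, single_one_dotProduct, Matrix.mulVec_single_one,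
      Matrix.col_apply, smul_eq_mul, hs]
    ring
  have h1 := hq (e i + (1 : ℝ) • e j)
  have h2 := hq (e i + (-1 : ℝ) • e j)
  have hsum : (∫ a, F (symMatrix _ a) *
        ((e i + (1 : ℝ) • e j) ⬝ᵥ symMatrix (k + 1) a *ᵥ (e i + (1 : ℝ) • e j)) ^ 2 * w a) +
      ∫ a, F (symMatrix _ a) *
        ((e i + (-1 : ℝ) • e j) ⬝ᵥ symMatrix (k + 1) a *ᵥ (e i + (-1 : ℝ) • e j)) ^ 2 * w a =
      2 * (∫ a, F (symMatrix _ a) * symMatrix _ a i i ^ 2 * w a) +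
      2 * (∫ a, F (symMatrix _ a) * symMatrix _ a j j ^ 2 * w a) +
      4 * ∫ a, F (symMatrix _ a) * (symMatrix _ a i i * symMatrix _ a j j +
        2 * symMatrix _ a i j ^ 2) * w a := by
    have i1 := (hint _ ((PolyGrowth.entry i i).pow 2)).const_mul 2
    have i2 := (hint _ ((PolyGrowth.entry j j).pow 2)).const_mul 2
    have i12 : Integrable fun a => 2 * (F (symMatrix _ a) * symMatrix _ a i i ^ 2 * w a) +
        2 * (F (symMatrix _ a) * symMatrix _ a j j ^ 2 * w a) := i1.add i2
    have i3 := (hint _ (((PolyGrowth.entry i i).mul (PolyGrowth.entry j j)).add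
      ((PolyGrowth.const 2).mul ((PolyGrowth.entry i j).pow 2)))).const_mul 4
    rw [← integral_add (hint _ (hpoly _)) (hint _ (hpoly _)), ← integral_const_mul,
      ← integral_const_mul, ← integral_const_mul, ← integral_add i1 i2, ← integral_add i12 i3]
    refine integral_congr_ae (Filter.Eventually.of_forall fun a => ?_)
    simp only [hquad]; ring
  have hdiag : ∀ i, ∫ a, F (symMatrix _ a) * symMatrix _ a i i ^ 2 * w a = Q := fun i => by
    have := hq (e i)
    simpa [e] using this
  have hnorm : ∀ c : ℝ, (e i + c • e j) ⬝ᵥ (e i + c • e j) =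
      1 + c ^ 2 + 2 * c * (if i = j then 1 else 0) := fun c => by
    simp only [e, add_dotProduct, dotProduct_add, smul_dotProduct, dotProduct_smul,
      single_one_dotProduct, smul_eq_mul, Pi.single_apply, eq_comm (a := j) (b := i)]
    simp
    split_ifs <;> ring
  rw [h1, h2, hdiag, hdiag, hnorm, hnorm] at hsum
  split_ifs at hsum ⊢ <;> linarith

/-- Summation of `integral_entry_pair` over all pairs: `n` diagonal pairs count three times and `n
(n - 1)` others once, in total `n (n + 2)` with `n = k + 1`. -/
lemma traceMoment_two_add (hF : IsInvariantOfDegree F d) (s : ℝ) :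
    traceMoment F 2 s + 2 * ∫ a, F (symMatrix _ a) *
        (symMatrix (k + 1) a * symMatrix _ a).trace * gaussWeight (k + 1) (1 / 2) s a =
      (k + 1) * (k + 3) *
        ∫ a, F (symMatrix _ a) * symMatrix _ a 0 0 ^ 2 * gaussWeight (k + 1) (1 / 2) s a := by
  set w := gaussWeight (k + 1) (1 / 2) s
  set Q := ∫ a, F (symMatrix _ a) * symMatrix _ a 0 0 ^ 2 * w a
  have hint : ∀ G : (UpperIdx (k + 1) → ℝ) → ℝ, PolyGrowth G → Integrable fun a =>
      F (symMatrix _ a) * G a * w a := fun G hG =>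
    (hF.polyGrowth.mul hG).integrable (by norm_num) s
  have hpair : ∀ i j : Fin (k + 1), PolyGrowth fun a => symMatrix (k + 1) a i i *
      symMatrix (k + 1) a j j + 2 * symMatrix (k + 1) a i j ^ 2 := fun i j =>
    ((PolyGrowth.entry i i).mul (PolyGrowth.entry j j)).add
      ((PolyGrowth.const 2).mul ((PolyGrowth.entry i j).pow 2))
  have htr2 : PolyGrowth fun a => (symMatrix (k + 1) a * symMatrix (k + 1) a).trace := by
    simp only [trace_mul_self_symMatrix]
    exact PolyGrowth.sum _ fun i _ => PolyGrowth.sum _ fun j _ => (PolyGrowth.entry i j).pow 2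
  calc _ = ∫ a, ∑ i, ∑ j, F (symMatrix _ a) * (symMatrix _ a i i * symMatrix _ a j j +
        2 * symMatrix _ a i j ^ 2) * w a := by
        rw [traceMoment, ← integral_const_mul,
          ← integral_add (hint _ (PolyGrowth.trace.pow 2)) ((hint _ htr2).const_mul 2)]
        refine integral_congr_ae (Filter.Eventually.of_forall fun a => ?_)
        simp only [← Finset.sum_mul, ← Finset.mul_sum, Finset.sum_add_distrib,
          trace_mul_self_symMatrix]
        simp only [Matrix.trace, Matrix.diag, w]
        ring
    _ = ∑ i : Fin (k + 1), ∑ j : Fin (k + 1), (if i = j then 3 else 1) * Q := by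
        rw [integral_finsetSum _ fun i _ => integrable_finsetSum _ fun j _ => hint _ (hpair i j)]
        refine Finset.sum_congr rfl fun i _ => ?_
        rw [integral_finsetSum _ fun j _ => hint _ (hpair i j)]
        exact Finset.sum_congr rfl fun j _ => integral_entry_pair hF s i j
    _ = _ := by
        have : ∀ i j : Fin (k + 1), (if i = j then (3 : ℝ) else 1) = 1 + if i = j then 2 else 0 :=
          fun i j => by split_ifs <;> norm_num
        simp only [← Finset.sum_mul, this, Finset.sum_add_distrib, Finset.sum_ite_eq]
        simp
        left
        ring

end

/-! ### The Hermite equation with a source. -/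

/-- The Gaussian weight `exp (-Tr (A + u)² / 2)`. -/
noncomputable def shiftWeight (n : ℕ) (u : ℝ) (a : UpperIdx n → ℝ) : ℝ :=
  exp (-(1 / 2) * ((symMatrix n a + u • 1) ^ 2).trace)

lemma shiftWeight_eq {n : ℕ} (u : ℝ) (a : UpperIdx n → ℝ) :
    shiftWeight n u a = exp (-(n * u ^ 2 / 2)) * gaussWeight n (1 / 2) u a := by
  rw [shiftWeight, gaussWeight, ← exp_add]
  congr 1
  simp only [sq, Matrix.add_mul, Matrix.mul_add, Matrix.smul_mul, Matrix.mul_smul, Matrix.one_mul,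
    Matrix.mul_one, Matrix.trace_add, Matrix.trace_smul, Matrix.trace_one, smul_eq_mul,
    Fintype.card_fin]
  ring

/-- The unnormalized mean of `F` over the ensemble with mean `-u`. -/
noncomputable def shiftIntegral {n : ℕ} (F : Matrix (Fin n) (Fin n) ℝ → ℝ) (u : ℝ) : ℝ :=
  ∫ a, F (symMatrix n a) * shiftWeight n u a

/-- Invariant homogeneous functionals satisfy a Hermite equation with a source. -/
lemma shiftIntegral_ode {k d : ℕ} {F : Matrix (Fin (k + 1)) (Fin (k + 1)) ℝ → ℝ}
    (hF : IsInvariantOfDegree F d) :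
    ∃ Φ' Φ'' : ℝ → ℝ, (∀ u, HasDerivAt (shiftIntegral F) (Φ' u) u) ∧
      (∀ u, HasDerivAt Φ' (Φ'' u) u) ∧
      ∀ u, 1 / 2 * Φ'' u - u * Φ' u + d * shiftIntegral F u =
        (k + 1) * (k + 3) / 2 * ∫ a, F (symMatrix _ a) * ((symMatrix _ a 0 0 + u) ^ 2 - 1) *
          shiftWeight (k + 1) u a := by
  set c : ℝ := (k : ℝ) + 1
  set g : ℝ → ℝ := fun u => exp (-(c * u ^ 2 / 2))
  have hg : ∀ u, HasDerivAt g (g u * (-(c * u))) u := fun u => by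
    refine ((((hasDerivAt_id u).pow 2).const_mul c).div_const 2).neg.exp.congr_deriv ?_
    simp only [g, Pi.pow_apply, id, Pi.neg_apply]
    push_cast
    ring
  have hw : ∀ u a, shiftWeight (k + 1) u a = g u * gaussWeight (k + 1) (1 / 2) u a := fun u a => by
    rw [shiftWeight_eq]; simp only [g, c]; push_cast; rfl
  have hfun : shiftIntegral F = fun u => g u * traceMoment F 0 u := by
    ext u
    rw [shiftIntegral, traceMoment, ← integral_const_mul]
    refine integral_congr_ae (Filter.Eventually.of_forall fun a => ?_)
    simp only [hw]; ring
  set ψ := traceMoment F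
  have hψ : ∀ j u, HasDerivAt (ψ j) (-ψ (j + 1) u) u := hasDerivAt_traceMoment hF
  refine ⟨fun u => g u * (-(c * u) * ψ 0 u - ψ 1 u),
    fun u => g u * ((c ^ 2 * u ^ 2 - c) * ψ 0 u + 2 * c * u * ψ 1 u + ψ 2 u), ?_, ?_, ?_⟩
  · intro u
    rw [hfun]
    exact ((hg u).mul (hψ 0 u)).congr_deriv (by ring)
  · intro u
    refine ((hg u).mul ((((hasDerivAt_id u).const_mul c).neg.mul (hψ 0 u)).sub
      (hψ 1 u))).congr_deriv ?_
    simp only [Pi.sub_apply, Pi.mul_apply, Pi.neg_apply, id]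
    ring
  · intro u
    have hint : ∀ G : (UpperIdx (k + 1) → ℝ) → ℝ, PolyGrowth G → Integrable fun a =>
        F (symMatrix _ a) * G a * gaussWeight (k + 1) (1 / 2) u a := fun G hG =>
      (hF.polyGrowth.mul hG).integrable (by norm_num) u
    have hΔ : ∫ a, F (symMatrix _ a) * ((symMatrix _ a 0 0 + u) ^ 2 - 1) *
          shiftWeight (k + 1) u a = g u *
        ((∫ a, F (symMatrix _ a) * symMatrix _ a 0 0 ^ 2 * gaussWeight (k + 1) (1 / 2) u a) +
          2 * u * (∫ a, F (symMatrix _ a) * symMatrix _ a 0 0 * gaussWeight (k + 1) (1 / 2) u a) +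
          (u ^ 2 - 1) * ψ 0 u) := by
      have i1 := hint _ ((PolyGrowth.entry 0 0).pow 2)
      have i2 := (hint _ (PolyGrowth.entry 0 0)).const_mul (2 * u)
      have i3 := (hint _ (PolyGrowth.trace.pow 0)).const_mul (u ^ 2 - 1)
      have i12 : Integrable fun a => F (symMatrix _ a) * symMatrix _ a 0 0 ^ 2 *
          gaussWeight (k + 1) (1 / 2) u a + 2 * u * (F (symMatrix _ a) * symMatrix _ a 0 0 *
            gaussWeight (k + 1) (1 / 2) u a) := i1.add i2
      simp only [ψ, traceMoment]
      rw [← integral_const_mul, ← integral_const_mul, ← integral_add i1 i2,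
        ← integral_add i12 i3, ← integral_const_mul]
      refine integral_congr_ae (Filter.Eventually.of_forall fun a => ?_)
      simp only [hw]; ring
    -- The second derivative contains `(Tr A)²`, and Euler's identity trades the term with `d` for
    -- `Tr A²`. They occur in the ratio `1 : 2`, exactly the combination that reduces to `A₀₀²`.
    have hE := integral_trace_mul_self hF u
    have h1 := traceMoment_one hF u
    have h2 := traceMoment_two_add hF u
    have hN : 2 * (Fintype.card (UpperIdx (k + 1)) : ℝ) = c * (c + 1) := by
      have := card_upperIdx (k + 1)
      simp only [c]
      exact_mod_cast this
    rw [hΔ, hfun]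
    rw [hE] at h2
    simp only
    set Q := ∫ a, F (symMatrix _ a) * symMatrix _ a 0 0 ^ 2 * gaussWeight (k + 1) (1 / 2) u a
    set M := ∫ a, F (symMatrix _ a) * symMatrix _ a 0 0 * gaussWeight (k + 1) (1 / 2) u a
    have hk : (k : ℝ) = c - 1 := by simp [c]
    rw [show (k : ℝ) + 3 = c + 2 by rw [hk]; ring] at h2 ⊢
    change ψ 1 u = c * M at h1
    change ψ 2 u + 2 * ((d + (Fintype.card (UpperIdx (k + 1)) : ℝ)) * ψ 0 u - u * ψ 1 u) =
      c * (c + 2) * Q at h2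
    linear_combination (1 / 2) * g u * h2 - g u * ψ 0 u / 2 * hN + g u * (c + 2) * u * h1

/-! ### Integrating out the first diagonal entry. -/

section border

variable {k : ℕ} (x : ℝ) (b : Fin k → ℝ) (C : Matrix (Fin k) (Fin k) ℝ)

lemma det_borderMatrix :
    (borderMatrix x b C).det = x * C.det + (borderMatrix 0 b C).det := by
  rw [Matrix.det_succ_row_zero, Matrix.det_succ_row_zero (borderMatrix 0 b C), Fin.sum_univ_succ,
    Fin.sum_univ_succ]
  have h : ∀ j : Fin (k + 1), (borderMatrix x b C).submatrix Fin.succ j.succAbove =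
      (borderMatrix 0 b C).submatrix Fin.succ j.succAbove := fun j => rfl
  have h0 : (borderMatrix x b C).submatrix Fin.succ (0 : Fin (k + 1)).succAbove = C := by
    ext i j; simp
  simp only [borderMatrix_zero_succ, borderMatrix_zero_zero, h]
  rw [← h, h0]
  simp

/-- The Schur complement formula. With the border in the form `C y`, a unitriangular row operation
by `y` clears the first row, so `C` need not be invertible. -/
lemma det_borderMatrix_mulVec {C : Matrix (Fin k) (Fin k) ℝ} (hC : C.IsSymm) (y : Fin k → ℝ) :
    (borderMatrix x (C *ᵥ y) C).det = (x - y ⬝ᵥ C *ᵥ y) * C.det := by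
  set U : Matrix (Fin (k + 1)) (Fin (k + 1)) ℝ :=
    Matrix.of (Fin.cons (Fin.cons 1 y) fun i => Fin.cons 0 ((1 : Matrix (Fin k) (Fin k) ℝ) i))
  set M : Matrix (Fin (k + 1)) (Fin (k + 1)) ℝ :=
    Matrix.of (Fin.cons (Fin.cons (x - y ⬝ᵥ C *ᵥ y) 0) fun i => Fin.cons ((C *ᵥ y) i) (C i))
  have hUM : borderMatrix x (C *ᵥ y) C = U * M := by
    ext i j
    rw [Matrix.mul_apply, Fin.sum_univ_succ]
    refine Fin.cases ?_ (fun i => ?_) i <;> refine Fin.cases ?_ (fun j => ?_) j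
    · simp [U, M, dotProduct]
    · simp only [U, M, borderMatrix_zero_succ, Matrix.of_apply, Fin.cons_zero, Fin.cons_succ,
        Pi.zero_apply, mul_zero, zero_add, Matrix.mulVec, dotProduct]
      exact Finset.sum_congr rfl fun l _ => by rw [hC.apply, mul_comm]
    · simp [U, M, Matrix.one_apply]
    · simp [U, M, Matrix.one_apply]
  have hU : U.det = 1 := by
    rw [Matrix.det_succ_column_zero, Fin.sum_univ_succ]
    have : U.submatrix (0 : Fin (k + 1)).succAbove Fin.succ = 1 := by
      ext i j; simp [U]
    rw [this]
    simp [U]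
  have hM : M.det = (x - y ⬝ᵥ C *ᵥ y) * C.det := by
    rw [Matrix.det_succ_row_zero, Fin.sum_univ_succ]
    have : M.submatrix Fin.succ (0 : Fin (k + 1)).succAbove = C := by
      ext i j; simp [M]
    rw [this]
    simp [M]
  rw [hUM, Matrix.det_mul, hU, hM, one_mul]

lemma trace_sq_borderMatrix_add (u : ℝ) :
    ((borderMatrix x b C + u • 1) ^ 2).trace =
      (x + u) ^ 2 + 2 * (b ⬝ᵥ b) + ((C + u • 1) ^ 2).trace := by
  have h : borderMatrix x b C + u • 1 = borderMatrix (x + u) b (C + u • 1) := by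
    ext i j
    refine Fin.cases ?_ (fun i => ?_) i <;> refine Fin.cases ?_ (fun j => ?_) j <;>
      simp [Matrix.one_apply, Fin.succ_ne_zero, (Fin.succ_ne_zero _).symm]
  rw [h, sq, sq (C + _), Matrix.trace, Matrix.trace, Fin.sum_univ_succ]
  simp only [Matrix.diag, Matrix.mul_apply, Fin.sum_univ_succ (n := k), borderMatrix_zero_zero,
    borderMatrix_zero_succ, borderMatrix_succ_zero, borderMatrix_succ_succ,
    Finset.sum_add_distrib, dotProduct]
  ring

end border

lemma shiftWeight_symSplit {k : ℕ} (u x : ℝ) (b : Fin k → ℝ) (c : UpperIdx k → ℝ) :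
    shiftWeight (k + 1) u (symSplit k (x, b, c)) =
      exp (-((x + u) ^ 2 / 2)) * (exp (-(b ⬝ᵥ b)) * shiftWeight k u c) := by
  rw [shiftWeight, shiftWeight, symMatrix_symSplit, trace_sq_borderMatrix_add, ← exp_add,
    ← exp_add]
  congr 1; ring

lemma continuous_shiftWeight (n : ℕ) (u : ℝ) : Continuous (shiftWeight n u) := by
  rw [show shiftWeight n u = _ from funext (shiftWeight_eq u)]
  exact (continuous_gaussWeight n _ u).const_mul _

lemma shiftWeight_pos (n : ℕ) (u : ℝ) (a : UpperIdx n → ℝ) : 0 < shiftWeight n u a := exp_pos _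

lemma PolyGrowth.integrable_shiftWeight {n : ℕ} {G : (UpperIdx n → ℝ) → ℝ} (hG : PolyGrowth G)
    (u : ℝ) : Integrable fun a => G a * shiftWeight n u a := by
  refine ((hG.integrable (c := 1 / 2) (by norm_num) u).const_mul (exp (-(n * u ^ 2 / 2)))).congr
    (Filter.Eventually.of_forall fun a => ?_)
  simp only [shiftWeight_eq]; ring

lemma integral_symSplit {k : ℕ} {G : (UpperIdx (k + 1) → ℝ) → ℝ} (hG : Integrable G) :
    ∫ a, G a = ∫ q : (Fin k → ℝ) × (UpperIdx k → ℝ), ∫ x, G (symSplit k (x, q)) := by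
  rw [← (measurePreserving_symSplit k).integral_comp (symSplit k).measurableEmbedding]
  exact integral_prod_symm _
    ((measurePreserving_symSplit k).integrable_comp_emb (symSplit k).measurableEmbedding |>.2 hG)

lemma integrable_pow_mul_gaussian (j : ℕ) :
    Integrable fun t : ℝ => t ^ j * exp (-(t ^ 2 / 2)) := by
  refine (integrable_rpow_mul_exp_neg_mul_sq (b := 1 / 2) (by norm_num) (s := j)
    (neg_one_lt_zero.trans_le (Nat.cast_nonneg j))).congr
    (Filter.Eventually.of_forall fun x => ?_)
  simp only [rpow_natCast]
  congr 2; ring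

lemma integral_gaussian_half : ∫ t : ℝ, exp (-(t ^ 2 / 2)) = √(2 * π) := by
  rw [show 2 * π = π / (1 / 2) by ring, ← integral_gaussian]
  congr 1 with t; congr 1; ring

/-- Green's identity for the Gaussian weight. -/
lemma hasDerivAt_gaussian_green {p p' : ℝ → ℝ} {p'' t : ℝ} (h : HasDerivAt p (p' t) t)
    (h' : HasDerivAt p' p'' t) :
    HasDerivAt (fun t => -(t * p t + p' t) * exp (-(t ^ 2 / 2)))
      ((t ^ 2 - 1) * p t * exp (-(t ^ 2 / 2)) - p'' * exp (-(t ^ 2 / 2))) t := by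
  have hg : HasDerivAt (fun t : ℝ => exp (-(t ^ 2 / 2))) (-t * exp (-(t ^ 2 / 2))) t := by
    refine ((((hasDerivAt_id t).pow 2).div_const 2).neg.exp).congr_deriv ?_
    simp
    ring
  refine ((((hasDerivAt_id t).mul h).add h').neg.mul hg).congr_deriv ?_
  simp
  ring

/-- By Green's identity the factor `t ^ 2 - 1` becomes the second derivative of the square, the
constant `2 α²`. -/
lemma integral_hermite_two_mul_sq (α β : ℝ) :
    ∫ t : ℝ, (t ^ 2 - 1) * (α * t + β) ^ 2 * exp (-(t ^ 2 / 2)) = 2 * √(2 * π) * α ^ 2 := by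
  have i := integrable_pow_mul_gaussian
  have hd : ∀ t : ℝ, HasDerivAt (fun t => -(t * (α * t + β) ^ 2 + 2 * α * (α * t + β)) *
      exp (-(t ^ 2 / 2))) ((t ^ 2 - 1) * (α * t + β) ^ 2 * exp (-(t ^ 2 / 2)) -
        2 * α ^ 2 * exp (-(t ^ 2 / 2))) t := fun t => by
    have h1 : HasDerivAt (fun t => α * t + β) α t := by
      simpa using ((hasDerivAt_id t).const_mul α).add_const β
    refine hasDerivAt_gaussian_green (p := fun t => (α * t + β) ^ 2)
      (p' := fun t => 2 * α * (α * t + β)) ((h1.pow 2).congr_deriv (by simp; ring))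
      ((h1.const_mul (2 * α)).congr_deriv (by ring))
  have i0 : Integrable fun t : ℝ => 2 * α ^ 2 * exp (-(t ^ 2 / 2)) :=
    ((i 0).const_mul (2 * α ^ 2)).congr (Filter.Eventually.of_forall fun t => by simp)
  have i1 : Integrable fun t : ℝ => (t ^ 2 - 1) * (α * t + β) ^ 2 * exp (-(t ^ 2 / 2)) := by
    refine (((((i 4).const_mul (α ^ 2)).add ((i 3).const_mul (2 * α * β))).add
      ((i 2).const_mul (β ^ 2 - α ^ 2))).add (((i 1).const_mul (-2 * α * β)).add
        ((i 0).const_mul (-β ^ 2)))).congr (Filter.Eventually.of_forall fun t => ?_)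
    simp; ring
  have i2 : Integrable fun t : ℝ => -(t * (α * t + β) ^ 2 + 2 * α * (α * t + β)) *
      exp (-(t ^ 2 / 2)) := by
    refine (((((i 3).const_mul (-α ^ 2)).add ((i 2).const_mul (-2 * α * β))).add
      ((i 1).const_mul (-β ^ 2 - 2 * α ^ 2))).add ((i 0).const_mul (-2 * α * β))).congr
      (Filter.Eventually.of_forall fun t => ?_)
    simp; ring
  have h := integral_eq_zero_of_hasDerivAt_of_integrable hd (i1.sub i0) i2
  rw [integral_sub i1 i0, integral_const_mul, integral_gaussian_half] at h
  linarith

/-- The function `|α t + β| - (α t + β)` vanishes to the right of its kink at `-β / α`, so Green's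
identity on the left half-line leaves only the boundary term at the kink. The jump of the slope
there is `2 α`. -/
lemma integral_hermite_two_mul_abs_sub_of_pos {α : ℝ} (hα : 0 < α) (β : ℝ) :
    ∫ t : ℝ, (t ^ 2 - 1) * (|α * t + β| - (α * t + β)) * exp (-(t ^ 2 / 2)) =
      2 * α * exp (-((β / α) ^ 2 / 2)) := by
  have i := integrable_pow_mul_gaussian
  set a := -(β / α)
  have ha : α * a + β = 0 := by simp only [a]; field_simp; ring
  have hd : ∀ t : ℝ, HasDerivAt (fun t => -(t * (-2 * (α * t + β)) + -2 * α) *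
      exp (-(t ^ 2 / 2))) ((t ^ 2 - 1) * (-2 * (α * t + β)) * exp (-(t ^ 2 / 2))) t := fun t => by
    have h1 : HasDerivAt (fun t => α * t + β) α t := by
      simpa using ((hasDerivAt_id t).const_mul α).add_const β
    refine (hasDerivAt_gaussian_green (p := fun t => -2 * (α * t + β))
      (p' := fun _ => -2 * α) (h1.const_mul (-2)) (hasDerivAt_const t _)).congr_deriv (by ring)
  have i1 : Integrable fun t : ℝ => (t ^ 2 - 1) * (-2 * (α * t + β)) * exp (-(t ^ 2 / 2)) := by
    refine ((((i 3).const_mul (-2 * α)).add ((i 2).const_mul (-2 * β))).add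
      (((i 1).const_mul (2 * α)).add ((i 0).const_mul (2 * β)))).congr
      (Filter.Eventually.of_forall fun t => ?_)
    simp; ring
  have i2 : Integrable fun t : ℝ => -(t * (-2 * (α * t + β)) + -2 * α) * exp (-(t ^ 2 / 2)) := by
    refine (((i 2).const_mul (2 * α)).add (((i 1).const_mul (2 * β)).add
      ((i 0).const_mul (2 * α)))).congr (Filter.Eventually.of_forall fun t => ?_)
    simp; ring
  have h := integral_Iic_of_hasDerivAt_of_tendsto' (a := a) (fun t _ => hd t) i1.integrableOn
    (tendsto_zero_of_hasDerivAt_of_integrableOn_Iic (a := a) (fun t _ => hd t) i1.integrableOn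
      i2.integrableOn)
  have hI : ∀ t, (t ^ 2 - 1) * (|α * t + β| - (α * t + β)) * exp (-(t ^ 2 / 2)) =
      (Set.Iic a).indicator
        (fun t => (t ^ 2 - 1) * (-2 * (α * t + β)) * exp (-(t ^ 2 / 2))) t := fun t => by
    have e : α * t + β = α * (t - a) := by linear_combination ha
    by_cases ht : t ∈ Set.Iic a
    · rw [Set.indicator_of_mem ht, abs_of_nonpos]
      · ring
      · rw [e]; exact mul_nonpos_of_nonneg_of_nonpos hα.le (sub_nonpos.2 ht)
    · rw [Set.indicator_of_notMem ht, abs_of_nonneg]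
      · ring
      · rw [e]; exact mul_nonneg hα.le (sub_nonneg.2 (not_le.1 ht).le)
  simp only [hI]
  rw [integral_indicator measurableSet_Iic, h, ha]
  simp [a]

lemma integral_hermite_two_mul_abs_sub (α β : ℝ) :
    ∫ t : ℝ, (t ^ 2 - 1) * (|α * t + β| - (α * t + β)) * exp (-(t ^ 2 / 2)) =
      2 * |α| * exp (-((β / α) ^ 2 / 2)) := by
  rcases lt_trichotomy α 0 with h | rfl | h
  · have := integral_hermite_two_mul_abs_sub_of_pos (neg_pos.2 h) β
    rw [abs_of_neg h, show (β / α) ^ 2 = (β / -α) ^ 2 by rw [div_neg, neg_sq], ← this,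
      ← integral_neg_eq_self]
    congr 1 with t; simp
  -- For `α = 0` the convention `β / 0 = 0` is harmless: the right side has the factor `|α|`, and on
  -- the left a constant is integrated against `t ^ 2 - 1`, which has Gaussian mean zero.
  · have h := integral_hermite_two_mul_sq 0 1
    simp only [zero_mul, zero_add, one_pow, mul_one, ne_eq, OfNat.ofNat_ne_zero,
      not_false_eq_true, zero_pow, mul_zero] at h
    have h2 := congrArg (· * (|β| - β)) h
    simp only [← integral_mul_const, zero_mul] at h2
    simp only [abs_zero, mul_zero, zero_mul, zero_add]
    rw [← h2]
    congr 1 with t; ring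
  · rw [abs_of_pos h, integral_hermite_two_mul_abs_sub_of_pos h]

lemma PolyGrowth.prod {n : ℕ} {ι : Type*} (s : Finset ι) {f : ι → (UpperIdx n → ℝ) → ℝ}
    (h : ∀ i ∈ s, PolyGrowth (f i)) : PolyGrowth fun a => ∏ i ∈ s, f i a := by
  classical
  induction s using Finset.induction_on with
  | empty => simpa using PolyGrowth.const (n := n) 1
  | insert i s hi ih =>
    simp only [Finset.prod_insert hi]
    exact (h i (Finset.mem_insert_self i s)).mul
      (ih fun j hj => h j (Finset.mem_insert_of_mem hj))

lemma PolyGrowth.det (n : ℕ) : PolyGrowth fun a => (symMatrix n a).det := by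
  simp only [Matrix.det_apply']
  exact .sum _ fun σ _ => (PolyGrowth.const _).mul (.prod _ fun i _ => .entry _ _)

lemma PolyGrowth.abs {n : ℕ} {G : (UpperIdx n → ℝ) → ℝ} (hG : PolyGrowth G) :
    PolyGrowth fun a => |G a| :=
  ⟨hG.continuous.abs, by simpa only [abs_abs] using hG.bound⟩

lemma PolyGrowth.sub {n : ℕ} {G H : (UpperIdx n → ℝ) → ℝ} (hG : PolyGrowth G)
    (hH : PolyGrowth H) : PolyGrowth fun a => G a - H a := by
  simpa [sub_eq_add_neg] using hG.add ((PolyGrowth.const (-1)).mul hH)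

lemma integral_gaussian_pi (k : ℕ) (t : ℝ) :
    ∫ b : Fin k → ℝ, exp (-t * (b ⬝ᵥ b)) = √(π / t) ^ k := by
  have h := integral_fintype_prod_eq_pow (ι := Fin k) (μ := (volume : Measure ℝ))
    fun x : ℝ => exp (-t * x ^ 2)
  rw [integral_gaussian, Fintype.card_fin] at h
  rw [← h]
  refine integral_congr_ae (Filter.Eventually.of_forall fun b => ?_)
  simp only [← exp_sum, ← Finset.mul_sum, dotProduct, sq]

section source

variable (k : ℕ) (u : ℝ)

/-- Integrating the first diagonal entry out of the source term of the Hermite equation. -/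
lemma integral_source {φ : ℝ → ℝ} (hφ : PolyGrowth fun a => φ (symMatrix (k + 1) a).det) :
    ∫ a, φ (symMatrix _ a).det * ((symMatrix _ a 0 0 + u) ^ 2 - 1) * shiftWeight (k + 1) u a =
      ∫ q : (Fin k → ℝ) × (UpperIdx k → ℝ),
        (∫ t, (t ^ 2 - 1) * φ ((symMatrix k q.2).det * t +
          ((borderMatrix 0 q.1 (symMatrix k q.2)).det - (symMatrix k q.2).det * u)) *
            exp (-(t ^ 2 / 2))) * (exp (-(q.1 ⬝ᵥ q.1)) * shiftWeight k u q.2) := by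
  rw [integral_symSplit]
  · refine integral_congr_ae (Filter.Eventually.of_forall fun ⟨b, c⟩ => ?_)
    simp only
    rw [← integral_mul_const]
    -- Substitution `t = x + u`: the shifted diagonal entry is a standard Gaussian variable.
    conv_rhs => rw [← integral_add_right_eq_self _ u]
    refine integral_congr_ae (Filter.Eventually.of_forall fun x => ?_)
    simp only [symMatrix_symSplit, shiftWeight_symSplit, borderMatrix_zero_zero]
    rw [det_borderMatrix, show (symMatrix k c).det * (x + u) + ((borderMatrix 0 b
      (symMatrix k c)).det - (symMatrix k c).det * u) = x * (symMatrix k c).det +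
      (borderMatrix 0 b (symMatrix k c)).det by ring]
    ring
  · exact (hφ.mul ((((PolyGrowth.entry 0 0).add (.const u)).pow 2).sub
      (.const 1))).integrable_shiftWeight u

lemma integral_source_det_sq :
    ∫ a, (symMatrix _ a).det ^ 2 * ((symMatrix _ a 0 0 + u) ^ 2 - 1) *
        shiftWeight (k + 1) u a =
      2 * √(2 * π) * √π ^ k * shiftIntegral (fun A : Matrix (Fin k) (Fin k) ℝ => A.det ^ 2) u := by
  rw [integral_source k u (φ := fun x => x ^ 2) ((PolyGrowth.det _).pow 2)]
  simp only [integral_hermite_two_mul_sq]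
  have h1 := integral_gaussian_pi k 1
  have h2 := integral_prod_mul (μ := (volume : Measure (Fin k → ℝ)))
    (ν := (volume : Measure (UpperIdx k → ℝ))) (fun b => exp (-(b ⬝ᵥ b)))
    fun c => (symMatrix k c).det ^ 2 * shiftWeight k u c
  simp only [neg_mul, one_mul, div_one] at h1
  rw [h1] at h2
  rw [shiftIntegral, mul_assoc, ← h2, ← integral_const_mul]
  refine integral_congr_ae (Filter.Eventually.of_forall fun q => ?_)
  simp only; ring

end source

/-! ### Reducing the source of the excess to the second moment. -/

lemma lintegral_mulVec {k : ℕ} {C : Matrix (Fin k) (Fin k) ℝ} (hC : C.det ≠ 0)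
    {f : (Fin k → ℝ) → ENNReal} (hf : Measurable f) :
    ∫⁻ b, f b = ENNReal.ofReal |C.det| * ∫⁻ y, f (C *ᵥ y) := by
  have hm : Measurable (Matrix.toLin' C) :=
    (LinearMap.continuous_of_finiteDimensional (Matrix.toLin' C)).measurable
  have h := lintegral_map hf hm (μ := volume)
  rw [Real.map_matrix_volume_pi_eq_smul_volume_pi hC, lintegral_smul_measure] at h
  simp only [Matrix.toLin'_apply] at h
  rw [← h, smul_eq_mul, ← mul_assoc, ← ENNReal.ofReal_mul (abs_nonneg _), ← abs_mul,
    mul_inv_cancel₀ hC]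
  simp

/-- The symmetric square root of `1 + y yᵀ`. -/
lemma exists_symm_mul_self_eq {k : ℕ} (y : Fin k → ℝ) :
    ∃ P : Matrix (Fin k) (Fin k) ℝ, Pᵀ = P ∧ P * P = 1 + Matrix.vecMulVec y y ∧
      |P.det| = √(1 + y ⬝ᵥ y) := by
  have hr : 0 ≤ y ⬝ᵥ y := Finset.sum_nonneg fun i _ => mul_self_nonneg (y i)
  set s := √(1 + y ⬝ᵥ y)
  have hs : s ^ 2 = 1 + y ⬝ᵥ y := sq_sqrt (by positivity)
  have hs0 : 0 ≤ s := sqrt_nonneg _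
  -- The square of `1 + r y yᵀ` is `1 + (2 r + r² |y|²) y yᵀ`; with `|y|² = s² - 1` the bracket is
  -- `1` for `r = 1 / (1 + s)`.
  set P : Matrix (Fin k) (Fin k) ℝ := 1 + (1 / (1 + s)) • Matrix.vecMulVec y y
  have hP : P * P = 1 + Matrix.vecMulVec y y := by
    simp only [P, Matrix.add_mul, Matrix.mul_add, Matrix.one_mul, Matrix.mul_one, Matrix.smul_mul,
      Matrix.mul_smul, Matrix.vecMulVec_mul_vecMulVec]
    ext i j
    simp only [Matrix.add_apply, Matrix.smul_apply, Matrix.vecMulVec_apply, Pi.smul_apply,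
      smul_eq_mul]
    rw [show y ⬝ᵥ y = s ^ 2 - 1 by linarith]
    field_simp
    ring
  refine ⟨P, ?_, hP, ?_⟩
  · simp [P, Matrix.transpose_add, Matrix.transpose_smul, Matrix.transpose_vecMulVec]
  · have h := congrArg Matrix.det hP
    rw [Matrix.vecMulVec_eq Unit, Matrix.det_one_add_replicateCol_mul_replicateRow,
      Matrix.det_mul, ← sq] at h
    rw [← sqrt_sq_eq_abs, h]

/-- The identity behind the reduction. With `b = C y` the right side collects, up to the factor
`-1/2`, the exponents from the kink, from `b` and from `C`. The left side shows that together they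
are the exponent of the weight at `P C Pᵀ`, up to the constant `u ^ 2`. -/
lemma trace_sq_congruence_add {k : ℕ} {P : Matrix (Fin k) (Fin k) ℝ} {y : Fin k → ℝ}
    (hPT : Pᵀ = P) (hP : P * P = 1 + Matrix.vecMulVec y y) {C : Matrix (Fin k) (Fin k) ℝ}
    (hC : C.IsSymm) (u : ℝ) :
    ((P * C * Pᵀ + u • 1) ^ 2).trace + u ^ 2 =
      (y ⬝ᵥ C *ᵥ y + u) ^ 2 + 2 * (C *ᵥ y ⬝ᵥ C *ᵥ y) + ((C + u • 1) ^ 2).trace := by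
  have hv : ∀ M : Matrix (Fin k) (Fin k) ℝ,
      (M * Matrix.vecMulVec y y).trace = y ⬝ᵥ M *ᵥ y := fun M => by
    rw [Matrix.mul_vecMulVec, Matrix.trace_vecMulVec, dotProduct_comm]
  have hCC : y ⬝ᵥ (C * C) *ᵥ y = C *ᵥ y ⬝ᵥ C *ᵥ y := by
    rw [← Matrix.mulVec_mulVec, Matrix.dotProduct_mulVec, ← Matrix.mulVec_transpose, hC.eq]
  have h1 : (P * C * P).trace = C.trace + y ⬝ᵥ C *ᵥ y := by
    rw [Matrix.trace_mul_comm, ← Matrix.mul_assoc, hP, Matrix.trace_mul_comm, Matrix.mul_add,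
      Matrix.mul_one, Matrix.trace_add, hv]
  have h2 : (P * C * P * (P * C * P)).trace =
      (C * C).trace + 2 * (C *ᵥ y ⬝ᵥ C *ᵥ y) + (y ⬝ᵥ C *ᵥ y) ^ 2 := by
    have e : P * C * P * (P * C * P) = P * (C * (P * P) * C * P) := by
      simp only [Matrix.mul_assoc]
    rw [e, Matrix.trace_mul_comm, Matrix.mul_assoc _ P P, hP, Matrix.mul_add, Matrix.mul_one,
      Matrix.trace_add, hv]
    have e1 : C * (1 + Matrix.vecMulVec y y) * C = C * C + Matrix.vecMulVec (C *ᵥ y) (C *ᵥ y) := by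
      rw [Matrix.mul_add, Matrix.add_mul, Matrix.mul_one, Matrix.mul_vecMulVec,
        Matrix.vecMulVec_mul, ← Matrix.mulVec_transpose, hC.eq]
    rw [e1, Matrix.trace_add, Matrix.trace_vecMulVec, Matrix.add_mulVec, dotProduct_add, hCC,
      Matrix.vecMulVec_mulVec, op_smul_eq_smul, dotProduct_smul, smul_eq_mul,
      dotProduct_comm (C *ᵥ y) y]
    ring
  have hx : ∀ M : Matrix (Fin k) (Fin k) ℝ,
      ((M + u • 1) ^ 2).trace = (M * M).trace + 2 * u * M.trace + k * u ^ 2 := fun M => by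
    simp only [sq, Matrix.add_mul, Matrix.mul_add, Matrix.smul_mul, Matrix.mul_smul,
      Matrix.one_mul, Matrix.mul_one, Matrix.trace_add, Matrix.trace_smul, Matrix.trace_one,
      smul_eq_mul, Fintype.card_fin]
    ring
  rw [hx, hx, hPT, h1, h2]
  ring

/-- The power is written as a Gamma integral over `t`; after swapping, the integral over `y` is
Gaussian and the one over `t` is again a Gamma integral. The exponent `k + 5` consists of `k + 1`
from the Jacobian of the congruence and `4` from `det ^ 2`. -/
lemma lintegral_one_add_sq (k : ℕ) :
    ∫⁻ y : Fin k → ℝ, ENNReal.ofReal ((√(1 + y ⬝ᵥ y) ^ (k + 5))⁻¹) =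
      ENNReal.ofReal (√π ^ k * Gamma (5 / 2) / Gamma ((k + 5) / 2)) := by
  set a : ℝ := (k + 5) / 2
  have ha : 0 < a := by positivity
  have hΓ := Gamma_pos_of_pos ha
  have hdot : ∀ y : Fin k → ℝ, 0 ≤ y ⬝ᵥ y := fun y =>
    Finset.sum_nonneg fun i _ => mul_self_nonneg (y i)
  have h1 : ∀ {a r : ℝ}, 0 < a → 0 < r → ∫⁻ t in Set.Ioi 0,
      ENNReal.ofReal (t ^ (a - 1) * exp (-(r * t))) = ENNReal.ofReal ((1 / r) ^ a * Gamma a) := by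
    intro a r ha hr
    have h := integral_rpow_mul_exp_neg_mul_Ioi ha hr
    rw [← h, ofReal_integral_eq_lintegral_ofReal]
    · refine Integrable.of_integral_ne_zero ?_
      rw [h]
      have := Gamma_pos_of_pos ha
      positivity
    · refine (ae_restrict_iff' measurableSet_Ioi).2 (Filter.Eventually.of_forall fun t ht => ?_)
      have : (0 : ℝ) < t := ht
      positivity
  have h2 : ∀ y : Fin k → ℝ, ENNReal.ofReal ((√(1 + y ⬝ᵥ y) ^ (k + 5))⁻¹) =
      ENNReal.ofReal (Gamma a)⁻¹ * ∫⁻ t in Set.Ioi 0,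
        ENNReal.ofReal (t ^ (a - 1) * exp (-((1 + y ⬝ᵥ y) * t))) := fun y => by
    have hr : 0 < 1 + y ⬝ᵥ y := by linarith [hdot y]
    rw [h1 ha hr, ← ENNReal.ofReal_mul (by positivity)]
    congr 1
    rw [one_div, inv_rpow hr.le, sqrt_eq_rpow, ← rpow_natCast, ← rpow_mul hr.le]
    rw [show (1 / 2 : ℝ) * ((k + 5 : ℕ) : ℝ) = a by simp only [a]; push_cast; ring]
    field_simp
  have h3 : ∀ t ∈ Set.Ioi (0 : ℝ), ∫⁻ y : Fin k → ℝ,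
      ENNReal.ofReal (t ^ (a - 1) * exp (-((1 + y ⬝ᵥ y) * t))) =
        ENNReal.ofReal (√π ^ k) * ENNReal.ofReal (t ^ ((5 / 2 : ℝ) - 1) * exp (-(1 * t))) := by
    intro t ht
    have ht : 0 < t := ht
    have hi := integral_gaussian_pi k t
    have hint : Integrable fun b : Fin k → ℝ => exp (-t * (b ⬝ᵥ b)) := by
      refine Integrable.of_integral_ne_zero ?_
      rw [hi]
      positivity
    have hi' := ofReal_integral_eq_lintegral_ofReal hint
      (Filter.Eventually.of_forall fun _ => (exp_pos _).le)
    have e : ∀ y : Fin k → ℝ, ENNReal.ofReal (t ^ (a - 1) * exp (-((1 + y ⬝ᵥ y) * t))) =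
        ENNReal.ofReal (t ^ (a - 1) * exp (-t)) * ENNReal.ofReal (exp (-t * (y ⬝ᵥ y))) :=
      fun y => by
        rw [← ENNReal.ofReal_mul (by positivity), mul_assoc, ← exp_add]
        congr 3; ring
    simp only [e]
    rw [lintegral_const_mul' _ _ ENNReal.ofReal_ne_top, ← hi', hi,
      ← ENNReal.ofReal_mul (by positivity), ← ENNReal.ofReal_mul (by positivity)]
    congr 1
    have e2 : √t ^ k = t ^ ((k : ℝ) / 2) := by
      rw [sqrt_eq_rpow, ← rpow_natCast, ← rpow_mul ht.le]; congr 1; ring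
    have e3 : t ^ (a - 1) = t ^ ((5 / 2 : ℝ) - 1) * t ^ ((k : ℝ) / 2) := by
      rw [← rpow_add ht]; congr 1; simp only [a]; ring
    rw [sqrt_div' _ ht.le, div_pow, e2, e3]
    field_simp
  simp only [h2]
  rw [lintegral_const_mul' _ _ ENNReal.ofReal_ne_top, lintegral_lintegral_swap,
    setLIntegral_congr_fun measurableSet_Ioi h3, lintegral_const_mul' _ _ ENNReal.ofReal_ne_top,
    h1 (by norm_num) one_pos, ← ENNReal.ofReal_mul (by positivity),
    ← ENNReal.ofReal_mul (by positivity)]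
  · congr 1
    simp
    field_simp
  · refine Measurable.aemeasurable ?_
    have : Measurable fun p : (Fin k → ℝ) × ℝ => p.1 ⬝ᵥ p.1 := by
      have : Continuous fun p : (Fin k → ℝ) × ℝ => p.1 ⬝ᵥ p.1 := by fun_prop
      exact this.measurable
    simp only [Function.uncurry_def]
    fun_prop

/-- The source term of the Hermite equation for `|det| - det` after integrating out the first
diagonal entry; `b` is the rest of the first row. -/
noncomputable def sourceDensity (k : ℕ) (u : ℝ) (b : Fin k → ℝ) (c : UpperIdx k → ℝ) : ℝ :=
  2 * |(symMatrix k c).det| *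
    exp (-((((borderMatrix 0 b (symMatrix k c)).det - (symMatrix k c).det * u) /
      (symMatrix k c).det) ^ 2 / 2)) * (exp (-(b ⬝ᵥ b)) * shiftWeight k u c)

section source

variable (k : ℕ) (u : ℝ)

lemma sourceDensity_nonneg (b : Fin k → ℝ) (c : UpperIdx k → ℝ) : 0 ≤ sourceDensity k u b c := by
  have := (shiftWeight_pos k u c).le
  unfold sourceDensity
  positivity

lemma measurable_sourceDensity :
    Measurable fun q : (Fin k → ℝ) × (UpperIdx k → ℝ) => sourceDensity k u q.1 q.2 := by
  have hS := continuous_symMatrix k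
  have hbm : Measurable fun q : (Fin k → ℝ) × (UpperIdx k → ℝ) =>
      (borderMatrix 0 q.1 (symMatrix k q.2)).det := by
    refine (Continuous.matrix_det (continuous_matrix fun i j => ?_)).measurable
    refine Fin.cases ?_ (fun i => ?_) i <;> refine Fin.cases ?_ (fun j => ?_) j <;>
      simp only [borderMatrix_zero_zero, borderMatrix_zero_succ, borderMatrix_succ_zero,
        borderMatrix_succ_succ]
    · fun_prop
    · fun_prop
    · fun_prop
    · exact (hS.comp continuous_snd).matrix_elem i j
  have hdm : Measurable fun q : (Fin k → ℝ) × (UpperIdx k → ℝ) => (symMatrix k q.2).det :=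
    (hS.comp continuous_snd).matrix_det.measurable
  have hbb : Measurable fun q : (Fin k → ℝ) × (UpperIdx k → ℝ) => q.1 ⬝ᵥ q.1 := by
    have : Continuous fun q : (Fin k → ℝ) × (UpperIdx k → ℝ) => q.1 ⬝ᵥ q.1 := by fun_prop
    exact this.measurable
  have hWm : Measurable fun q : (Fin k → ℝ) × (UpperIdx k → ℝ) => shiftWeight k u q.2 :=
    ((continuous_shiftWeight k u).comp continuous_snd).measurable
  unfold sourceDensity
  fun_prop

variable {k}

lemma lintegral_sourceDensity_mulVec (c : UpperIdx k → ℝ) :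
    ∫⁻ b, ENNReal.ofReal (sourceDensity k u b c) =
      ∫⁻ y, ENNReal.ofReal (|(symMatrix k c).det| * sourceDensity k u (symMatrix k c *ᵥ y) c) := by
  by_cases hc : (symMatrix k c).det = 0
  · simp [sourceDensity, hc]
  · have hm : Measurable fun b => ENNReal.ofReal (sourceDensity k u b c) :=
      ((measurable_sourceDensity k u).comp measurable_prodMk_right).ennreal_ofReal
    rw [lintegral_mulVec hc hm, ← lintegral_const_mul' _ _ ENNReal.ofReal_ne_top]
    refine lintegral_congr fun y => ?_
    rw [← ENNReal.ofReal_mul (abs_nonneg _)]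

/-- The factor `|det C|` is the Jacobian of `b = C y`. It joins the one in `sourceDensity` to form
`det C ^ 2`, which is `det (P C Pᵀ) ^ 2` divided by `|det P| ^ 4`, and `trace_sq_congruence_add`
matches the exponents. -/
lemma sourceDensity_mulVec {P : Matrix (Fin k) (Fin k) ℝ} {y : Fin k → ℝ}
    (hPT : Pᵀ = P) (hP : P * P = 1 + Matrix.vecMulVec y y) (hP0 : P.det ≠ 0)
    (c : UpperIdx k → ℝ) :
    |(symMatrix k c).det| * sourceDensity k u (symMatrix k c *ᵥ y) c =
      2 * exp (-(u ^ 2 / 2)) * (|P.det| ^ 4)⁻¹ *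
        ((symMatrix k (congruence P c)).det ^ 2 * shiftWeight k u (congruence P c)) := by
  have ht := trace_sq_congruence_add hPT hP (isSymm_symMatrix c) u
  have hdet : (P * symMatrix k c * Pᵀ).det ^ 2 = |P.det| ^ 4 * |(symMatrix k c).det| ^ 2 := by
    rw [Matrix.det_mul, Matrix.det_mul, Matrix.det_transpose, ← sq_abs]
    simp only [abs_mul]
    ring
  have hexp : exp (-(u ^ 2 / 2)) * shiftWeight k u (congruence P c) =
      exp (-((y ⬝ᵥ symMatrix k c *ᵥ y + u) ^ 2 / 2)) *
        (exp (-(symMatrix k c *ᵥ y ⬝ᵥ symMatrix k c *ᵥ y)) * shiftWeight k u c) := by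
    rw [shiftWeight, shiftWeight, symMatrix_congruence, ← exp_add, ← exp_add, ← exp_add]
    congr 1
    linarith
  have hP4 : |P.det| ^ 4 ≠ 0 := pow_ne_zero _ (abs_ne_zero.2 hP0)
  rw [symMatrix_congruence P c, hdet]
  by_cases hc : (symMatrix k c).det = 0
  · simp [hc]
  · rw [sourceDensity, det_borderMatrix_mulVec 0 (isSymm_symMatrix c),
      show ((0 - y ⬝ᵥ symMatrix k c *ᵥ y) * (symMatrix k c).det - (symMatrix k c).det * u) /
        (symMatrix k c).det = -(y ⬝ᵥ symMatrix k c *ᵥ y + u) by field_simp; ring, neg_sq]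
    rw [show ∀ A W : ℝ, 2 * A * (|P.det| ^ 4)⁻¹ * (|P.det| ^ 4 * |(symMatrix k c).det| ^ 2 * W) =
      2 * |(symMatrix k c).det| ^ 2 * (A * W) from fun A W => by field_simp, hexp]
    ring

lemma shiftIntegral_det_sq_nonneg :
    0 ≤ shiftIntegral (fun A : Matrix (Fin k) (Fin k) ℝ => A.det ^ 2) u :=
  integral_nonneg fun c => mul_nonneg (sq_nonneg _) (shiftWeight_pos k u c).le

lemma lintegral_sourceDensity_congruence (y : Fin k → ℝ) :
    ∫⁻ c, ENNReal.ofReal (|(symMatrix k c).det| * sourceDensity k u (symMatrix k c *ᵥ y) c) =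
      ENNReal.ofReal (2 * exp (-(u ^ 2 / 2)) *
        shiftIntegral (fun A : Matrix (Fin k) (Fin k) ℝ => A.det ^ 2) u) *
          ENNReal.ofReal ((√(1 + y ⬝ᵥ y) ^ (k + 5))⁻¹) := by
  obtain ⟨P, hPT, hPP, hPd⟩ := exists_symm_mul_self_eq y
  have hy0 : 0 ≤ y ⬝ᵥ y := Finset.sum_nonneg fun i _ => mul_self_nonneg (y i)
  have hs : 0 < √(1 + y ⬝ᵥ y) := sqrt_pos.2 (by linarith)
  have hP0 : P.det ≠ 0 := abs_pos.1 (hPd ▸ hs)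
  have hSI : ∫⁻ c, ENNReal.ofReal ((symMatrix k c).det ^ 2 * shiftWeight k u c) =
      ENNReal.ofReal (shiftIntegral (fun A : Matrix (Fin k) (Fin k) ℝ => A.det ^ 2) u) :=
    (ofReal_integral_eq_lintegral_ofReal (((PolyGrowth.det k).pow 2).integrable_shiftWeight u)
      (Filter.Eventually.of_forall fun c => mul_nonneg (sq_nonneg _)
        (shiftWeight_pos k u c).le)).symm
  have hm : Measurable fun a => ENNReal.ofReal (2 * exp (-(u ^ 2 / 2)) * (|P.det| ^ 4)⁻¹ *
      ((symMatrix k a).det ^ 2 * shiftWeight k u a)) :=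
    ((((continuous_symMatrix k).matrix_det.pow 2).mul
      (continuous_shiftWeight k u)).const_mul _).measurable.ennreal_ofReal
  simp only [sourceDensity_mulVec u hPT hPP hP0]
  rw [lintegral_congruence hP0 hm]
  have e : ∀ a, ENNReal.ofReal (2 * exp (-(u ^ 2 / 2)) * (|P.det| ^ 4)⁻¹ *
      ((symMatrix k a).det ^ 2 * shiftWeight k u a)) =
      ENNReal.ofReal (2 * exp (-(u ^ 2 / 2)) * (|P.det| ^ 4)⁻¹) *
        ENNReal.ofReal ((symMatrix k a).det ^ 2 * shiftWeight k u a) := fun a =>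
    ENNReal.ofReal_mul (by positivity)
  have hSI0 := shiftIntegral_det_sq_nonneg (k := k) u
  simp only [e]
  rw [lintegral_const_mul' _ _ ENNReal.ofReal_ne_top, hSI, ← ENNReal.ofReal_mul (by positivity),
    ← ENNReal.ofReal_mul (by positivity), ← ENNReal.ofReal_mul (by positivity), hPd]
  congr 1
  rw [show k + 5 = k + 1 + 4 by ring, pow_add _ (k + 1) 4]
  field_simp

/-- For fixed `C` the row `b` is replaced by `y`; after swapping, for fixed `y` the block `C` is
replaced by `P C Pᵀ`. Then the variables separate. Nonnegativity lets Tonelli justify the swap. -/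
lemma lintegral_sourceDensity :
    ∫⁻ q : (Fin k → ℝ) × (UpperIdx k → ℝ), ENNReal.ofReal (sourceDensity k u q.1 q.2) =
      ENNReal.ofReal (2 * exp (-(u ^ 2 / 2)) *
        shiftIntegral (fun A : Matrix (Fin k) (Fin k) ℝ => A.det ^ 2) u) *
        ENNReal.ofReal (√π ^ k * Gamma (5 / 2) / Gamma ((k + 5) / 2)) := by
  have hS := continuous_symMatrix k
  have hmv : Measurable fun q : (UpperIdx k → ℝ) × (Fin k → ℝ) =>
      (symMatrix k q.1 *ᵥ q.2, q.1) := by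
    have : Continuous fun q : (UpperIdx k → ℝ) × (Fin k → ℝ) => symMatrix k q.1 *ᵥ q.2 :=
      (hS.comp continuous_fst).matrix_mulVec continuous_snd
    exact this.measurable.prodMk measurable_fst
  have hd : Measurable fun q : (UpperIdx k → ℝ) × (Fin k → ℝ) => |(symMatrix k q.1).det| :=
    (hS.comp continuous_fst).matrix_det.abs.measurable
  have hm := measurable_sourceDensity k u
  have h1 := lintegral_prod_symm (μ := (volume : Measure (Fin k → ℝ)))
    (ν := (volume : Measure (UpperIdx k → ℝ))) _ hm.ennreal_ofReal.aemeasurable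
  refine h1.trans ?_
  simp only [lintegral_sourceDensity_mulVec]
  rw [lintegral_lintegral_swap (hd.mul (hm.comp hmv)).ennreal_ofReal.aemeasurable]
  simp only [lintegral_sourceDensity_congruence]
  rw [lintegral_const_mul' _ _ ENNReal.ofReal_ne_top, lintegral_one_add_sq]

variable (k)

lemma integral_source_abs_det_sub :
    ∫ a, (|(symMatrix _ a).det| - (symMatrix _ a).det) * ((symMatrix _ a 0 0 + u) ^ 2 - 1) *
        shiftWeight (k + 1) u a =
      2 * exp (-(u ^ 2 / 2)) * (√π ^ k * Gamma (5 / 2) / Gamma ((k + 5) / 2)) *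
        shiftIntegral (fun A : Matrix (Fin k) (Fin k) ℝ => A.det ^ 2) u := by
  rw [integral_source k u (φ := fun x => |x| - x) ((PolyGrowth.det _).abs.sub (.det _))]
  simp only [integral_hermite_two_mul_abs_sub]
  refine (integral_congr_ae (g := fun q => sourceDensity k u q.1 q.2)
    (Filter.Eventually.of_forall fun q => ?_)).trans ?_
  · simp only [sourceDensity]
  have hnn : ∀ q : (Fin k → ℝ) × (UpperIdx k → ℝ), 0 ≤ sourceDensity k u q.1 q.2 := fun q =>
    sourceDensity_nonneg k u q.1 q.2
  have hm : AEStronglyMeasurable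
      (fun q : (Fin k → ℝ) × (UpperIdx k → ℝ) => sourceDensity k u q.1 q.2) :=
    (measurable_sourceDensity k u).aestronglyMeasurable
  rw [integral_eq_lintegral_of_nonneg_ae (Filter.Eventually.of_forall hnn) hm]
  have hΓ : 0 < Gamma (((k : ℝ) + 5) / 2) := Gamma_pos_of_pos (by positivity)
  have hΓ' : 0 < Gamma (5 / 2) := Gamma_pos_of_pos (by norm_num)
  have hSI0 := shiftIntegral_det_sq_nonneg (k := k) u
  rw [lintegral_sourceDensity, ← ENNReal.ofReal_mul (by positivity),
    ENNReal.toReal_ofReal (by positivity)]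
  ring

end source

/-! ### Normalization and leading asymptotics. -/

/-- The total mass `∫ exp (-Tr A² / 2) dA`. -/
noncomputable def gaussMass (n : ℕ) : ℝ := ∫ a, shiftWeight n 0 a

lemma gaussMass_zero : gaussMass 0 = 1 := by
  have : ∀ a, shiftWeight 0 0 a = 1 := fun a => by simp [shiftWeight, Matrix.trace]
  simp only [gaussMass, this, integral_const, smul_eq_mul, mul_one]
  rw [measureReal_def, volume_pi, Measure.pi_of_empty]
  simp

lemma gaussMass_succ (k : ℕ) : gaussMass (k + 1) = √(2 * π) * √π ^ k * gaussMass k := by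
  have h0 : Integrable (shiftWeight (k + 1) 0) := by
    simpa using (PolyGrowth.const (n := k + 1) 1).integrable_shiftWeight 0
  have h1 := integral_gaussian_pi k 1
  simp only [neg_mul, one_mul, div_one] at h1
  have h2 := integral_prod_mul (μ := (volume : Measure (Fin k → ℝ)))
    (ν := (volume : Measure (UpperIdx k → ℝ))) (fun b => exp (-(b ⬝ᵥ b))) (shiftWeight k 0)
  rw [h1] at h2
  rw [gaussMass, integral_symSplit h0, gaussMass, mul_assoc, ← h2, ← integral_const_mul]
  refine integral_congr_ae (Filter.Eventually.of_forall fun q => ?_)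
  obtain ⟨b, c⟩ := q
  simp only [shiftWeight_symSplit, integral_mul_const, add_zero, integral_gaussian_half]

lemma gaussMass_eq (n : ℕ) : gaussMass n = √2 ^ n * √π ^ (n * (n + 1) / 2) := by
  induction n with
  | zero => simp [gaussMass_zero]
  | succ k ih =>
    have h : (k + 1) * (k + 1 + 1) / 2 = k * (k + 1) / 2 + (k + 1) := by
      rw [show (k + 1) * (k + 1 + 1) = k * (k + 1) + (k + 1) * 2 by ring,
        Nat.add_mul_div_right _ _ two_pos]
    rw [gaussMass_succ, ih, h, sqrt_mul (by norm_num)]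
    ring

lemma gaussMass_pos (n : ℕ) : 0 < gaussMass n := by
  rw [gaussMass_eq]; positivity

open Filter Topology in
/-- Leading asymptotics when the mean of the ensemble tends to `+∞`. -/
lemma tendsto_shiftIntegral_div {n d : ℕ} {F : Matrix (Fin n) (Fin n) ℝ → ℝ}
    (hF : IsInvariantOfDegree F d) :
    Tendsto (fun u => shiftIntegral F u / (-u) ^ d) atBot (𝓝 (F 1 * gaussMass n)) := by
  set e : UpperIdx n → ℝ := upperEntries 1
  have he : symMatrix n e = 1 := symMatrix_upperEntries Matrix.isSymm_one
  have hen : ‖e‖ ≤ 1 := (pi_norm_le_iff_of_nonneg zero_le_one).2 fun p => by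
    simp only [e, upperEntries, Matrix.one_apply]
    split_ifs <;> simp
  have hw : ∀ u a, shiftWeight n u (a - u • e) = shiftWeight n 0 a := fun u a => by
    have : symMatrix n (a - u • e) = symMatrix n a - u • 1 := by rw [← he]; rfl
    simp [shiftWeight, this]
  have hP := hF.polyGrowth
  -- Recentre at the mean `-u I` and scale by `-u > 0`: homogeneity turns the argument into `I` plus
  -- a vanishing perturbation.
  have hev : ∀ᶠ u : ℝ in atBot, ∫ a, F (symMatrix n (e + (-u)⁻¹ • a)) * shiftWeight n 0 a =
      shiftIntegral F u / (-u) ^ d := by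
    filter_upwards [eventually_lt_atBot (0 : ℝ)] with u hu
    have hu' : 0 < -u := neg_pos.2 hu
    rw [eq_div_iff (by positivity), ← integral_mul_const, shiftIntegral]
    conv_rhs => rw [← integral_sub_right_eq_self _ (u • e)]
    refine integral_congr_ae (Eventually.of_forall fun a => ?_)
    have h : a - u • e = (-u) • (e + (-u)⁻¹ • a) := by
      rw [smul_add, smul_smul, mul_inv_cancel₀ hu'.ne', one_smul, neg_smul, sub_eq_add_neg,
        add_comm]
    simp only [hw]
    rw [h, symMatrix_smul, hF.homogeneous _ _ hu']
    ring
  refine Tendsto.congr' hev ?_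
  obtain ⟨C, m, hC, hb⟩ := hP.bound
  have hB : PolyGrowth fun a : UpperIdx n → ℝ => C * (2 + ‖a‖) ^ m := by
    refine ⟨by fun_prop, C * 2 ^ m, m, by positivity, fun a => ?_⟩
    have := norm_nonneg a
    rw [abs_of_nonneg (by positivity), mul_assoc, ← mul_pow]
    gcongr
    linarith
  have hc := continuous_symMatrix n
  rw [gaussMass, ← integral_const_mul]
  refine tendsto_integral_filter_of_dominated_convergence
    (fun a => C * (2 + ‖a‖) ^ m * shiftWeight n 0 a) ?_ ?_ (hB.integrable_shiftWeight 0) ?_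
  · refine Eventually.of_forall fun u => Continuous.aestronglyMeasurable ?_
    have : Continuous fun a : UpperIdx n → ℝ => e + (-u)⁻¹ • a := by fun_prop
    exact (hP.continuous.comp this).mul (continuous_shiftWeight n 0)
  · filter_upwards [eventually_le_atBot (-1 : ℝ)] with u hu
    refine Eventually.of_forall fun a => ?_
    rw [norm_mul, norm_of_nonneg (shiftWeight_pos n 0 a).le, Real.norm_eq_abs]
    refine mul_le_mul_of_nonneg_right ((hb _).trans ?_) (shiftWeight_pos n 0 a).le
    have h1 : ‖(-u)⁻¹ • a‖ ≤ ‖a‖ := by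
      rw [norm_smul, norm_of_nonneg (inv_nonneg.2 (by linarith))]
      exact mul_le_of_le_one_left (norm_nonneg a) (inv_le_one_of_one_le₀ (by linarith))
    have h2 := norm_add_le e ((-u)⁻¹ • a)
    have h3 : 1 + ‖e + (-u)⁻¹ • a‖ ≤ 2 + ‖a‖ := by linarith
    gcongr
  · refine Eventually.of_forall fun a => Tendsto.mul_const _ ?_
    have h1 : Tendsto (fun u : ℝ => e + (-u)⁻¹ • a) atBot (𝓝 (e + (0 : ℝ) • a)) :=
      ((tendsto_inv_atTop_zero.comp tendsto_neg_atBot_atTop).smul_const a).const_add e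
    have h2 : Tendsto (fun u : ℝ => F (symMatrix n (e + (-u)⁻¹ • a))) atBot
        (𝓝 (F (symMatrix n (e + (0 : ℝ) • a)))) := (hP.continuous.tendsto _).comp h1
    rwa [zero_smul, add_zero, he] at h2

lemma det_mul_self_of_mul_transpose {n : ℕ} {O : Matrix (Fin n) (Fin n) ℝ} (hO : O * Oᵀ = 1) :
    O.det * O.det = 1 := by
  simpa using congrArg Matrix.det hO

lemma isInvariantOfDegree_det_sq (n : ℕ) :
    IsInvariantOfDegree (fun A : Matrix (Fin n) (Fin n) ℝ => A.det ^ 2) (2 * n) where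
  continuous := by fun_prop
  nonneg _ := sq_nonneg _
  homogeneous t A _ := by
    rw [Matrix.det_smul, Fintype.card_fin, mul_pow, ← pow_mul, mul_comm n]
  invariant O A hO := by
    have := det_mul_self_of_mul_transpose hO
    rw [Matrix.det_mul, Matrix.det_mul, Matrix.det_transpose]
    linear_combination A.det ^ 2 * (O.det * O.det + 1) * this

lemma isInvariantOfDegree_abs_det_sub (n : ℕ) :
    IsInvariantOfDegree (fun A : Matrix (Fin n) (Fin n) ℝ => |A.det| - A.det) n where
  continuous := by fun_prop
  nonneg _ := sub_nonneg.2 (le_abs_self _)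
  homogeneous t A ht := by
    rw [Matrix.det_smul, Fintype.card_fin, abs_mul, abs_of_pos (pow_pos ht n)]
    ring
  invariant O A hO := by
    have : (O * A * Oᵀ).det = A.det := by
      rw [Matrix.det_mul, Matrix.det_mul, Matrix.det_transpose]
      linear_combination A.det * det_mul_self_of_mul_transpose hO
    rw [this]

/-! ### Solving the Hermite equations. -/

/-- The second moment of the determinant. -/
theorem shiftIntegral_det_sq (n : ℕ) (u : ℝ) :
    shiftIntegral (fun A : Matrix (Fin n) (Fin n) ℝ => A.det ^ 2) u =
      gaussMass n * goeSquare n u := by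
  induction n generalizing u with
  | zero =>
    have : ∀ a, shiftWeight 0 u a = shiftWeight 0 0 a := fun a => by
      simp [shiftWeight, Matrix.trace]
    simp [shiftIntegral, gaussMass, this, goeSquare_zero]
  | succ k ih =>
    have hF := isInvariantOfDegree_det_sq (k + 1)
    obtain ⟨Φ', Φ'', h1, h2, h3⟩ := shiftIntegral_ode hF
    have hlim := (tendsto_shiftIntegral_div hF).sub
      ((tendsto_goeSquare_div (k + 1)).const_mul (gaussMass (k + 1)))
    rw [Matrix.det_one, one_pow, one_mul, mul_one, sub_self] at hlim
    -- The integral and its closed form have the same source, by the induction hypothesis, and the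
    -- same leading term, so their difference solves the homogeneous equation and is small at `-∞`.
    have key := hermite_ode_eq_zero (d := 2 * (k + 1))
      (fun u => (h1 u).sub ((hasDerivAt_goeSquare (k + 1) u).const_mul (gaussMass (k + 1))))
      (fun u => (h2 u).sub ((hasDerivAt_goeSquareDeriv (k + 1) u).const_mul (gaussMass (k + 1))))
      (fun u => ?_) (hlim.congr fun u => ?_) u
    · simpa [sub_eq_zero] using key
    · have h4 := h3 u
      have h5 := goeSquare_ode k u
      rw [integral_source_det_sq, ih] at h4
      simp only [Pi.sub_apply]
      have hZ := gaussMass_succ k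
      push_cast at h4 h5 ⊢
      linear_combination h4 - gaussMass (k + 1) * h5 -
        (k + 1) * (k + 3) * goeSquare k u * hZ
    · simp only [Pi.sub_apply]; ring

/-- The mean of `|det| - det`. -/
theorem shiftIntegral_abs_det_sub (k : ℕ) (u : ℝ) :
    shiftIntegral (fun A : Matrix (Fin (k + 1)) (Fin (k + 1)) ℝ => |A.det| - A.det) u =
      gaussMass (k + 1) *
        (2 * √2 / ((k + 1 : ℕ) * Gamma ((k + 1 : ℕ) / 2)) * goeExcess (k + 1) u) := by
  have hF := isInvariantOfDegree_abs_det_sub (k + 1)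
  obtain ⟨Φ', Φ'', h1, h2, h3⟩ := shiftIntegral_ode hF
  set c := gaussMass (k + 1) * (2 * √2 / ((k + 1 : ℕ) * Gamma ((k + 1 : ℕ) / 2)))
  have hlim := (tendsto_shiftIntegral_div hF).sub
    ((tendsto_goeExcess_div (k + 1)).const_mul c)
  have key := hermite_ode_eq_zero (d := k + 1)
    (fun u => (h1 u).sub ((hasDerivAt_goeExcess (k + 1) u).const_mul c))
    (fun u => (h2 u).sub ((hasDerivAt_goeExcessDeriv (k + 1) u).const_mul c))
    (fun u => ?_) ?_ u
  · simp only [Pi.sub_apply, sub_eq_zero] at key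
    rw [key, ← mul_assoc]
  · have h4 := h3 u
    have h5 := goeExcess_ode k u
    rw [integral_source_abs_det_sub, shiftIntegral_det_sq] at h4
    have hΓ : 0 < Gamma (((k + 1 : ℕ) : ℝ) / 2) := Gamma_pos_of_pos (by positivity)
    have hΓ5 : Gamma (((k : ℝ) + 5) / 2) =
        (k + 3) / 2 * ((k + 1) / 2 * Gamma (((k + 1 : ℕ) : ℝ) / 2)) := by
      rw [show ((k : ℝ) + 5) / 2 = ((k + 1 : ℕ) : ℝ) / 2 + 1 + 1 by push_cast; ring,
        Gamma_add_one (by positivity), Gamma_add_one (by positivity)]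
      push_cast; ring
    have hΓ52 : Gamma (5 / 2) = 3 / 4 * √π := by
      rw [show (5 / 2 : ℝ) = 1 / 2 + 1 + 1 by norm_num, Gamma_add_one (by norm_num),
        Gamma_add_one (by norm_num), Gamma_one_half_eq]
      ring
    have h2s : √2 * √2 = 2 := mul_self_sqrt (by norm_num)
    -- The constant `c` is chosen so that the source of `c * goeExcess (k + 1)` is that of the
    -- integral.
    have hc : (k + 1) * (k + 3) / 2 * (2 * exp (-(u ^ 2 / 2)) * (√π ^ k * Gamma (5 / 2) /
        Gamma ((k + 5) / 2)) * (gaussMass k * goeSquare k u)) =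
        c * (3 * (k + 1) / 4 * exp (-(u ^ 2 / 2)) * goeSquare k u) := by
      simp only [c]
      rw [gaussMass_succ, hΓ5, hΓ52, sqrt_mul (by norm_num)]
      set G := Gamma (((k + 1 : ℕ) : ℝ) / 2)
      push_cast
      field_simp
      linear_combination (-gaussMass k * goeSquare k u) * h2s
    simp only [Pi.sub_apply]
    rw [hc] at h4
    linear_combination h4 - c * h5
  -- The functional vanishes at the identity, so the integral is `o(|u| ^ (k + 1))` at `-∞`, like
  -- `goeExcess`.
  · have : |(1 : Matrix (Fin (k + 1)) (Fin (k + 1)) ℝ).det| -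
        (1 : Matrix (Fin (k + 1)) (Fin (k + 1)) ℝ).det = 0 := by simp
    rw [this, zero_mul, mul_zero, sub_zero] at hlim
    refine hlim.congr fun u => ?_
    simp only [Pi.sub_apply]; ring

/-! ### Back to the law `goe` and the theorem. -/

lemma goeDensity_symMatrix (n : ℕ) (u : ℝ) (a : UpperIdx n → ℝ) :
    goeDensity n u 1 (symMatrix n a) = (gaussMass n)⁻¹ * shiftWeight n u a := by
  rw [goeDensity, gaussMass_eq, shiftWeight]
  simp only [mul_one, mul_inv]

lemma measurable_goeDensity (n : ℕ) (u : ℝ) :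
    Measurable fun A => ENNReal.ofReal (goeDensity n u 1 A) := by
  refine Measurable.ennreal_ofReal (Continuous.measurable ?_)
  have : Continuous fun A : Matrix (Fin n) (Fin n) ℝ => ((A + u • 1) ^ 2).trace := by fun_prop
  unfold goeDensity
  fun_prop

lemma goeDensity_nonneg (n : ℕ) (u v : ℝ) (A) : 0 ≤ goeDensity n u v A := by
  unfold goeDensity; positivity

lemma integral_goe (n : ℕ) (u : ℝ) {f : Matrix (Fin n) (Fin n) ℝ → ℝ} (hf : Continuous f) :
    ∫ A, f A ∂(goe n u 1) = (gaussMass n)⁻¹ * shiftIntegral f u := by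
  have hS := (continuous_symMatrix n).measurable
  have hm : Measurable fun A => (ENNReal.ofReal (goeDensity n u 1 A)).toReal • f A :=
    (measurable_goeDensity n u).ennreal_toReal.smul hf.measurable
  rw [goe, integral_withDensity_eq_integral_toReal_smul (measurable_goeDensity n u)
    (Filter.Eventually.of_forall fun _ => ENNReal.ofReal_lt_top), symLebesgue,
    integral_map hS.aemeasurable hm.aestronglyMeasurable, shiftIntegral, ← integral_const_mul]
  refine integral_congr_ae (Filter.Eventually.of_forall fun a => ?_)
  simp only
  rw [ENNReal.toReal_ofReal (goeDensity_nonneg _ _ _ _), goeDensity_symMatrix, smul_eq_mul]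
  ring

lemma integrable_goe (n : ℕ) (u : ℝ) {f : Matrix (Fin n) (Fin n) ℝ → ℝ} (hf : Continuous f)
    (hg : PolyGrowth fun a => f (symMatrix n a)) : Integrable f (goe n u 1) := by
  have hS := (continuous_symMatrix n).measurable
  have hm : Measurable fun A => (ENNReal.ofReal (goeDensity n u 1 A)).toReal • f A :=
    (measurable_goeDensity n u).ennreal_toReal.smul hf.measurable
  rw [goe, integrable_withDensity_iff_integrable_smul' (measurable_goeDensity n u)
    (Filter.Eventually.of_forall fun _ => ENNReal.ofReal_lt_top), symLebesgue,
    integrable_map_measure hm.aestronglyMeasurable hS.aemeasurable]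
  refine ((hg.integrable_shiftWeight u).const_mul (gaussMass n)⁻¹).congr
    (Filter.Eventually.of_forall fun a => ?_)
  simp only [Function.comp]
  rw [ENNReal.toReal_ofReal (goeDensity_nonneg _ _ _ _), goeDensity_symMatrix, smul_eq_mul]
  ring

lemma integrable_det_goe (n : ℕ) (u : ℝ) :
    Integrable (fun A : Matrix (Fin n) (Fin n) ℝ => A.det) (goe n u 1) :=
  integrable_goe n u (by fun_prop) (PolyGrowth.det n)

lemma expAbsDet_eq (k : ℕ) (u : ℝ) : expAbsDet (k + 1) u = expDet (k + 1) u +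
    2 * √2 / ((k + 1 : ℕ) * Gamma ((k + 1 : ℕ) / 2)) * goeExcess (k + 1) u := by
  have hi := integrable_det_goe (k + 1) u
  rw [← sub_eq_iff_eq_add', expAbsDet, expDet, ← integral_sub hi.abs hi,
    integral_goe _ _ (by fun_prop), shiftIntegral_abs_det_sub, inv_mul_cancel_left₀
    (gaussMass_pos _).ne']

theorem theorem1p1 (n k : ℕ) (u : ℝ) :
    Integrable (fun A : Matrix (Fin n) (Fin n) ℝ => A.det) (goe n u 1) ∧
    (n = 2 * (k + 1) →
      expAbsDet n u = expDet n u +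
        √(2 * π) * exp (-(u ^ 2 / 2)) / (∏ i ∈ Finset.Icc 1 n, Gamma ((i : ℝ) / 2)) *
          ∑ i : Fin (k + 1), ∑ j : Fin (k + 1),
            (deleteRowCol (gammaMatrix₁ (k + 1)) i j).det *
              Matrix.det
                !![hermiteP (2 * ((i : ℤ) + 1) - 1) u, hermiteP (2 * ((j : ℤ) + 1)) u;
                   hermiteP (2 * ((i : ℤ) + 1) - 2) u, hermiteP (2 * ((j : ℤ) + 1) - 1) u]) ∧
    (n = 2 * (k + 1) - 1 →
      expAbsDet n u = expDet n u +
        √2 * exp (-(u ^ 2 / 2)) / (∏ i ∈ Finset.Icc 1 n, Gamma ((i : ℝ) / 2)) *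
          ∑ i : Fin (k + 1), ∑ j : Fin (k + 1),
            (deleteRowCol (gammaMatrix₂ (k + 1)) i j).det *
              Matrix.det
                !![hermiteP (2 * (i : ℤ)) u, hermiteP (2 * (j : ℤ) + 1) u;
                   hermiteP (2 * (i : ℤ) - 1) u, hermiteP (2 * (j : ℤ)) u]) := by
  refine ⟨integrable_det_goe n u, ?_, ?_⟩
  · rintro rfl
    rw [minors_formula_even]
    exact expAbsDet_eq (2 * k + 1) u
  · intro hn
    obtain rfl : n = 2 * k + 1 := by omega
    rw [minors_formula_odd]
    exact expAbsDet_eq (2 * k) u
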